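/- **Setting.** Let $B\ge 2$ be the section size and let $p_0$ be the uniform distribution on the $B$ unit vectors of $\mathbb R^B$ with a single component equal to $1$. Let $P_{\rm out}(y|x)$, $x\in\mathbb R$, be a memoryless channel with a (measurable) transition density with respect to a $\sigma$-finite reference measure $dy$ on the output alphabet. For $0\le E\le 1$, $p,z\in\mathbb R$ put $$f(y|p,E)=\int du\,P_{\rm out}(y|u)\,\mathcal N(u|p,E),\qquad \mathcal F(p|E)=\int dy\,f(y|p,E)\big(\partial_x\ln f(y|x,E)\big)^2_{x=p},\qquad \phi(y|z,E)=f(y|z\sqrt{1-E},E).$$ For a rate $R>0$ put $\Sigma(E)^{-2}=\frac1R\,\mathbb E_{p\sim\mathcal N(0,1-E)}[\mathcal F(p|E)]\in[0,\infty]$, where the value at $E=0$ is understood as the limit for $E\downarrow 0$ (possibly $\infty$). Assume that $\mathbb E_{z\sim\mathcal N(0,1)}\int dy\,|\phi\log_2\phi|<\infty$ for all $E\in[0,1]$. Let $\mathbf s\sim p_0$ and $\mathbf z\sim\mathcal N(0,\mathbf I_B)$ be independent, and let $$\theta(\mathbf x,\mathbf s,\mathbf z,\Sigma)=\exp\Big(-\frac{\|\mathbf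 x-(\mathbf s+\mathbf z\,\Sigma/\sqrt{\log_2 B})\|_2^2}{2\Sigma^2/\log_2 B}\Big),\qquad g_{{\rm in},i}=\frac{\sum_{\mathbf x}p_0(\mathbf x)\,\theta\, x_i}{\sum_{\mathbf x}p_0(\mathbf x)\,\theta},\qquad m(\Sigma)=\mathbb E_{\mathbf s,\mathbf z}\Big[\sum_{i=1}^B(g_{{\rm in},i}(\mathbf s,\mathbf z,\Sigma)-s_i)^2\Big],$$ with $\theta$ extended by its limits to $\Sigma\in\{0,\infty\}$. *Underlying ensemble.* Let $T_{\rm u}(E)=m(\Sigma(E))$, $T_{\rm u}^{(\infty)}(E)=\lim_t T_{\rm u}^t(E)$, $E_0=T_{\rm u}^{(\infty)}(0)$ and $\mathcal V_0=\{E\in[0,1] : T_{\rm u}^{(\infty)}(E)=E_0\}$. Let $F_{\rm u}(E)=U_{\rm u}(E)-S_{\rm u}(\Sigma(E))$ with $$U_{\rm u}(E)=-\frac{E}{2\ln(2)\Sigma(E)^2}-\frac1R\,\mathbb E_z\Big[\int dy\,\phi\log_2\phi\Big],\qquad S_{\rm u}(\Sigma)=\mathbb E_{\mathbf s,\mathbf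 z}\Big[\log_B\sum_{\mathbf x}p_0(\mathbf x)\,\theta(\mathbf x,\mathbf s,\mathbf z,\Sigma)\Big]$$ (the first term of $U_{\rm u}$ being $0$ at $E=0$), let $\Delta F_{\rm u}=\inf_{E\in[0,1]\setminus\mathcal V_0}(F_{\rm u}(E)-F_{\rm u}(E_0))$ with $\inf\emptyset=\infty$, and let $R_{\rm pot}=\sup\{R>0 : \Delta F_{\rm u}>0\}\in[0,\infty]$. *Coupled ensemble.* Let $g_w$ $(w\ge1)$ be design functions: $g_w(x)=0$ for $|x|>1$, $g_w(x)\ge g_0>0$ for $|x|\le1$, and $g_w$ is Lipschitz on $[-1,1]$ with constant $g_*$, where $g_0,g_*$ do not depend on $w$. For $1\le r,c\le\Gamma$ let $J_{r,c}=\gamma_r\Gamma g_w((r-c)/w)/(2w+1)$, where $\gamma_r$ is fixed by $\sum_{c}J_{r,c}/\Gamma=1$. For a profile $\mathbf E\in[0,1]^\Gamma$ let $$\Sigma_c(\mathbf E)^{-2}=\sum_{r=1}^\Gamma\frac{J_{r,c}}{\Gamma\,\Sigma(E_r)^2},\qquad [T_{\rm c}(\mathbf E)]_r=\sum_{c=1}^\Gamma\frac{J_{r,c}}{\Gamma}\,m(\Sigma_c(\mathbf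 E)).$$ Let $\mathcal R=\{1,\dots,3w\}\cup\{\Gamma-3w+1,\dots,\Gamma\}$. The state evolution is $E_r^{(0)}=1$ and $E_r^{(t+1)}=[T_{\rm c}(\mathbf E^{(t)})]_r$ for $r\notin\mathcal R$, and $E^{(t)}_r=0$ for $r\in\mathcal R$ and all $t$; its limit is denoted $T_{\rm c}^{(\infty)}(\mathbf 1)$. Let $\mathbf E_0$ be the constant profile $E_0$, and write $\mathbf E\prec\mathbf G$ if $E_r\le G_r$ for all $r$ with strict inequality for at least one $r$. The GAMP threshold of the coupled ensemble is $$R_{\rm c}=\liminf_{w\to\infty}\ \liminf_{\Gamma\to\infty}\ \sup\{R>0 : T_{\rm c}^{(\infty)}(\mathbf 1)\prec\mathbf E_0\}\in[0,\infty],$$ where, in the case $E_0=0$ (in which nothing is strictly below $\mathbf E_0$), the condition is read as $T_{\rm c}^{(\infty)}(\mathbf 1)=\mathbf E_0$. **Statement.** $R_{\rm c}\ge R_{\rm pot}$. -/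

import Mathlib

open MeasureTheory ProbabilityTheory Filter Topology
open scoped ENNReal

namespace SparseSuperposition

noncomputable section

/-- A memoryless channel with real input `x` and output in `Y`, given by its transition
density `P_out(y|x)` with respect to a reference measure `ν` on `Y` (Lebesgue measure for a
continuous output alphabet, counting measure for a discrete one). -/
structure MemorylessChannel {Y : Type*} [MeasurableSpace Y] (ν : Measure Y) where
  density : ℝ → Y → ℝ
  measurable_density : Measurable (Function.uncurry density)
  density_nonneg : ∀ x y, 0 ≤ density x y
  lintegral_density : ∀ x, ∫⁻ y, ENNReal.ofReal (density x y) ∂ν = 1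

variable {Y : Type*} [MeasurableSpace Y] {ν : Measure Y}

/-! ### Effective noise -/

/-- `f(y|p,E) = ∫ du P_out(y|u) 𝒩(u|p,E)`. -/
def smoothed (P : MemorylessChannel ν) (E p : ℝ) (y : Y) : ℝ :=
  ∫ u, P.density u y ∂(gaussianReal p E.toNNReal)

/-- The Fisher information `ℱ(p|E) = ∫ dy f(y|p,E) (∂ₓ ln f(y|x,E))²|_{x=p}`. -/
def fisher (P : MemorylessChannel ν) (E p : ℝ) : ℝ≥0∞ :=
  ∫⁻ y, ENNReal.ofReal
    (smoothed P E p y * (deriv (fun x => Real.log (smoothed P E x y)) p) ^ 2) ∂ν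

/-- `𝔼_{p|E}[ℱ(p|E)]` with `p ∼ 𝒩(0,1-E)`. For `E > 0` this is the formula itself, in which
`f(y|·,E)` is smooth. At `E = 0` there is no smoothing left and `P_out(y|·)` need not be
differentiable (binary-input channels with `π = sign`), so the value at `0` is the limit for
`E ↓ 0`, which may be infinite. -/
def meanFisher (P : MemorylessChannel ν) (E : ℝ) : ℝ≥0∞ :=
  if 0 < E then ∫⁻ p, fisher P E p ∂(gaussianReal 0 (1 - E).toNNReal)
  else limsup (fun e : ℝ => ∫⁻ p, fisher P e p ∂(gaussianReal 0 (1 - e).toNNReal)) (𝓝[>] 0)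

/-- The inverse effective noise variance `Σ(E)⁻² = 𝔼_{p|E}[ℱ(p|E)] / R`, in `[0,∞]`. -/
def invNoise (P : MemorylessChannel ν) (R E : ℝ) : ℝ≥0∞ :=
  meanFisher P E / ENNReal.ofReal R

/-! ### Denoiser of a section -/

/-- The section of size `B` whose only non-zero component is a `1` at position `j`. The prior
`p₀` is the uniform distribution on these `B` vectors. -/
def sect (B : ℕ) (j : Fin B) : Fin B → ℝ := Pi.single j 1

/-- The weight `θ(x,s,z,Σ)` as a function of `τ = Σ⁻² ∈ [0,∞]`. For `0 < Σ < ∞` it equals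
`exp (-‖x - (s + z Σ/√(log₂ B))‖² / (2 Σ²/log₂ B))`, see `theta_eq`; after cancelling `Σ` the
formula also makes sense for `Σ = ∞`. The case `Σ = 0` is the limit `Σ → 0`. -/
def theta (B : ℕ) (τ : ℝ≥0∞) (x s z : Fin B → ℝ) : ℝ :=
  if τ = ∞ then (if x = s then Real.exp (-(∑ i, z i ^ 2) / 2) else 0)
  else Real.exp (-(∑ i, (√(τ.toReal * Real.logb 2 B) * (x i - s i) - z i) ^ 2) / 2)

theorem theta_eq (B : ℕ) (hB : 2 ≤ B) (σ : ℝ) (hσ : 0 < σ) (x s z : Fin B → ℝ) :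
    theta B (ENNReal.ofReal (σ ^ 2)⁻¹) x s z =
      Real.exp (-(∑ i, (x i - (s i + z i * σ / √(Real.logb 2 B))) ^ 2) /
        (2 * σ ^ 2 / Real.logb 2 B)) := by
  have hL : 0 < Real.logb 2 B := Real.logb_pos (by norm_num) (by exact_mod_cast hB)
  have hsq : √(Real.logb 2 B) ^ 2 = Real.logb 2 B := Real.sq_sqrt hL.le
  have hs0 : 0 < √(Real.logb 2 B) := Real.sqrt_pos.2 hL
  have h1 : √((σ ^ 2)⁻¹ * Real.logb 2 B) = √(Real.logb 2 B) / σ := by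
    rw [Real.sqrt_mul (by positivity), Real.sqrt_inv, Real.sqrt_sq hσ.le]
    field_simp
  rw [theta, if_neg ENNReal.ofReal_ne_top, ENNReal.toReal_ofReal (by positivity), h1]
  congr 1
  rw [← Finset.sum_neg_distrib, ← Finset.sum_neg_distrib, Finset.sum_div, Finset.sum_div]
  refine Finset.sum_congr rfl fun i _ => ?_
  generalize √(Real.logb 2 B) = q at *
  rw [← hsq]
  field_simp
  ring

/-- The denoiser `g_{in,i}(s,z,Σ)` for `τ = Σ⁻²`; the common factor `1/B` of the prior is kept
in numerator and denominator. -/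
def denoiser (B : ℕ) (τ : ℝ≥0∞) (s z : Fin B → ℝ) (i : Fin B) : ℝ :=
  (∑ k : Fin B, (1 / (B : ℝ)) * theta B τ (sect B k) s z * sect B k i) /
    (∑ k : Fin B, (1 / (B : ℝ)) * theta B τ (sect B k) s z)

/-- `𝔼_{s,z}[h(s,z)]` with `s ∼ p₀` and `z ∼ 𝒩(0, I_B)` independent. -/
def expSZ (B : ℕ) (h : (Fin B → ℝ) → (Fin B → ℝ) → ℝ) : ℝ :=
  ∑ j : Fin B, (1 / (B : ℝ)) *
    ∫ z, h (sect B j) z ∂(Measure.pi fun _ : Fin B => gaussianReal 0 1)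

/-- `𝔼_{s,z}[∑ᵢ (g_{in,i}(s,z,Σ) - sᵢ)²]` for `τ = Σ⁻²`. -/
def mse (B : ℕ) (τ : ℝ≥0∞) : ℝ :=
  expSZ B fun s z => ∑ i, (denoiser B τ s z i - s i) ^ 2

/-! ### State evolution of the underlying ensemble -/

/-- The operator `T_u`. -/
def Tu (P : MemorylessChannel ν) (B : ℕ) (R E : ℝ) : ℝ := mse B (invNoise P R E)

/-- `T_u^{(∞)}(E) = lim_t T_u^t(E)`. -/
def TuLim (P : MemorylessChannel ν) (B : ℕ) (R E : ℝ) : ℝ :=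
  limUnder atTop fun t : ℕ => (Tu P B R)^[t] E

/-- The MSE floor `E₀ = T_u^{(∞)}(0)`. -/
def floorMSE (P : MemorylessChannel ν) (B : ℕ) (R : ℝ) : ℝ := TuLim P B R 0

/-- The basin of attraction `𝒱₀` of the MSE floor. -/
def basin (P : MemorylessChannel ν) (B : ℕ) (R : ℝ) : Set ℝ :=
  {E | E ∈ Set.Icc 0 1 ∧ TuLim P B R E = floorMSE P B R}

/-! ### Potential of the underlying ensemble -/

/-- `φ(y|z,E) = ∫ dx P_out(y|x) 𝒩(x|z√(1-E),E)`. -/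
def phi (P : MemorylessChannel ν) (E z : ℝ) (y : Y) : ℝ := smoothed P E (z * √(1 - E)) y

/-- `𝔼_z[∫ dy φ log₂ φ]` is an absolutely convergent integral for every `E ∈ [0,1]`, that is,
the conditional entropies appearing in the potential are well defined and finite. -/
def FiniteEntropy (P : MemorylessChannel ν) : Prop :=
  ∀ E ∈ Set.Icc (0 : ℝ) 1,
    Integrable (fun q : ℝ × Y => phi P E q.1 q.2 * Real.logb 2 (phi P E q.1 q.2))
      ((gaussianReal 0 1).prod ν)

/-- `U_u(E)`. The product `E · Σ(E)⁻²` is taken in `[0,∞]`, with `0 · ∞ = 0` (relevant only for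
`E = 0`). -/
def Uu (P : MemorylessChannel ν) (R E : ℝ) : ℝ :=
  -((ENNReal.ofReal E * invNoise P R E).toReal / (2 * Real.log 2)) -
    (1 / R) * ∫ z, (∫ y, phi P E z y * Real.logb 2 (phi P E z y) ∂ν) ∂(gaussianReal 0 1)

/-- `S_u(Σ)` for `τ = Σ⁻²`. -/
def Su (B : ℕ) (τ : ℝ≥0∞) : ℝ :=
  expSZ B fun s z => Real.logb B (∑ k : Fin B, (1 / (B : ℝ)) * theta B τ (sect B k) s z)

/-- The potential `F_u(E) = U_u(E) - S_u(Σ(E))`. -/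
def Fu (P : MemorylessChannel ν) (B : ℕ) (R E : ℝ) : ℝ := Uu P R E - Su B (invNoise P R E)

/-- The free energy gap `ΔF_u`, equal to `∞` if every `E ∈ [0,1]` lies in the basin. -/
def gap (P : MemorylessChannel ν) (B : ℕ) (R : ℝ) : EReal :=
  ⨅ E ∈ Set.Icc (0 : ℝ) 1 \ basin P B R, ((Fu P B R E - Fu P B R (floorMSE P B R) : ℝ) : EReal)

/-- The potential threshold `R_pot = sup {R > 0 | ΔF_u > 0}`, in `[0,∞]`. -/
def Rpot (P : MemorylessChannel ν) (B : ℕ) : ℝ≥0∞ :=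
  ⨆ R ∈ {R : ℝ | 0 < R ∧ 0 < gap P B R}, ENNReal.ofReal R

/-! ### The coupled ensemble -/

/-- `g w` is the design function of window `w`; the constants `g₀` and `gL` do not depend
on `w`. -/
structure IsDesign (g : ℕ → ℝ → ℝ) (g₀ gL : ℝ) : Prop where
  pos : 0 < g₀
  eq_zero : ∀ w, 1 ≤ w → ∀ x, 1 < |x| → g w x = 0
  le : ∀ w, 1 ≤ w → ∀ x, |x| ≤ 1 → g₀ ≤ g w x
  lipschitz : ∀ w, 1 ≤ w → ∀ x y, |x| ≤ 1 → |y| ≤ 1 → |g w x - g w y| ≤ gL * |x - y|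

/-- The factor `γ_r`, fixed by the normalization `∑_c J_{r,c}/Γ = 1`. -/
def rowFactor (g : ℕ → ℝ → ℝ) (Γ w : ℕ) (r : Fin Γ) : ℝ :=
  (2 * w + 1) / ∑ c : Fin Γ, g w (((r : ℝ) - (c : ℝ)) / w)

/-- The block variances `J_{r,c} = γ_r Γ g_w((r-c)/w) / (2w+1)`. -/
def J (g : ℕ → ℝ → ℝ) (Γ w : ℕ) (r c : Fin Γ) : ℝ :=
  rowFactor g Γ w r * Γ * g w (((r : ℝ) - (c : ℝ)) / w) / (2 * w + 1)

theorem sum_J (g : ℕ → ℝ → ℝ) (g₀ gL : ℝ) (hg : IsDesign g g₀ gL) (Γ w : ℕ) (hw : 1 ≤ w)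
    (r : Fin Γ) : ∑ c, J g Γ w r c / Γ = 1 := by
  have hΓ : (0 : ℝ) < Γ := by exact_mod_cast r.pos
  have hnn : ∀ x, 0 ≤ g w x := fun x => by
    rcases le_or_gt |x| 1 with h | h
    · exact hg.pos.le.trans (hg.le w hw x h)
    · exact (hg.eq_zero w hw x h).ge
  have hpos : 0 < ∑ c : Fin Γ, g w (((r : ℝ) - (c : ℝ)) / w) := by
    refine Finset.sum_pos' (fun c _ => hnn _) ⟨r, Finset.mem_univ r, ?_⟩
    exact hg.pos.trans_le (hg.le w hw _ (by simp))
  have h2 : (0 : ℝ) < 2 * w + 1 := by positivity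
  have : ∀ c, J g Γ w r c / Γ = g w (((r : ℝ) - (c : ℝ)) / w) /
      ∑ c : Fin Γ, g w (((r : ℝ) - (c : ℝ)) / w) := fun c => by
    unfold J rowFactor
    field_simp
  simp_rw [this]
  rw [← Finset.sum_div, div_self hpos.ne']

/-- The pinned positions `{1,…,3w} ∪ {Γ-3w+1,…,Γ}`; block number `r + 1` is `r : Fin Γ`. -/
def Pinned (Γ w : ℕ) (r : Fin Γ) : Prop := (r : ℕ) + 1 ≤ 3 * w ∨ Γ + 1 ≤ (r : ℕ) + 1 + 3 * w

/-- `Σ_c(E)⁻² = ∑_r J_{r,c} / (Γ Σ(E_r)²)`. -/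
def blockInvNoise (P : MemorylessChannel ν) (g : ℕ → ℝ → ℝ) (R : ℝ) (Γ w : ℕ)
    (E : Fin Γ → ℝ) (c : Fin Γ) : ℝ≥0∞ :=
  ∑ r, ENNReal.ofReal (J g Γ w r c / Γ) * invNoise P R (E r)

/-- The operator `T_c`. -/
def Tc (P : MemorylessChannel ν) (B : ℕ) (g : ℕ → ℝ → ℝ) (R : ℝ) (Γ w : ℕ)
    (E : Fin Γ → ℝ) (r : Fin Γ) : ℝ :=
  ∑ c, J g Γ w r c / Γ * mse B (blockInvNoise P g R Γ w E c)

open Classical in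
/-- The profile with value `E r` at unpinned positions and `0` at pinned ones. -/
def pin (Γ w : ℕ) (E : Fin Γ → ℝ) (r : Fin Γ) : ℝ := if Pinned Γ w r then 0 else E r

/-- State evolution `E^{(t)}` of the coupled system, started from the all ones vector, with the
pinning condition enforced at all times. -/
def seProfile (P : MemorylessChannel ν) (B : ℕ) (g : ℕ → ℝ → ℝ) (R : ℝ) (Γ w : ℕ) :
    ℕ → Fin Γ → ℝ
  | 0 => pin Γ w fun _ => 1
  | t + 1 => pin Γ w (Tc P B g R Γ w (seProfile P B g R Γ w t))

/-- The limiting profile `T_c^{(∞)}(1)`. -/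
def TcLim (P : MemorylessChannel ν) (B : ℕ) (g : ℕ → ℝ → ℝ) (R : ℝ) (Γ w : ℕ) : Fin Γ → ℝ :=
  limUnder atTop (seProfile P B g R Γ w)

/-- `E` is strictly better than `G`: `G` is strictly degraded with respect to `E`. -/
def StrictlyBelow {Γ : ℕ} (E G : Fin Γ → ℝ) : Prop := (∀ r, E r ≤ G r) ∧ ∃ r, E r < G r

/-- Decoding succeeds: `T_c^{(∞)}(1) ≺ 𝐄₀`. If the floor `E₀` is `0`, no profile is strictly
below it, and success means that the floor profile itself is reached. -/
def CoupledSucceeds (P : MemorylessChannel ν) (B : ℕ) (g : ℕ → ℝ → ℝ) (Γ w : ℕ) (R : ℝ) : Prop :=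
  StrictlyBelow (TcLim P B g R Γ w) (fun _ => floorMSE P B R) ∨
    (floorMSE P B R = 0 ∧ TcLim P B g R Γ w = fun _ => floorMSE P B R)

/-- The GAMP threshold `R_c` of the coupled ensemble, in `[0,∞]`: the limit inferior of
`sup {R > 0 | T_c^{(∞)}(1) ≺ 𝐄₀}` for first `Γ → ∞` and then `w → ∞`. -/
def Rc (P : MemorylessChannel ν) (B : ℕ) (g : ℕ → ℝ → ℝ) : ℝ≥0∞ :=
  liminf (fun w : ℕ => liminf (fun Γ : ℕ =>
    ⨆ R ∈ {R : ℝ | 0 < R ∧ CoupledSucceeds P B g Γ w R}, ENNReal.ofReal R) atTop) atTop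

end

end SparseSuperposition

namespace SparseSuperposition

/-! ### A discrete potential inequality -/

/-! Fix `R` with `0 < gap P B R`. It suffices that for all large `w` and every `Γ > 0` the coupled
recursion succeeds at this `R`. Up to the factor 2 ln 2 the potential is G(E) − E h(E) + M(h(E)),
where h = Σ⁻², G is 2/R times the conditional entropy of the output in nats, and M = `sectPot`. Two
information inequalities tie it to state evolution. The slope of M is `mse`, which is nonincreasing
(I-MMSE, `mse_mul_le_sectPot_sub`). G grows at rate at most h, which is nonincreasing too
(`condEnt_sub_le`, an integrated de Bruijn inequality obtained from the Gaussian logarithmic Sobolev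
inequality). Only these one-sided bounds and monotonicity enter; neither differentiability of the
potential nor continuity of the recursion is needed.

Threshold saturation is then a summation by parts. On the integer line, run the recursion with the
bulk kernel, with a seed ε held at negative positions and the profile continued as a constant to the
right of N. Started from 1 it decreases in time and stays nondecreasing in space, so at some time it
is almost stationary. For such a profile the increments of the potential from the left end to the
right end telescope (`potential_le_of_subsolution`). Besides the errors of stationarity and of the
seed, the only loss comes from displacing the kernel by one position. It is h(ε) times the total
variation of the kernel, which is O(1/w) because the design functions are bounded below and
Lipschitz uniformly in `w`. So, uniformly in Γ, the potential of the right end value x exceeds that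
of the floor by less than the gap, and x lies in the basin. As x dominates the whole coupled
profile, all later profiles are below the scalar iterates of x, which tend to E₀.

The seed has to be positive, since h(0) may be infinite (`exists_seed`). If E₀ > 0, take ε = E₀. If
E₀ = 0, a small ε is a subsolution only up to the error ε; the resulting cost ε h(ε) cancels the
term −ε h(ε) of the potential, and what remains is that G(ε) is at most G(0) plus an arbitrarily
small error for suitable small ε (`exists_condEnt_le`). -/

theorem sum_Icc_telescope (u : ℤ → ℝ) (L U : ℤ) (h : L ≤ U) :
    ∑ r ∈ Finset.Icc L U, (u r - u (r - 1)) = u U - u (L - 1) := by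
  obtain ⟨n, rfl⟩ := Int.le.dest h
  induction n with
  | zero => simp
  | succ n ih =>
    have : Finset.Icc L (L + ((n + 1 : ℕ) : ℤ)) =
        insert (L + ((n + 1 : ℕ) : ℤ)) (Finset.Icc L (L + (n : ℤ))) := by
      ext x; simp only [Finset.mem_Icc, Finset.mem_insert]; push_cast; omega
    rw [this, Finset.sum_insert (by simp), ih (by omega)]
    have e : L + ((n + 1 : ℕ) : ℤ) - 1 = L + n := by push_cast; ring
    rw [e]; ring

theorem sum_Icc_shift (f : ℤ → ℝ) (N k : ℤ) (w : ℕ) (hk : k ∈ Finset.Icc (-(w : ℤ)) w)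
    (hf : ∀ r, r ∉ Finset.Icc 0 N → f r = 0) :
    ∑ c ∈ Finset.Icc (-(w : ℤ)) (N + w), f (c + k) = ∑ r ∈ Finset.Icc 0 N, f r := by
  have h1 : ∑ c ∈ Finset.Icc (-(w : ℤ)) (N + w), f (c + k) =
      ∑ r ∈ Finset.Icc (-(w : ℤ) + k) (N + w + k), f r := by
    rw [← Finset.map_add_right_Icc, Finset.sum_map]; rfl
  rw [h1]
  symm
  refine Finset.sum_subset (fun r hr => ?_) fun r _ hr => hf r hr
  simp only [Finset.mem_Icc] at *; omega

/-- The weighted block sums `∑_k a_k f(c+k)`. -/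
noncomputable def smoothL (w : ℕ) (a f : ℤ → ℝ) (c : ℤ) : ℝ :=
  ∑ k ∈ Finset.Icc (-(w : ℤ)) w, a k * f (c + k)

/-- The adjoint weighted block sums `∑_k a_k f(r-k)`. -/
noncomputable def smoothR (w : ℕ) (a f : ℤ → ℝ) (r : ℤ) : ℝ :=
  ∑ k ∈ Finset.Icc (-(w : ℤ)) w, a k * f (r - k)

/-- Moving the evaluation point by one is the same as moving the kernel by one, so the increment is
at most the total variation of `a`. The range up to `w + 1` includes the jump of `a` to zero at the
right end. -/
theorem smoothR_sub_le (w : ℕ) (a f : ℤ → ℝ) (κ : ℝ)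
    (hsupp : ∀ k, k ∉ Finset.Icc (-(w : ℤ)) w → a k = 0)
    (hκ : ∑ k ∈ Finset.Icc (-(w : ℤ)) (w + 1), |a k - a (k - 1)| ≤ κ)
    (hf0 : ∀ c, 0 ≤ f c) (hf1 : ∀ c, f c ≤ 1) (r : ℤ) :
    smoothR w a f r - smoothR w a f (r - 1) ≤ κ := by
  have h1 : smoothR w a f r = ∑ k ∈ Finset.Icc (-(w : ℤ)) (w + 1), a k * f (r - k) := by
    refine Finset.sum_subset (Finset.Icc_subset_Icc le_rfl (by omega)) fun k _ hk => ?_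
    rw [hsupp k hk, zero_mul]
  have h2 : smoothR w a f (r - 1) =
      ∑ k ∈ Finset.Icc (-(w : ℤ)) (w + 1), a (k - 1) * f (r - k) := by
    have e : smoothR w a f (r - 1) =
        ∑ k ∈ Finset.Icc (-(w : ℤ) + 1) (w + 1), a (k - 1) * f (r - k) := by
      rw [← Finset.map_add_right_Icc, Finset.sum_map]
      refine Finset.sum_congr rfl fun k _ => ?_
      simp only [addRightEmbedding_apply, add_sub_cancel_right]
      congr 2; ring
    rw [e]
    refine Finset.sum_subset (Finset.Icc_subset_Icc (by omega) le_rfl) fun k hk hk' => ?_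
    rw [hsupp (k - 1), zero_mul]
    simp only [Finset.mem_Icc] at *; omega
  rw [h1, h2, ← Finset.sum_sub_distrib]
  refine le_trans (Finset.sum_le_sum fun k _ => ?_) hκ
  rw [← sub_mul]
  calc (a k - a (k - 1)) * f (r - k) ≤ |a k - a (k - 1)| * f (r - k) :=
        mul_le_mul_of_nonneg_right (le_abs_self _) (hf0 _)
    _ ≤ |a k - a (k - 1)| * 1 := mul_le_mul_of_nonneg_left (hf1 _) (abs_nonneg _)
    _ = _ := mul_one _

/-- Along a nondecreasing profile that is almost a subsolution of the coupled recursion, the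
single-system potential increases by at most the variation of the kernel. -/
theorem potential_le_of_subsolution (w : ℕ) (a : ℤ → ℝ) (κ η ε x : ℝ) (N : ℤ) (hN : 0 ≤ N)
    (ha : ∀ k, 0 ≤ a k) (hsupp : ∀ k, k ∉ Finset.Icc (-(w : ℤ)) w → a k = 0)
    (hsum : ∑ k ∈ Finset.Icc (-(w : ℤ)) w, a k = 1)
    (hκ : ∑ k ∈ Finset.Icc (-(w : ℤ)) (w + 1), |a k - a (k - 1)| ≤ κ) (hη : 0 ≤ η)
    (h m G M : ℝ → ℝ)
    (hh : ∀ s t, ε ≤ s → s ≤ t → t ≤ x → h t ≤ h s) (hh0 : ∀ s, ε ≤ s → s ≤ x → 0 ≤ h s)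
    (hm0 : ∀ t, 0 ≤ t → 0 ≤ m t) (hm1 : ∀ t, 0 ≤ t → m t ≤ 1)
    (hG : ∀ s t, ε ≤ s → s ≤ t → t ≤ x → G t - G s ≤ h s * (t - s))
    (hM : ∀ s t, 0 ≤ s → s ≤ t → m t * (t - s) ≤ M t - M s)
    (X : ℤ → ℝ) (hX : Monotone X) (hXε : ∀ r, r < 0 → X r = ε) (hXx : ∀ r, N ≤ r → X r = x)
    (hsub : ∀ r, 0 ≤ r → r ≤ N →
      X r ≤ smoothR w a (fun c => m (smoothL w a (fun r => h (X r)) c)) r + η) :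
    G x - x * h x + M (h x) ≤ G ε - ε * h ε + M (h ε) + h ε * (κ + η) := by
  have hXl : ∀ r, ε ≤ X r := fun r => by
    rw [← hXε (min r 0 - 1) (by omega)]; exact hX (by omega)
  have hXu : ∀ r, X r ≤ x := fun r => by
    rw [← hXx (max r N) (by omega)]; exact hX (by omega)
  set H : ℤ → ℝ := fun r => h (X r) with hH
  set τ : ℤ → ℝ := smoothL w a H with hτ
  set D : ℤ → ℝ := fun r => H (r - 1) - H r with hD
  have hHanti : ∀ r s, r ≤ s → H s ≤ H r := fun r s hrs => hh _ _ (hXl r) (hX hrs) (hXu s)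
  have hH0 : ∀ r, 0 ≤ H r := fun r => hh0 _ (hXl r) (hXu r)
  have hD0 : ∀ r, 0 ≤ D r := fun r => sub_nonneg.2 (hHanti _ _ (by omega))
  have hDout : ∀ r, r ∉ Finset.Icc 0 N → D r = 0 := fun r hr => by
    simp only [Finset.mem_Icc, not_and_or, not_le] at hr
    rcases hr with hr | hr
    · simp only [hD, hH, hXε r hr, hXε (r - 1) (by omega), sub_self]
    · simp only [hD, hH, hXx r hr.le, hXx (r - 1) (by omega), sub_self]
  have hτ0 : ∀ c, 0 ≤ τ c := fun c => Finset.sum_nonneg fun k _ => mul_nonneg (ha k) (hH0 _)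
  have hτanti : ∀ c, τ c ≤ τ (c - 1) := fun c =>
    Finset.sum_le_sum fun k _ => mul_le_mul_of_nonneg_left (hHanti _ _ (by omega)) (ha k)
  have hτD : ∀ c, τ (c - 1) - τ c = ∑ k ∈ Finset.Icc (-(w : ℤ)) w, a k * D (c + k) := fun c => by
    simp only [hτ, smoothL, ← Finset.sum_sub_distrib, hD]
    refine Finset.sum_congr rfl fun k _ => ?_
    rw [show c - 1 + k = c + k - 1 by ring]; ring
  set T : ℤ → ℝ := smoothR w a (fun c => m (τ c)) with hT
  have hTκ : ∀ r, T r - T (r - 1) ≤ κ := fun r =>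
    smoothR_sub_le w a _ κ hsupp hκ (fun c => hm0 _ (hτ0 c)) (fun c => hm1 _ (hτ0 c)) r
  -- the part of the potential in `E`
  have hK : (G x - x * h x) - (G ε - ε * h ε) ≤ ∑ r ∈ Finset.Icc 0 N, X r * D r := by
    have := sum_Icc_telescope (fun r => G (X r) - X r * H r) 0 N hN
    simp only [hH, hXx N le_rfl, hXε (0 - 1) (by norm_num)] at this
    rw [← this]
    refine Finset.sum_le_sum fun r _ => ?_
    have := hG (X (r - 1)) (X r) (hXl _) (hX (by omega)) (hXu _)
    simp only [hD, hH]
    linarith [mul_comm (h (X (r - 1))) (X r - X (r - 1))]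
  -- the part of the potential in `τ`
  have hτl : τ (-(w : ℤ) - 1) = h ε := by
    simp only [hτ, smoothL]
    rw [← one_mul (h ε), ← hsum, Finset.sum_mul]
    refine Finset.sum_congr rfl fun k hk => ?_
    simp only [hH]; rw [hXε _ (by simp only [Finset.mem_Icc] at hk; omega)]
  have hτr : τ (N + w) = h x := by
    simp only [hτ, smoothL]
    rw [← one_mul (h x), ← hsum, Finset.sum_mul]
    refine Finset.sum_congr rfl fun k hk => ?_
    simp only [hH]; rw [hXx _ (by simp only [Finset.mem_Icc] at hk; omega)]
  have hMsum : ∑ r ∈ Finset.Icc 0 N, D r * T (r - 1) ≤ M (h ε) - M (h x) := by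
    have h1 := sum_Icc_telescope (fun c => M (τ c)) (-(w : ℤ)) (N + w) (by omega)
    simp only [hτl, hτr] at h1
    -- Exchanging the two sums moves the kernel from `D` onto `m (τ ·)`. The base point `c - 1`
    -- turns into the argument `r - 1` of the adjoint smoothing.
    have h2 : ∑ c ∈ Finset.Icc (-(w : ℤ)) (N + w), m (τ (c - 1)) * (τ (c - 1) - τ c) =
        ∑ r ∈ Finset.Icc 0 N, D r * T (r - 1) := by
      simp only [hτD, Finset.mul_sum]
      rw [Finset.sum_comm]
      simp only [hT, smoothR, Finset.mul_sum]
      rw [Finset.sum_comm (s := Finset.Icc 0 N)]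
      refine Finset.sum_congr rfl fun k hk => ?_
      rw [← sum_Icc_shift (fun r => D r * (a k * m (τ (r - 1 - k)))) N k w hk
        fun r hr => by rw [hDout r hr, zero_mul]]
      refine Finset.sum_congr rfl fun c _ => ?_
      rw [show c + k - 1 - k = c - 1 by ring]; ring
    rw [← h2]
    -- `hM` bounds the slope of `M` at the larger argument, which is `τ (c - 1)` because `τ` is
    -- nonincreasing. This is why `T (r - 1)` appears instead of `T r`, at the price `κ`.
    have h3 : ∑ c ∈ Finset.Icc (-(w : ℤ)) (N + w), m (τ (c - 1)) * (τ (c - 1) - τ c) ≤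
        -∑ c ∈ Finset.Icc (-(w : ℤ)) (N + w), (M (τ c) - M (τ (c - 1))) := by
      rw [← Finset.sum_neg_distrib]
      refine Finset.sum_le_sum fun c _ => ?_
      linarith [hM _ _ (hτ0 c) (hτanti c)]
    linarith
  have hDsum : ∑ r ∈ Finset.Icc 0 N, D r ≤ h ε := by
    have := sum_Icc_telescope H 0 N hN
    have e : ∑ r ∈ Finset.Icc 0 N, D r = -∑ r ∈ Finset.Icc 0 N, (H r - H (r - 1)) := by
      rw [← Finset.sum_neg_distrib]; exact Finset.sum_congr rfl fun r _ => by simp only [hD]; ring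
    rw [e, this]
    have h1 : H (0 - 1) = h ε := by simp only [hH]; rw [hXε (0 - 1) (by norm_num)]
    linarith [hH0 N]
  have hκ0 : 0 ≤ κ := le_trans (Finset.sum_nonneg fun _ _ => abs_nonneg _) hκ
  have hfin : ∑ r ∈ Finset.Icc 0 N, X r * D r - ∑ r ∈ Finset.Icc 0 N, D r * T (r - 1) ≤
      h ε * (κ + η) := by
    rw [← Finset.sum_sub_distrib]
    calc _ ≤ ∑ r ∈ Finset.Icc 0 N, D r * (κ + η) := by
          refine Finset.sum_le_sum fun r hr => ?_
          rw [Finset.mem_Icc] at hr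
          have h1 : X r ≤ T r + η := hsub r hr.1 hr.2
          have h2 := hTκ r
          have : X r - T (r - 1) ≤ κ + η := by linarith
          nlinarith [hD0 r]
      _ = (∑ r ∈ Finset.Icc 0 N, D r) * (κ + η) := by rw [Finset.sum_mul]
      _ ≤ _ := mul_le_mul_of_nonneg_right hDsum (by linarith)
  linarith

/-! ### Gaussian measures -/

/-- The standard Gaussian measure on the line. -/
noncomputable abbrev gam : Measure ℝ := gaussianReal 0 1

theorem integral_comp_measurePreserving {α β : Type*} [MeasurableSpace α] [MeasurableSpace β]
    {μ : Measure α} {κ : Measure β} {f : α → β} (hf : MeasurePreserving f μ κ) {F : β → ℝ}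
    (hF : AEStronglyMeasurable F κ) : ∫ x, F (f x) ∂μ = ∫ y, F y ∂κ := by
  rw [← hf.map_eq, integral_map hf.measurable.aemeasurable (by rw [hf.map_eq]; exact hF)]

theorem map_gam (p E : ℝ) (hE : 0 ≤ E) :
    gam.map (fun w => p + √E * w) = gaussianReal p E.toNNReal := by
  have h : (fun w : ℝ => p + √E * w) = (fun x => p + x) ∘ fun w => √E * w := rfl
  rw [h, ← Measure.map_map (by fun_prop) (by fun_prop), gaussianReal_map_const_mul,
    gaussianReal_map_const_add]
  congr 1
  · simp
  · ext; simp [Real.sq_sqrt hE, Real.coe_toNNReal _ hE]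

theorem measurePreserving_gam (p E : ℝ) (hE : 0 ≤ E) :
    MeasurePreserving (fun w => p + √E * w) gam (gaussianReal p E.toNNReal) :=
  ⟨by fun_prop, map_gam p E hE⟩

theorem integral_gaussianReal_eq_gam (p E : ℝ) (hE : 0 ≤ E) {F : ℝ → ℝ} (hF : Measurable F) :
    ∫ u, F u ∂(gaussianReal p E.toNNReal) = ∫ w, F (p + √E * w) ∂gam := by
  rw [← map_gam p E hE, integral_map (by fun_prop) hF.aestronglyMeasurable]

/-- A unit vector `(c, s)` is the cosine and sine of its argument, and the standard Gaussian on the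
plane is invariant under rotation. -/
theorem measurePreserving_rotate_gam (c s : ℝ) (h : c ^ 2 + s ^ 2 = 1) :
    MeasurePreserving (fun p : ℝ × ℝ => (c * p.1 + s * p.2, -s * p.1 + c * p.2))
      (gam.prod gam) (gam.prod gam) := by
  obtain ⟨θ, hc, hs⟩ : ∃ θ : ℝ, Real.cos θ = c ∧ Real.sin θ = s := by
    have hn : ‖(⟨c, s⟩ : ℂ)‖ = 1 := by
      rw [Complex.norm_def, Complex.normSq_mk, show c * c + s * s = 1 by linarith, Real.sqrt_one]
    have h0 : (⟨c, s⟩ : ℂ) ≠ 0 := fun h0 => by rw [h0] at hn; simp at hn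
    exact ⟨Complex.arg ⟨c, s⟩, by rw [Complex.cos_arg h0, hn, div_one],
      by rw [Complex.sin_arg, hn, div_one]⟩
  refine ⟨by fun_prop, ?_⟩
  have e : (fun p : ℝ × ℝ => (c * p.1 + s * p.2, -s * p.1 + c * p.2)) =
      ContinuousLinearMap.rotation θ := by
    ext p <;> simp [ContinuousLinearMap.rotation_apply, hc, hs]
  rw [e]
  exact IsGaussian.map_rotation_eq_self (μ := gam) (by simp) θ

theorem measurePreserving_combine_gam (c s : ℝ) (h : c ^ 2 + s ^ 2 = 1) :
    MeasurePreserving (fun p : ℝ × ℝ => c * p.1 + s * p.2) (gam.prod gam) gam :=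
  measurePreserving_fst.comp (measurePreserving_rotate_gam c s h)

theorem measurePreserving_combine_pi_gam (ι : Type*) [Fintype ι] (c s : ℝ)
    (h : c ^ 2 + s ^ 2 = 1) :
    MeasurePreserving (fun (p : (ι → ℝ) × (ι → ℝ)) i => c * p.1 i + s * p.2 i)
      ((Measure.pi fun _ : ι => gam).prod (Measure.pi fun _ : ι => gam))
      (Measure.pi fun _ : ι => gam) := by
  have h1 := (measurePreserving_arrowProdEquivProdArrow ℝ ℝ ι (fun _ => gam) (fun _ => gam)).symm
  have h2 := measurePreserving_pi (fun _ : ι => gam.prod gam) (fun _ : ι => gam)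
    fun _ => measurePreserving_combine_gam c s h
  exact h2.comp h1

theorem gaussianPDFReal_zero_one (x : ℝ) :
    gaussianPDFReal 0 1 x = (√(2 * Real.pi))⁻¹ * Real.exp (-x ^ 2 / 2) := by
  simp [gaussianPDFReal]

theorem integral_gam (F : ℝ → ℝ) : ∫ x, F x ∂gam = ∫ x, gaussianPDFReal 0 1 x * F x := by
  rw [integral_gaussianReal_eq_integral_smul one_ne_zero]; rfl

theorem integrable_gam_iff (F : ℝ → ℝ) :
    Integrable F gam ↔ Integrable fun x => gaussianPDFReal 0 1 x * F x := by
  rw [gam, gaussianReal_of_var_ne_zero 0 one_ne_zero,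
    integrable_withDensity_iff_integrable_smul' (measurable_gaussianPDF 0 1)
      (ae_of_all _ fun _ => gaussianPDF_lt_top)]
  simp [toReal_gaussianPDF]

/-- Translation of the standard Gaussian. -/
theorem integral_gam_add (F : ℝ → ℝ) (t : ℝ) :
    ∫ x, F (x + t) ∂gam = ∫ x, Real.exp (t * x - t ^ 2 / 2) * F x ∂gam := by
  rw [integral_gam, integral_gam,
    ← integral_add_right_eq_self (fun x => gaussianPDFReal 0 1 x *
      (Real.exp (t * x - t ^ 2 / 2) * F x)) t]
  congr 1; ext x
  simp only [gaussianPDFReal_zero_one]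
  rw [← mul_assoc, mul_assoc _ (Real.exp _) (Real.exp _), ← Real.exp_add]
  congr 3; ring

theorem integrable_id_gam : Integrable (fun x : ℝ => x) gam :=
  (memLp_id_gaussianReal (μ := 0) (v := 1) 1).integrable (by simp)

theorem integrable_sq_gam : Integrable (fun x : ℝ => x ^ 2) gam :=
  (memLp_id_gaussianReal (μ := 0) (v := 1) 2).integrable_sq

theorem integral_sq_gam : ∫ x, x ^ 2 ∂gam = 1 := by
  have h := variance_fun_id_gaussianReal (μ := 0) (v := 1)
  rw [variance_of_integral_eq_zero (by fun_prop) (by simp)] at h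
  simpa using h

/-- Gaussian integration by parts. -/
theorem integral_mul_gam {f f' : ℝ → ℝ} (hf : ∀ x, HasDerivAt f (f' x) x) {C C' : ℝ}
    (hC : ∀ x, |f x| ≤ C) (hf'm : Measurable f') (hC' : ∀ x, |f' x| ≤ C') :
    ∫ x, x * f x ∂gam = ∫ x, f' x ∂gam := by
  have hfm : Measurable f := (continuous_iff_continuousAt.2 fun x => (hf x).continuousAt).measurable
  have hg : ∀ x, HasDerivAt (gaussianPDFReal 0 1) (-x * gaussianPDFReal 0 1 x) x := fun x => by
    have : gaussianPDFReal 0 1 = fun x => (√(2 * Real.pi))⁻¹ * Real.exp (-x ^ 2 / 2) :=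
      funext gaussianPDFReal_zero_one
    rw [this]
    have h1 : HasDerivAt (fun x : ℝ => -x ^ 2 / 2) (-x) x := by
      have := ((hasDerivAt_pow 2 x).neg.div_const 2)
      refine this.congr_deriv ?_; push_cast; ring
    exact (h1.exp.const_mul (√(2 * Real.pi))⁻¹).congr_deriv (by ring)
  have hi1 : Integrable f gam := Integrable.of_bound hfm.aestronglyMeasurable C (ae_of_all _ hC)
  have hi2 : Integrable f' gam := Integrable.of_bound hf'm.aestronglyMeasurable C' (ae_of_all _ hC')
  have hi3 : Integrable (fun x => x * f x) gam :=
    integrable_id_gam.mul_bdd hfm.aestronglyMeasurable (ae_of_all _ hC)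
  have := integral_mul_deriv_eq_deriv_mul_of_integrable (u := f) (u' := f')
    (v := gaussianPDFReal 0 1) (v' := fun x => -x * gaussianPDFReal 0 1 x)
    (fun x _ => hf x) (fun x _ => hg x)
    (((integrable_gam_iff _).1 hi3).neg.congr
      (ae_of_all _ fun x => by simp only [Pi.neg_apply, Pi.mul_apply]; ring))
    (((integrable_gam_iff _).1 hi2).congr (ae_of_all _ fun x => by simp only [Pi.mul_apply]; ring))
    (((integrable_gam_iff _).1 hi1).congr (ae_of_all _ fun x => by simp only [Pi.mul_apply]; ring))
  rw [integral_gam, integral_gam]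
  have e1 : ∀ x, gaussianPDFReal 0 1 x * (x * f x) = -(f x * (-x * gaussianPDFReal 0 1 x)) :=
    fun x => by ring
  have e2 : ∀ x, gaussianPDFReal 0 1 x * f' x = f' x * gaussianPDFReal 0 1 x := fun x => by ring
  simp only [e1, e2, integral_neg, this, neg_neg]

section Pi

variable {n : ℕ} (i : Fin (n + 1))

theorem measurePreserving_insertNth_gam :
    MeasurePreserving (fun p : (Fin n → ℝ) × ℝ => i.insertNth (α := fun _ => ℝ) p.2 p.1)
      ((Measure.pi fun _ : Fin n => gam).prod gam) (Measure.pi fun _ : Fin (n + 1) => gam) :=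
  (measurePreserving_piFinSuccAbove (fun _ : Fin (n + 1) => gam) i).symm.comp
    Measure.measurePreserving_swap

theorem integral_pi_gam_eq {F : (Fin (n + 1) → ℝ) → ℝ}
    (hF : Integrable F (Measure.pi fun _ => gam)) :
    ∫ z, F z ∂(Measure.pi fun _ => gam) =
      ∫ y, ∫ x, F (i.insertNth (α := fun _ => ℝ) x y) ∂gam ∂(Measure.pi fun _ => gam) := by
  have h := measurePreserving_insertNth_gam i
  rw [← h.map_eq, integral_map h.measurable.aemeasurable
    (by rw [h.map_eq]; exact hF.aestronglyMeasurable), integral_prod]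
  exact h.integrable_comp_of_integrable hF

end Pi

/-! ### The denoiser and its Gaussian channel -/

/-- The standard Gaussian measure on `ℝ^B`. -/
noncomputable abbrev gamPi (B : ℕ) : Measure (Fin B → ℝ) := Measure.pi fun _ : Fin B => gam

/-- The posterior probability of position `k` given the output `y` of the section channel with
amplitude `t`. -/
noncomputable def posterior {B : ℕ} (t : ℝ) (y : Fin B → ℝ) (k : Fin B) : ℝ :=
  Real.exp (t * y k) / ∑ l, Real.exp (t * y l)

/-- The output of the section channel. -/
def output {B : ℕ} (t : ℝ) (j : Fin B) (z : Fin B → ℝ) (i : Fin B) : ℝ := t * sect B j i + z i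

section Basic

variable {B : ℕ} (t : ℝ) (y z : Fin B → ℝ)

theorem sum_exp_pos (j : Fin B) : 0 < ∑ l : Fin B, Real.exp (t * y l) := by
  refine Finset.sum_pos (fun _ _ => Real.exp_pos _) ⟨j, Finset.mem_univ j⟩

variable (j k : Fin B)

theorem posterior_nonneg : 0 ≤ posterior t y k :=
  div_nonneg (Real.exp_pos _).le (Finset.sum_nonneg fun _ _ => (Real.exp_pos _).le)

theorem sum_posterior (j : Fin B) : ∑ k, posterior t y k = 1 := by
  unfold posterior
  rw [← Finset.sum_div, div_self (sum_exp_pos t y j).ne']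

theorem posterior_le_one : posterior t y k ≤ 1 := by
  rw [← sum_posterior t y k]
  exact Finset.single_le_sum (fun l _ => posterior_nonneg t y l) (Finset.mem_univ k)

theorem continuous_posterior : Continuous fun p : ℝ × (Fin B → ℝ) => posterior p.1 p.2 k := by
  unfold posterior
  refine Continuous.div (by fun_prop) (by fun_prop) fun p => (sum_exp_pos p.1 p.2 k).ne'

theorem measurable_posterior : Measurable fun y : Fin B → ℝ => posterior t y k :=
  ((continuous_posterior k).comp (by fun_prop : Continuous fun y : Fin B → ℝ => (t, y))).measurable

theorem measurable_output : Measurable (output t j) :=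
  measurable_pi_lambda _ fun i => by unfold output; fun_prop

theorem sect_sq_sum : ∑ i, (t * sect B k i - y i) ^ 2 = t ^ 2 - 2 * (t * y k) + ∑ i, y i ^ 2 := by
  have h : ∀ i, (t * sect B k i - y i) ^ 2 =
      (if i = k then t ^ 2 - 2 * (t * y k) else 0) + y i ^ 2 := fun i => by
    unfold sect
    by_cases h : i = k
    · subst h; simp; ring
    · simp [h]
  simp only [h, Finset.sum_add_distrib, Finset.sum_ite_eq', Finset.mem_univ, if_true]

/-- Expanding the square leaves a factor that does not depend on `k`. It cancels in the denoiser,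
which becomes a softmax of the output. -/
theorem theta_sect (τ : ℝ≥0∞) (hτ : τ ≠ ∞) :
    theta B τ (sect B k) (sect B j) z =
      Real.exp (√(τ.toReal * Real.logb 2 B) * output (√(τ.toReal * Real.logb 2 B)) j z k) *
      Real.exp (-((√(τ.toReal * Real.logb 2 B)) ^ 2 +
        ∑ i, output (√(τ.toReal * Real.logb 2 B)) j z i ^ 2) / 2) := by
  rw [theta, if_neg hτ]
  set t := √(τ.toReal * Real.logb 2 B)
  have h : ∑ i, (t * (sect B k i - sect B j i) - z i) ^ 2 =
      ∑ i, (t * sect B k i - output t j z i) ^ 2 :=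
    Finset.sum_congr rfl fun i _ => by unfold output; ring
  rw [h, sect_sq_sum, ← Real.exp_add]
  congr 1; ring

theorem denoiser_eq_posterior (τ : ℝ≥0∞) (hτ : τ ≠ ∞) :
    denoiser B τ (sect B j) z k = posterior (√(τ.toReal * Real.logb 2 B))
      (output (√(τ.toReal * Real.logb 2 B)) j z) k := by
  have hB : (B : ℝ) ≠ 0 := by exact_mod_cast k.pos.ne'
  unfold denoiser posterior
  simp only [theta_sect _ _ _ τ hτ]
  set t := √(τ.toReal * Real.logb 2 B)
  set y := output t j z
  have h : ∀ x, sect B x k = if x = k then (1 : ℝ) else 0 := fun x => by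
    unfold sect; rw [Pi.single_apply]; simp [eq_comm]
  simp only [h, mul_ite, mul_one, mul_zero, Finset.sum_ite_eq', Finset.mem_univ, if_true]
  rw [← Finset.mul_sum, ← Finset.sum_mul]
  have := (sum_exp_pos t y k).ne'
  have h2 := (Real.exp_pos (-(t ^ 2 + ∑ i, y i ^ 2) / 2)).ne'
  field_simp

end Basic

/-- The mean square error of position `j` at amplitude `t`. -/
noncomputable def mseAt (B : ℕ) (j : Fin B) (t : ℝ) : ℝ :=
  ∫ z, ∑ i, (posterior t (output t j z) i - sect B j i) ^ 2 ∂(gamPi B)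

/-- The mean square error at amplitude `t`. -/
noncomputable def mseAmp (B : ℕ) (t : ℝ) : ℝ := ∑ j : Fin B, (1 / (B : ℝ)) * mseAt B j t

theorem mse_eq_mseAmp (B : ℕ) (τ : ℝ≥0∞) (hτ : τ ≠ ∞) :
    mse B τ = mseAmp B (√(τ.toReal * Real.logb 2 B)) := by
  unfold mse expSZ mseAmp mseAt
  simp only [denoiser_eq_posterior _ _ _ τ hτ]

theorem mse_top (B : ℕ) : mse B ∞ = 0 := by
  unfold mse expSZ
  refine Finset.sum_eq_zero fun j _ => ?_
  have hB : (B : ℝ) ≠ 0 := by exact_mod_cast j.pos.ne'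
  have hinj : ∀ k, sect B k = sect B j ↔ k = j := fun k => by
    refine ⟨fun h => ?_, fun h => by rw [h]⟩
    have := congrFun h k
    unfold sect at this
    by_contra hne
    rw [Pi.single_eq_same, Pi.single_eq_of_ne hne] at this
    norm_num at this
  -- At infinite inverse noise only the true section keeps a nonzero weight, so the denoiser returns
  -- it exactly.
  have : ∀ z i, denoiser B ∞ (sect B j) z i = sect B j i := fun z i => by
    unfold denoiser theta
    simp only [if_true, hinj, mul_ite, ite_mul, mul_zero, zero_mul, Finset.sum_ite_eq',
      Finset.mem_univ]
    have := (Real.exp_pos (-∑ i, z i ^ 2 / 2)).ne'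
    rw [mul_comm, mul_div_assoc, div_self, mul_one]
    positivity
  simp [this]

theorem sum_sq_sub_le_two {B : ℕ} (t : ℝ) (y : Fin B → ℝ) (j i : Fin B) :
    |posterior t y i - sect B j i| ≤ 1 := by
  have h0 := posterior_nonneg t y i
  have h1 := posterior_le_one t y i
  unfold sect
  by_cases h : i = j
  · subst h; rw [Pi.single_eq_same, abs_le]; constructor <;> linarith
  · rw [Pi.single_eq_of_ne h, abs_le]; constructor <;> linarith

/-! ### Monotonicity in the signal to noise ratio -/

theorem measurable_sect_error {B : ℕ} (K : (Fin B → ℝ) → Fin B → ℝ)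
    (hK : ∀ i, Measurable fun y => K y i) (j : Fin B) :
    Measurable fun y => ∑ i, (K y i - sect B j i) ^ 2 :=
  Finset.measurable_sum _ fun i _ => ((hK i).sub_const _).pow_const 2

theorem sum_sq_bound {B : ℕ} (v : Fin B → ℝ) (hv : ∀ i, |v i| ≤ 1) :
    |∑ i, v i ^ 2| ≤ B := by
  rw [abs_of_nonneg (Finset.sum_nonneg fun i _ => sq_nonneg _)]
  calc ∑ i, v i ^ 2 ≤ ∑ _i : Fin B, (1 : ℝ) :=
        Finset.sum_le_sum fun i _ => by rw [sq_le_one_iff_abs_le_one]; exact hv i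
    _ = B := by simp

/-- Change of measure: the likelihood ratio of the output for position `j` against pure noise is
`exp (t y_j - t² / 2)`. All positions are thereby compared under the same measure. -/
theorem integral_output {B : ℕ} (F : (Fin B → ℝ) → ℝ) (hF : Measurable F) (C : ℝ)
    (hC : ∀ y, |F y| ≤ C) (t : ℝ) (j : Fin B) :
    Integrable (fun y => Real.exp (t * y j - t ^ 2 / 2) * F y) (gamPi B) ∧
    ∫ z, F (output t j z) ∂(gamPi B) =
      ∫ y, Real.exp (t * y j - t ^ 2 / 2) * F y ∂(gamPi B) := by
  obtain ⟨n, rfl⟩ : ∃ n, B = n + 1 := ⟨B - 1, by have := j.pos; omega⟩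
  have hexp : Integrable (fun y : Fin (n + 1) → ℝ => Real.exp (t * y j - t ^ 2 / 2))
      (gamPi (n + 1)) := by
    have h1 : Integrable (fun x : ℝ => Real.exp (t * x - t ^ 2 / 2)) gam := by
      simp only [Real.exp_sub, div_eq_mul_inv]
      exact (integrable_exp_mul_gaussianReal t).mul_const _
    exact (measurePreserving_eval (fun _ : Fin (n + 1) => gam) j).integrable_comp_of_integrable h1
  have hint : Integrable (fun y => Real.exp (t * y j - t ^ 2 / 2) * F y) (gamPi (n + 1)) :=
    hexp.mul_bdd hF.aestronglyMeasurable (ae_of_all _ hC)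
  refine ⟨hint, ?_⟩
  rw [integral_pi_gam_eq j hint, integral_pi_gam_eq j (F := fun z => F (output t j z))
    (Integrable.of_bound (hF.comp (measurable_output t j)).aestronglyMeasurable C
      (ae_of_all _ fun z => hC _))]
  congr 1; ext y
  have e : ∀ x, output t j (j.insertNth (α := fun _ => ℝ) x y) =
      j.insertNth (α := fun _ => ℝ) (x + t) y := fun x => by
    ext i
    unfold output sect
    refine Fin.succAboveCases j ?_ (fun i => ?_) i
    · simp; ring
    · simp
  simp only [e, Fin.insertNth_apply_same]
  exact integral_gam_add (fun x => F (j.insertNth (α := fun _ => ℝ) x y)) t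

/-- The posterior mean is the best estimator. -/
theorem mseAmp_le_of_estimator {B : ℕ} (t : ℝ) (K : (Fin B → ℝ) → Fin B → ℝ)
    (hK : ∀ i, Measurable fun y => K y i) (hK1 : ∀ j i y, |K y i - sect B j i| ≤ 1) :
    mseAmp B t ≤ ∑ j : Fin B, (1 / (B : ℝ)) *
      ∫ z, ∑ i, (K (output t j z) i - sect B j i) ^ 2 ∂(gamPi B) := by
  have h1 := fun j : Fin B => integral_output (fun y => ∑ i, (K y i - sect B j i) ^ 2)
    (measurable_sect_error K hK j) B (fun y => sum_sq_bound _ fun i => hK1 j i y) t j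
  have h2 := fun j : Fin B => integral_output (fun y => ∑ i, (posterior t y i - sect B j i) ^ 2)
    (measurable_sect_error _ (fun i => measurable_posterior t i) j) B
    (fun y => sum_sq_bound _ fun i => sum_sq_sub_le_two t y j i) t j
  unfold mseAmp mseAt
  simp only [fun j => (h1 j).2, fun j => (h2 j).2]
  rw [← Finset.mul_sum, ← Finset.mul_sum]
  refine mul_le_mul_of_nonneg_left ?_ (by positivity)
  rw [← integral_finsetSum _ fun j _ => (h1 j).1, ← integral_finsetSum _ fun j _ => (h2 j).1]
  refine integral_mono (integrable_finsetSum _ fun j _ => (h2 j).1)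
    (integrable_finsetSum _ fun j _ => (h1 j).1) fun y => ?_
  simp only
  -- For a fixed output the weighted error is a quadratic polynomial in each coordinate of the
  -- estimate, minimized at the posterior probability.
  have key : ∀ L : Fin B → ℝ, ∑ j, Real.exp (t * y j - t ^ 2 / 2) * ∑ i, (L i - sect B j i) ^ 2 =
      Real.exp (-t ^ 2 / 2) * ∑ i, ((∑ l, Real.exp (t * y l)) * L i ^ 2 -
        2 * L i * Real.exp (t * y i) + Real.exp (t * y i)) := fun L => by
    simp only [Finset.mul_sum]
    rw [Finset.sum_comm]
    refine Finset.sum_congr rfl fun i _ => ?_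
    have : ∀ j, Real.exp (t * y j - t ^ 2 / 2) * (L i - sect B j i) ^ 2 =
        Real.exp (-t ^ 2 / 2) * (Real.exp (t * y j) * L i ^ 2) +
        if j = i then Real.exp (-t ^ 2 / 2) *
          (- 2 * L i * Real.exp (t * y i) + Real.exp (t * y i)) else 0 := fun j => by
      have h : sect B j i = if j = i then (1 : ℝ) else 0 := by
        unfold sect; rw [Pi.single_apply]; simp [eq_comm]
      rw [h, show t * y j - t ^ 2 / 2 = -t ^ 2 / 2 + t * y j by ring, Real.exp_add]
      split_ifs with hji
      · subst hji; ring
      · ring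
    simp only [this, Finset.sum_add_distrib, Finset.sum_ite_eq', Finset.mem_univ, if_true]
    rw [← Finset.mul_sum, ← Finset.sum_mul]; ring
  rw [key, key]
  refine mul_le_mul_of_nonneg_left (Finset.sum_le_sum fun i _ => ?_) (Real.exp_pos _).le
  have hS := sum_exp_pos t y i
  have hp : (∑ l, Real.exp (t * y l)) * posterior t y i = Real.exp (t * y i) := by
    unfold posterior; field_simp
  rw [← hp]
  nlinarith [mul_nonneg hS.le (sq_nonneg (K y i - posterior t y i))]

/-- Adding independent noise to an output of amplitude `t` simulates an output of amplitude `s ≤ t`.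
For each value `z'` of the added noise this is an estimator at amplitude `t`, hence no better than
the posterior mean there; averaging over `z'` gives the error at amplitude `s`. -/
theorem mseAmp_antitone {B : ℕ} {s t : ℝ} (hs : 0 ≤ s) (hst : s ≤ t) :
    mseAmp B t ≤ mseAmp B s := by
  rcases hs.trans hst |>.eq_or_lt with ht | ht
  · rw [show s = t by linarith]
  set c := s / t with hc
  have hc1 : c ≤ 1 := by rw [hc, div_le_one ht]; exact hst
  have hc0 : 0 ≤ c := div_nonneg hs ht.le
  have hcs : c ^ 2 + √(1 - c ^ 2) ^ 2 = 1 := by rw [Real.sq_sqrt (by nlinarith)]; ring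
  set d := √(1 - c ^ 2)
  have hmp := measurePreserving_combine_pi_gam (Fin B) c d hcs
  set K : (Fin B → ℝ) → (Fin B → ℝ) → Fin B → ℝ :=
    fun z' y => posterior s fun i => c * y i + d * z' i with hK
  have hKm : ∀ i, Measurable fun p : (Fin B → ℝ) × (Fin B → ℝ) => K p.1 p.2 i := fun i =>
    (measurable_posterior s i).comp
      (f := fun p : (Fin B → ℝ) × (Fin B → ℝ) => fun i => c * p.2 i + d * p.1 i) (by fun_prop)
  have hFm : ∀ j, Measurable fun p : (Fin B → ℝ) × (Fin B → ℝ) =>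
      ∑ i, (K p.2 (output t j p.1) i - sect B j i) ^ 2 := fun j =>
    Finset.measurable_sum _ fun i _ => (((hKm i).comp (measurable_snd.prodMk
      ((measurable_output t j).comp measurable_fst))).sub_const _).pow_const 2
  have hFi : ∀ j, Integrable (fun p : (Fin B → ℝ) × (Fin B → ℝ) =>
      ∑ i, (K p.2 (output t j p.1) i - sect B j i) ^ 2) ((gamPi B).prod (gamPi B)) := fun j =>
    Integrable.of_bound (hFm j).aestronglyMeasurable B
      (ae_of_all _ fun p => sum_sq_bound _ fun i => sum_sq_sub_le_two s _ j i)
  have h1 : ∀ j, mseAt B j s = ∫ z', ∫ z, ∑ i, (K z' (output t j z) i - sect B j i) ^ 2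
      ∂(gamPi B) ∂(gamPi B) := fun j => by
    unfold mseAt
    rw [← integral_prod_symm _ (hFi j), ← integral_comp_measurePreserving hmp
      (F := fun z => ∑ i, (posterior s (output s j z) i - sect B j i) ^ 2)
      ((measurable_sect_error (posterior s) (fun i => measurable_posterior s i) j).comp
        (measurable_output s j)).aestronglyMeasurable]
    congr 1; ext p
    refine Finset.sum_congr rfl fun i _ => ?_
    congr 3
    ext l
    simp only [output]
    have : c * t = s := by rw [hc]; field_simp
    rw [← this]; ring
  have hFi' := fun j => (hFi j).integral_prod_right
  calc mseAmp B t = ∫ _z', mseAmp B t ∂(gamPi B) := by simp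
    _ ≤ ∫ z', ∑ j : Fin B, (1 / (B : ℝ)) *
        ∫ z, ∑ i, (K z' (output t j z) i - sect B j i) ^ 2 ∂(gamPi B) ∂(gamPi B) := by
        refine integral_mono (integrable_const _)
          (integrable_finsetSum _ fun j _ => (hFi' j).const_mul _) fun z' => ?_
        exact mseAmp_le_of_estimator t (K z') (fun i => (hKm i).comp measurable_prodMk_left)
          fun j i y => sum_sq_sub_le_two s _ j i
    _ = mseAmp B s := by
        rw [integral_finsetSum _ fun j _ => (hFi' j).const_mul _]
        unfold mseAmp
        refine Finset.sum_congr rfl fun j _ => ?_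
        rw [integral_const_mul, h1]

/-! ### The I-MMSE relation for the section channel. -/

/-- The expected logarithm of the partition function of position `j`, up to explicit terms. -/
noncomputable def logPart (B : ℕ) (j : Fin B) (t : ℝ) : ℝ :=
  ∫ z, Real.log (∑ l, Real.exp (t * output t j z l)) ∂(gamPi B)

theorem integrable_eval_gamPi {B : ℕ} (i : Fin B) : Integrable (fun z => z i) (gamPi B) :=
  (measurePreserving_eval (fun _ : Fin B => gam) i).integrable_comp_of_integrable integrable_id_gam

theorem integrable_eval_sq_gamPi {B : ℕ} (i : Fin B) :
    Integrable (fun z => z i ^ 2) (gamPi B) :=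
  (measurePreserving_eval (fun _ : Fin B => gam) i).integrable_comp_of_integrable integrable_sq_gam

theorem abs_le_of_weights {ι : Type*} [Fintype ι] (p v : ι → ℝ) (hp : ∀ i, 0 ≤ p i)
    (hp1 : ∀ i, p i ≤ 1) : |∑ i, p i * v i| ≤ ∑ i, |v i| := by
  refine (Finset.abs_sum_le_sum_abs _ _).trans (Finset.sum_le_sum fun i _ => ?_)
  rw [abs_mul, abs_of_nonneg (hp i)]
  exact mul_le_of_le_one_left (abs_nonneg _) (hp1 i)

theorem abs_log_sum_exp_le {B : ℕ} (v : Fin B → ℝ) (j : Fin B) :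
    |Real.log (∑ l, Real.exp (v l))| ≤ Real.log B + ∑ l, |v l| := by
  have hle : ∀ l, |v l| ≤ ∑ l, |v l| := fun l =>
    Finset.single_le_sum (f := fun l => |v l|) (fun _ _ => abs_nonneg _) (Finset.mem_univ l)
  have hB : (1 : ℝ) ≤ B := by exact_mod_cast j.pos
  have hpos : 0 < ∑ l, Real.exp (v l) :=
    Finset.sum_pos (fun _ _ => Real.exp_pos _) ⟨j, Finset.mem_univ j⟩
  rw [abs_le]; constructor
  · have h1 : v j ≤ Real.log (∑ l, Real.exp (v l)) := by
      rw [Real.le_log_iff_exp_le hpos]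
      exact Finset.single_le_sum (f := fun l => Real.exp (v l)) (fun _ _ => (Real.exp_pos _).le)
        (Finset.mem_univ j)
    linarith [neg_abs_le (v j), hle j, Real.log_nonneg hB]
  · rw [Real.log_le_iff_le_exp hpos, Real.exp_add, Real.exp_log (by linarith)]
    calc ∑ l, Real.exp (v l) ≤ ∑ _l : Fin B, Real.exp (∑ l, |v l|) :=
          Finset.sum_le_sum fun l _ => Real.exp_le_exp.2 ((le_abs_self _).trans (hle l))
      _ = _ := by simp

theorem integrable_log_sum_exp {B : ℕ} (j : Fin B) (t : ℝ) :
    Integrable (fun z => Real.log (∑ l, Real.exp (t * output t j z l))) (gamPi B) := by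
  have hi : Integrable (fun z => Real.log B + ∑ l, |t * output t j z l|) (gamPi B) := by
    refine (integrable_const _).add (integrable_finsetSum _ fun l _ => Integrable.abs ?_)
    unfold output
    exact ((integrable_const _).add (integrable_eval_gamPi l)).const_mul t
  refine hi.mono' ?_ (ae_of_all _ fun z => abs_log_sum_exp_le _ j)
  unfold output
  exact Measurable.aestronglyMeasurable (by fun_prop)

/-- Gaussian integration by parts in the coordinate `z k` alone, where the derivative of the softmax
is `t (p_k - p_k²)`. -/
theorem integral_mul_posterior {B : ℕ} (t : ℝ) (j k : Fin B) :
    ∫ z, z k * posterior t (output t j z) k ∂(gamPi B) =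
      ∫ z, t * (posterior t (output t j z) k - posterior t (output t j z) k ^ 2) ∂(gamPi B) := by
  obtain ⟨n, rfl⟩ : ∃ n, B = n + 1 := ⟨B - 1, by have := j.pos; omega⟩
  have hpm : Measurable fun z => posterior t (output t j z) k :=
    (measurable_posterior t k).comp (measurable_output t j)
  have hb : ∀ y : Fin (n + 1) → ℝ, |posterior t y k| ≤ 1 := fun y => by
    rw [abs_of_nonneg (posterior_nonneg _ _ _)]; exact posterior_le_one _ _ _
  have hb2 : ∀ y : Fin (n + 1) → ℝ, |t * (posterior t y k - posterior t y k ^ 2)| ≤ |t| := fun y => by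
    have h0 := posterior_nonneg t y k
    have h1 := posterior_le_one t y k
    rw [abs_mul]
    refine mul_le_of_le_one_right (abs_nonneg _) ?_
    rw [abs_le]; constructor <;> nlinarith
  rw [integral_pi_gam_eq k ((integrable_eval_gamPi k).mul_bdd hpm.aestronglyMeasurable
      (ae_of_all _ fun z => hb _)),
    integral_pi_gam_eq k (F := fun z =>
      t * (posterior t (output t j z) k - posterior t (output t j z) k ^ 2)) (Integrable.of_bound
      (((hpm.sub (hpm.pow_const 2)).const_mul t)).aestronglyMeasurable |t|
      (ae_of_all _ fun z => hb2 _))]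
  congr 1; ext y
  simp only [Fin.insertNth_apply_same]
  set Z : ℝ → Fin (n + 1) → ℝ := fun x => output t j (k.insertNth (α := fun _ => ℝ) x y) with hZ
  have hcont : Continuous Z := by
    refine continuous_pi fun i => ?_
    simp only [hZ, output]
    refine continuous_const.add ?_
    refine Fin.succAboveCases k ?_ (fun i => ?_) i
    · simpa using continuous_id'
    · simpa using continuous_const
  have hder : ∀ x l, HasDerivAt (fun x => Real.exp (t * Z x l))
      (if l = k then t * Real.exp (t * Z x k) else 0) x := fun x l => by
    simp only [hZ, output]
    by_cases hl : l = k
    · subst hl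
      simp only [if_true, Fin.insertNth_apply_same]
      have h1 : HasDerivAt (fun x => t * (t * sect (n + 1) j l + x)) t x := by
        simpa using ((hasDerivAt_id x).const_add (t * sect (n + 1) j l)).const_mul t
      exact h1.exp.congr_deriv (by ring)
    · obtain ⟨i, rfl⟩ := Fin.exists_succAbove_eq hl
      simp only [Fin.insertNth_apply_succAbove, if_neg hl]
      exact hasDerivAt_const _ _
  refine integral_mul_gam (f := fun x => posterior t (Z x) k) (fun x => ?_)
    (fun x => hb _) ?_ (fun x => hb2 _)
  · have h1 := (hder x k).div (HasDerivAt.fun_sum (u := Finset.univ) fun l _ => hder x l)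
      (sum_exp_pos t (Z x) k).ne'
    refine h1.congr_deriv ?_
    have h3 := (sum_exp_pos t (Z x) k).ne'
    simp only [if_true, Finset.sum_ite_eq', Finset.mem_univ]
    simp only [hZ, posterior] at h3 ⊢
    field_simp
  · have h1 : Continuous fun x => posterior t (Z x) k :=
      (continuous_posterior k).comp (continuous_const.prodMk hcont)
    exact ((h1.sub (h1.pow 2)).const_mul t).measurable

/-- Differentiation gives `∑ p_l (2 t s_l + z_l)`, and integration by parts turns `z_l p_l` into `t
(p_l - p_l²)`. Since the `p_l` sum to one, the result is `2 t` minus `t` times the square error. The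
identity holds for each position separately, without averaging over the prior. -/
theorem hasDerivAt_logPart {B : ℕ} (j : Fin B) (t : ℝ) :
    HasDerivAt (logPart B j) (2 * t - t * mseAt B j t) t := by
  set F' : ℝ → (Fin B → ℝ) → ℝ := fun s z =>
    ∑ l, posterior s (output s j z) l * (2 * s * sect B j l + z l) with hF'
  have hd : ∀ s z, HasDerivAt (fun s => Real.log (∑ l, Real.exp (s * output s j z l)))
      (F' s z) s := fun s z => by
    have h1 : ∀ l, HasDerivAt (fun s => Real.exp (s * output s j z l))
        (Real.exp (s * output s j z l) * (2 * s * sect B j l + z l)) s := fun l => by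
      refine HasDerivAt.exp ?_
      unfold output
      have := (hasDerivAt_id s).mul (((hasDerivAt_id s).mul_const (sect B j l)).add_const (z l))
      exact this.congr_deriv (by simp; ring)
    have h2 := (HasDerivAt.fun_sum (u := Finset.univ) fun l _ => h1 l).log
      (sum_exp_pos s (output s j z) j).ne'
    refine h2.congr_deriv ?_
    simp only [hF', posterior, Finset.sum_div]
    exact Finset.sum_congr rfl fun l _ => by ring
  have hF'm : ∀ s, Measurable (F' s) := fun s => Finset.measurable_sum _ fun l _ =>
    ((measurable_posterior s l).comp (measurable_output s j)).mul (by fun_prop)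
  have hs1 : ∀ l, |sect B j l| ≤ 1 := fun l => by
    unfold sect; rw [Pi.single_apply]; split_ifs <;> simp
  have key := (hasDerivAt_integral_of_dominated_loc_of_deriv_le (μ := gamPi B)
    (F := fun s z => Real.log (∑ l, Real.exp (s * output s j z l))) (F' := F') (x₀ := t)
    (bound := fun z => ∑ l, (2 * (|t| + 1) + |z l|)) (Metric.ball_mem_nhds t one_pos)
    (Eventually.of_forall fun s => (integrable_log_sum_exp j s).aestronglyMeasurable)
    (integrable_log_sum_exp j t) (hF'm t).aestronglyMeasurable
    (ae_of_all _ fun z s hs => by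
      refine (abs_le_of_weights _ _ (fun l => posterior_nonneg _ _ _)
        fun l => posterior_le_one _ _ _).trans (Finset.sum_le_sum fun l _ => ?_)
      refine (abs_add_le _ _).trans (add_le_add_left ?_ _)
      rw [abs_mul, abs_mul, abs_two]
      have : |s| ≤ |t| + 1 := by
        rw [Metric.mem_ball, Real.dist_eq] at hs
        have := abs_sub_abs_le_abs_sub s t
        linarith
      nlinarith [hs1 l, abs_nonneg (sect B j l), abs_nonneg s])
    (integrable_finsetSum _ fun l _ => (integrable_const _).add (integrable_eval_gamPi l).abs)
    (ae_of_all _ fun z s _ => hd s z)).2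
  refine key.congr_deriv ?_
  have hpm : ∀ k, Measurable fun z => posterior t (output t j z) k := fun k =>
    (measurable_posterior t k).comp (measurable_output t j)
  have hb : ∀ k (y : Fin B → ℝ), |posterior t y k| ≤ 1 := fun k y => by
    rw [abs_of_nonneg (posterior_nonneg _ _ _)]; exact posterior_le_one _ _ _
  have hp : ∀ k, Integrable (fun z => posterior t (output t j z) k) (gamPi B) := fun k =>
    Integrable.of_bound (hpm k).aestronglyMeasurable 1 (ae_of_all _ fun z => hb k _)
  have hp2 : ∀ k, Integrable (fun z => posterior t (output t j z) k ^ 2) (gamPi B) := fun k =>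
    Integrable.of_bound ((hpm k).pow_const 2).aestronglyMeasurable 1 (ae_of_all _ fun z => by
      rw [Real.norm_eq_abs, abs_pow]; exact pow_le_one₀ (abs_nonneg _) (hb k _))
  have hpp : ∀ k, Integrable (fun z => posterior t (output t j z) k -
      posterior t (output t j z) k ^ 2) (gamPi B) := fun k => (hp k).sub (hp2 k)
  have hzp : ∀ k, Integrable (fun z => z k * posterior t (output t j z) k) (gamPi B) := fun k =>
    (integrable_eval_gamPi k).mul_bdd (hpm k).aestronglyMeasurable (ae_of_all _ fun z => hb k _)
  have e1 : ∫ z, F' t z ∂(gamPi B) = ∑ k, (2 * t * sect B j k *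
      ∫ z, posterior t (output t j z) k ∂(gamPi B) +
      ∫ z, t * (posterior t (output t j z) k - posterior t (output t j z) k ^ 2) ∂(gamPi B)) := by
    have : ∀ z, F' t z = ∑ k, (2 * t * sect B j k * posterior t (output t j z) k +
        z k * posterior t (output t j z) k) := fun z => Finset.sum_congr rfl fun k _ => by ring
    simp only [this]
    have hsum : ∀ k, Integrable (fun z => 2 * t * sect B j k * posterior t (output t j z) k +
        z k * posterior t (output t j z) k) (gamPi B) := fun k =>
      ((hp k).const_mul _).add (hzp k)
    rw [integral_finsetSum _ fun k _ => hsum k]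
    refine Finset.sum_congr rfl fun k _ => ?_
    rw [integral_add ((hp k).const_mul _) (hzp k), integral_const_mul, integral_mul_posterior]
  have e2 : ∀ z, ∑ i, (posterior t (output t j z) i - sect B j i) ^ 2 =
      2 - ∑ k, (2 * sect B j k * posterior t (output t j z) k +
        (posterior t (output t j z) k - posterior t (output t j z) k ^ 2)) := fun z => by
    have h1 : ∑ i, sect B j i ^ 2 = 1 := by
      unfold sect; simp [Pi.single_apply]
    have h2 := sum_posterior t (output t j z) j
    calc _ = (∑ i, sect B j i ^ 2) + (∑ i, posterior t (output t j z) i) -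
          ∑ k, (2 * sect B j k * posterior t (output t j z) k +
        (posterior t (output t j z) k - posterior t (output t j z) k ^ 2)) := by
          rw [← Finset.sum_add_distrib, ← Finset.sum_sub_distrib]
          exact Finset.sum_congr rfl fun k _ => by ring
      _ = _ := by rw [h1, h2]; ring
  rw [e1, mseAt]
  simp only [e2]
  have hint : ∀ k, Integrable (fun z => 2 * sect B j k * posterior t (output t j z) k +
        (posterior t (output t j z) k - posterior t (output t j z) k ^ 2)) (gamPi B) := fun k =>
    ((hp k).const_mul _).add (hpp k)
  rw [integral_sub (integrable_const _) (integrable_finsetSum _ fun k _ => hint k),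
    integral_finsetSum _ fun k _ => hint k]
  simp only [integral_const, probReal_univ, one_smul]
  rw [mul_sub, mul_comm t 2, sub_sub_cancel, Finset.mul_sum]
  refine Finset.sum_congr rfl fun k _ => ?_
  rw [integral_add ((hp k).const_mul _) (hpp k), integral_const_mul,
    integral_const_mul]
  ring

/-- The average of `logPart` minus the energy `t²`. -/
noncomputable def freeLog (B : ℕ) (t : ℝ) : ℝ :=
  ∑ j : Fin B, (1 / (B : ℝ)) * logPart B j t - t ^ 2

theorem hasDerivAt_freeLog {B : ℕ} (hB : 0 < B) (t : ℝ) :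
    HasDerivAt (freeLog B) (-t * mseAmp B t) t := by
  have hB' : (B : ℝ) ≠ 0 := by exact_mod_cast hB.ne'
  have h := (HasDerivAt.fun_sum (u := Finset.univ) fun (j : Fin B) _ =>
    (hasDerivAt_logPart j t).const_mul (1 / (B : ℝ))).sub (hasDerivAt_pow 2 t)
  refine h.congr_deriv ?_
  unfold mseAmp
  simp only [mul_sub, Finset.sum_sub_distrib, Finset.mul_sum, Finset.sum_const, Finset.card_univ,
    Fintype.card_fin, nsmul_eq_mul]
  have : ∀ x : ℝ, (B : ℝ) * (1 / B * (2 * x)) = 2 * x := fun x => by field_simp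
  rw [this]
  push_cast
  rw [pow_one, sub_right_comm, sub_self, zero_sub,
    ← Finset.sum_neg_distrib]
  exact Finset.sum_congr rfl fun j _ => by ring

/-- The derivative `-x * mseAmp B x` is at most `-x * mseAmp B t` on `[s, t]`, because the error
decreases with the amplitude. -/
theorem freeLog_sub_le {B : ℕ} (hB : 0 < B) {s t : ℝ} (hs : 0 ≤ s) (hst : s ≤ t) :
    freeLog B t - freeLog B s ≤ -(mseAmp B t * (t ^ 2 - s ^ 2) / 2) := by
  have hd : ∀ x, HasDerivAt (fun x => freeLog B x + mseAmp B t * x ^ 2 / 2)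
      (x * (mseAmp B t - mseAmp B x)) x := fun x => by
    have := (hasDerivAt_freeLog hB x).add (((hasDerivAt_pow 2 x).const_mul (mseAmp B t)).div_const 2)
    exact this.congr_deriv (by push_cast; ring)
  have hanti : AntitoneOn (fun x => freeLog B x + mseAmp B t * x ^ 2 / 2) (Set.Icc s t) := by
    refine antitoneOn_of_deriv_nonpos (convex_Icc s t)
      (fun x _ => (hd x).continuousAt.continuousWithinAt)
      (fun x _ => (hd x).differentiableAt.differentiableWithinAt) fun x hx => ?_
    rw [interior_Icc] at hx
    rw [(hd x).deriv]
    exact mul_nonpos_of_nonneg_of_nonpos (hs.trans hx.1.le)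
      (sub_nonpos.2 (mseAmp_antitone (hs.trans hx.1.le) hx.2.le))
  have := hanti (Set.left_mem_Icc.2 hst) (Set.right_mem_Icc.2 hst) hst
  simp only at this
  linarith

/-! ### The error and the section potential as functions of the inverse noise. -/

theorem mse_nonneg (B : ℕ) (τ : ℝ≥0∞) : 0 ≤ mse B τ := by
  unfold mse expSZ
  exact Finset.sum_nonneg fun _ _ => mul_nonneg (by positivity)
    (integral_nonneg fun _ => Finset.sum_nonneg fun _ _ => sq_nonneg _)

theorem mse_antitone (B : ℕ) : Antitone (mse B) := fun σ τ h => by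
  by_cases hτ : τ = ∞
  · rw [hτ, mse_top]; exact mse_nonneg B σ
  have hσ : σ ≠ ∞ := ne_top_of_le_ne_top hτ h
  rw [mse_eq_mseAmp B τ hτ, mse_eq_mseAmp B σ hσ]
  refine mseAmp_antitone (Real.sqrt_nonneg _) (Real.sqrt_le_sqrt ?_)
  rcases Nat.eq_zero_or_pos B with rfl | hB
  · simp
  exact mul_le_mul_of_nonneg_right (ENNReal.toReal_mono hτ h)
    (Real.logb_nonneg (by norm_num) (by exact_mod_cast hB))

theorem mse_le_one (B : ℕ) (hB : 0 < B) (τ : ℝ≥0∞) : mse B τ ≤ 1 := by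
  refine (mse_antitone B (zero_le : 0 ≤ τ)).trans ?_
  rw [mse_eq_mseAmp B 0 (by simp)]
  -- The comparison estimator is identically zero; its error is the squared norm of the section,
  -- equal to 1.
  have hs : ∀ j i : Fin B, |sect B j i| ≤ 1 := fun j i => by
    unfold sect; rw [Pi.single_apply]; split_ifs <;> simp
  refine (mseAmp_le_of_estimator _ (fun _ _ => 0) (fun _ => measurable_const)
    fun j i _ => by rw [zero_sub, abs_neg]; exact hs j i).trans ?_
  have h1 : ∀ j : Fin B, ∑ i, ((0 : ℝ) - sect B j i) ^ 2 = 1 := fun j => by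
    unfold sect; simp [Pi.single_apply]
  have : (B : ℝ) ≠ 0 := by exact_mod_cast hB.ne'
  simp only [h1]
  simp [this]

theorem sum_theta (B : ℕ) (τ : ℝ≥0∞) (hτ : τ ≠ ∞) (j : Fin B) (z : Fin B → ℝ) :
    ∑ k : Fin B, (1 / (B : ℝ)) * theta B τ (sect B k) (sect B j) z =
      (1 / (B : ℝ)) * (∑ k, Real.exp (√(τ.toReal * Real.logb 2 B) *
        output (√(τ.toReal * Real.logb 2 B)) j z k)) *
      Real.exp (-((√(τ.toReal * Real.logb 2 B)) ^ 2 +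
        ∑ i, output (√(τ.toReal * Real.logb 2 B)) j z i ^ 2) / 2) := by
  simp only [theta_sect _ _ _ τ hτ]
  rw [← Finset.mul_sum, ← Finset.sum_mul, mul_assoc]

theorem integral_energy (B : ℕ) (t : ℝ) (j : Fin B) :
    Integrable (fun z => (t ^ 2 + ∑ i, output t j z i ^ 2) / 2) (gamPi B) ∧
    ∫ z, (t ^ 2 + ∑ i, output t j z i ^ 2) / 2 ∂(gamPi B) = t ^ 2 + B / 2 := by
  have e : ∀ z, (t ^ 2 + ∑ i, output t j z i ^ 2) / 2 =
      t ^ 2 + ∑ i, (t * sect B j i * z i + z i ^ 2 / 2) := fun z => by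
    have h1 : ∑ i, (t * sect B j i) ^ 2 = t ^ 2 := by
      unfold sect; simp [Pi.single_apply]
    have : ∑ i, output t j z i ^ 2 = ∑ i, (t * sect B j i) ^ 2 +
        2 * ∑ i, (t * sect B j i * z i + z i ^ 2 / 2) := by
      rw [Finset.mul_sum, ← Finset.sum_add_distrib]
      exact Finset.sum_congr rfl fun i _ => by unfold output; ring
    rw [this, h1]; ring
  simp only [e]
  have hi : ∀ i : Fin B, Integrable (fun z => t * sect B j i * z i + z i ^ 2 / 2) (gamPi B) :=
    fun i => ((integrable_eval_gamPi i).const_mul _).add ((integrable_eval_sq_gamPi i).div_const 2)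
  refine ⟨(integrable_const _).add (integrable_finsetSum _ fun i _ => hi i), ?_⟩
  rw [integral_add (integrable_const _) (integrable_finsetSum _ fun i _ => hi i),
    integral_finsetSum _ fun i _ => hi i]
  have h1 : ∀ i : Fin B, ∫ z, z i ∂(gamPi B) = 0 := fun i => by
    have := integral_comp_measurePreserving (measurePreserving_eval (fun _ : Fin B => gam) i)
      (F := fun x => x) (by fun_prop)
    simpa using this
  have h2 : ∀ i : Fin B, ∫ z, z i ^ 2 ∂(gamPi B) = 1 := fun i => by
    have := integral_comp_measurePreserving (measurePreserving_eval (fun _ : Fin B => gam) i)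
      (F := fun x => x ^ 2) (by fun_prop)
    rw [integral_sq_gam] at this
    exact this
  have h3 : ∀ i : Fin B, ∫ z, (t * sect B j i * z i + z i ^ 2 / 2) ∂(gamPi B) = 1 / 2 := fun i => by
    rw [integral_add ((integrable_eval_gamPi i).const_mul _)
      ((integrable_eval_sq_gamPi i).div_const 2), integral_const_mul, integral_div, h1, h2]
    ring
  simp [h3]
  ring

theorem log_sum_theta (B : ℕ) (τ : ℝ≥0∞) (hτ : τ ≠ ∞) (j : Fin B) (z : Fin B → ℝ) :
    Real.log (∑ k : Fin B, (1 / (B : ℝ)) * theta B τ (sect B k) (sect B j) z) =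
      Real.log (∑ k, Real.exp (√(τ.toReal * Real.logb 2 B) *
        output (√(τ.toReal * Real.logb 2 B)) j z k)) -
      (((√(τ.toReal * Real.logb 2 B)) ^ 2 +
        ∑ i, output (√(τ.toReal * Real.logb 2 B)) j z i ^ 2) / 2 + Real.log B) := by
  have hB : (B : ℝ) ≠ 0 := by exact_mod_cast j.pos.ne'
  have h := (sum_exp_pos (√(τ.toReal * Real.logb 2 B))
    (output (√(τ.toReal * Real.logb 2 B)) j z) j).ne'
  rw [sum_theta B τ hτ, Real.log_mul (by positivity) (Real.exp_pos _).ne', Real.log_exp,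
    Real.log_mul (by positivity) h, one_div, Real.log_inv]
  ring

theorem integrable_log_sum_theta (B : ℕ) (τ : ℝ≥0∞) (hτ : τ ≠ ∞) (j : Fin B) :
    Integrable (fun z => Real.log (∑ k : Fin B, (1 / (B : ℝ)) *
      theta B τ (sect B k) (sect B j) z)) (gamPi B) := by
  simp only [log_sum_theta B τ hτ]
  exact (integrable_log_sum_exp j _).sub ((integral_energy B _ j).1.add (integrable_const _))

/-- The logarithm splits into the log-sum-exp of the output and an energy that does not depend on
the candidate section; the energy has mean `t² + B / 2`, with `t² = τ log₂ B`. -/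
theorem Su_eq (B : ℕ) (hB : 0 < B) (τ : ℝ≥0∞) (hτ : τ ≠ ∞) :
    Su B τ = (freeLog B (√(τ.toReal * Real.logb 2 B)) - (B / 2 + Real.log B)) / Real.log B := by
  have hB' : (B : ℝ) ≠ 0 := by exact_mod_cast hB.ne'
  have h : ∀ j : Fin B, ∫ z, Real.log (∑ k : Fin B, (1 / (B : ℝ)) *
      theta B τ (sect B k) (sect B j) z) ∂(gamPi B) =
      logPart B j (√(τ.toReal * Real.logb 2 B)) -
        ((√(τ.toReal * Real.logb 2 B)) ^ 2 + B / 2 + Real.log B) := fun j => by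
    simp only [log_sum_theta B τ hτ]
    have hi : Integrable (fun z => ((√(τ.toReal * Real.logb 2 B)) ^ 2 +
        ∑ i, output (√(τ.toReal * Real.logb 2 B)) j z i ^ 2) / 2 + Real.log B) (gamPi B) :=
      (integral_energy B _ j).1.add (integrable_const _)
    rw [integral_sub (integrable_log_sum_exp j _) hi,
      integral_add (integral_energy B _ j).1 (integrable_const _), (integral_energy B _ j).2]
    simp [logPart]
  unfold Su expSZ Real.logb freeLog
  unfold Real.logb at h
  simp only [integral_div, h]
  simp only [mul_sub, mul_div_assoc', sub_div, Finset.sum_sub_distrib, ← Finset.sum_div,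
    Finset.sum_const, Finset.card_univ, Fintype.card_fin, nsmul_eq_mul]
  field_simp
  ring

/-- Minus the potential of the section channel, normalized to have derivative `mse`. -/
noncomputable def sectPot (B : ℕ) (τ : ℝ≥0∞) : ℝ := -(2 * Real.log 2 * Su B τ)

/-- `sectPot` is a concave primitive of `mse` in the variable `τ`: the squared amplitude is `τ log₂
B`, and the factors 2 ln 2 and ln B bring the slope to exactly `mse`. The inequality uses the
smallest slope on `[s, t]`. -/
theorem mse_mul_le_sectPot_sub (B : ℕ) (hB : 2 ≤ B) {s t : ℝ} (hs : 0 ≤ s) (hst : s ≤ t) :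
    mse B (ENNReal.ofReal t) * (t - s) ≤
      sectPot B (ENNReal.ofReal t) - sectPot B (ENNReal.ofReal s) := by
  have hB1 : (1 : ℝ) < B := by exact_mod_cast hB
  have hlB : 0 < Real.log B := Real.log_pos hB1
  have hl2 : 0 < Real.log 2 := Real.log_pos (by norm_num)
  have hL : 0 ≤ Real.logb 2 B := Real.logb_nonneg (by norm_num) hB1.le
  have ht : 0 ≤ t := hs.trans hst
  unfold sectPot
  rw [Su_eq B (by omega) _ ENNReal.ofReal_ne_top, Su_eq B (by omega) _ ENNReal.ofReal_ne_top,
    mse_eq_mseAmp B _ ENNReal.ofReal_ne_top, ENNReal.toReal_ofReal hs, ENNReal.toReal_ofReal ht]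
  have key := freeLog_sub_le (B := B) (by omega) (Real.sqrt_nonneg (s * Real.logb 2 B))
    (Real.sqrt_le_sqrt (mul_le_mul_of_nonneg_right hst hL))
  rw [Real.sq_sqrt (mul_nonneg hs hL), Real.sq_sqrt (mul_nonneg ht hL)] at key
  set q := mseAmp B √(t * Real.logb 2 B)
  have e : q * (t - s) = 2 * Real.log 2 / Real.log B *
      (q * (t * Real.logb 2 B - s * Real.logb 2 B) / 2) := by
    unfold Real.logb; field_simp
  rw [e]
  have := mul_le_mul_of_nonneg_left key (by positivity : 0 ≤ 2 * Real.log 2 / Real.log B)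
  calc _ ≤ -(2 * Real.log 2 / Real.log B * (freeLog B √(t * Real.logb 2 B) -
        freeLog B √(s * Real.logb 2 B))) := by linarith
    _ = _ := by field_simp; ring

/-- Keeping only the term of the true section in the partition function gives precisely its value at
infinite inverse noise, so `Su` is smallest there. -/
theorem sectPot_mono_top (B : ℕ) (hB : 2 ≤ B) (τ : ℝ≥0∞) : sectPot B τ ≤ sectPot B ∞ := by
  by_cases hτ : τ = ∞
  · rw [hτ]
  have hl2 : 0 < Real.log 2 := Real.log_pos (by norm_num)
  unfold sectPot
  refine neg_le_neg (mul_le_mul_of_nonneg_left ?_ (by positivity))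
  unfold Su expSZ
  refine Finset.sum_le_sum fun j _ => mul_le_mul_of_nonneg_left ?_ (by positivity)
  have hB1 : (1 : ℝ) < B := by exact_mod_cast hB
  have hinj : ∀ k, sect B k = sect B j ↔ k = j := fun k => by
    refine ⟨fun h => ?_, fun h => by rw [h]⟩
    have := congrFun h k
    unfold sect at this
    by_contra hne
    rw [Pi.single_eq_same, Pi.single_eq_of_ne hne] at this
    norm_num at this
  have e : ∀ z, ∑ k : Fin B, (1 / (B : ℝ)) * theta B ∞ (sect B k) (sect B j) z =
      (1 / (B : ℝ)) * Real.exp (-(∑ i, z i ^ 2) / 2) := fun z => by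
    unfold theta
    simp [hinj]
  simp only [e]
  have hle : ∀ z, (1 / (B : ℝ)) * Real.exp (-(∑ i, z i ^ 2) / 2) ≤
      ∑ k : Fin B, (1 / (B : ℝ)) * theta B τ (sect B k) (sect B j) z := fun z => by
    have h0 : (1 / (B : ℝ)) * Real.exp (-(∑ i, z i ^ 2) / 2) =
        (1 / (B : ℝ)) * theta B τ (sect B j) (sect B j) z := by
      rw [theta, if_neg hτ]; simp
    rw [h0]
    refine Finset.single_le_sum (f := fun k => (1 / (B : ℝ)) *
      theta B τ (sect B k) (sect B j) z) (fun k _ => ?_) (Finset.mem_univ j)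
    rw [theta, if_neg hτ]; positivity
  unfold Real.logb
  rw [integral_div, integral_div]
  refine div_le_div_of_nonneg_right ?_ (Real.log_nonneg hB1.le)
  refine integral_mono ?_ (integrable_log_sum_theta B τ hτ j)
    fun z => Real.log_le_log (by positivity) (hle z)
  have e2 : ∀ z : Fin B → ℝ, Real.log ((1 / (B : ℝ)) * Real.exp (-(∑ i, z i ^ 2) / 2)) =
      Real.log (1 / B) + (-(∑ i, z i ^ 2) / 2) := fun z => by
    rw [Real.log_mul (by positivity) (Real.exp_pos _).ne', Real.log_exp]
  simp only [e2]
  exact (integrable_const _).add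
    ((integrable_finsetSum _ fun i _ => integrable_eval_sq_gamPi i).neg.div_const 2)

/-! ### Gaussian smoothing and the logarithmic Sobolev inequality -/

/-- Gaussian smoothing with variance `s`. -/
noncomputable def gsmooth (s : ℝ) (F : ℝ → ℝ) (x : ℝ) : ℝ := ∫ w, F (x + √s * w) ∂gam

/-- The entropy of `F` with respect to the Gaussian with mean `x` and variance `s`. -/
noncomputable def gent (s : ℝ) (F : ℝ → ℝ) (x : ℝ) : ℝ :=
  gsmooth s (fun y => F y * Real.log (F y)) x - gsmooth s F x * Real.log (gsmooth s F x)

theorem bounded_integrable_gam {F : ℝ → ℝ} (hF : Measurable F) {C : ℝ} (hC : ∀ x, |F x| ≤ C)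
    (x s : ℝ) : Integrable (fun w => F (x + √s * w)) gam :=
  Integrable.of_bound (hF.comp (by fun_prop)).aestronglyMeasurable C (ae_of_all _ fun _ => hC _)

theorem measurable_gsmooth {F : ℝ → ℝ} (hF : Measurable F) (s : ℝ) : Measurable (gsmooth s F) := by
  have h : StronglyMeasurable fun p : ℝ × ℝ => F (p.1 + √s * p.2) :=
    (hF.comp (by fun_prop)).stronglyMeasurable
  exact h.integral_prod_right.measurable

theorem abs_gsmooth_le {F : ℝ → ℝ} {C : ℝ} (hC : ∀ x, |F x| ≤ C)
    (x s : ℝ) : |gsmooth s F x| ≤ C := by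
  have := norm_integral_le_of_norm_le_const (μ := gam) (f := fun w => F (x + √s * w)) (C := C)
    (ae_of_all _ fun w => hC _)
  simpa [gsmooth] using this

/-- The normalized combination of two standard Gaussians with weights `√(a / (a + b))` and `√(b / (a
+ b))` is standard Gaussian. If `a + b = 0` the noise plays no role, and the first projection
serves. -/
theorem measurePreserving_combine_var (a b : ℝ) (ha : 0 ≤ a) (hb : 0 ≤ b) (x : ℝ) {s : ℝ → ℝ}
    (hs : ∀ w, s w = x + √(a + b) * w) :
    ∃ f : ℝ × ℝ → ℝ, MeasurePreserving f (gam.prod gam) gam ∧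
      ∀ p, s (f p) = x + √a * p.1 + √b * p.2 := by
  rcases (add_nonneg ha hb).eq_or_lt with h0 | h0
  · refine ⟨Prod.fst, measurePreserving_fst, fun p => ?_⟩
    have ha0 : a = 0 := by linarith
    have hb0 : b = 0 := by linarith
    simp [hs, ha0, hb0]
  · refine ⟨fun p => √(a / (a + b)) * p.1 + √(b / (a + b)) * p.2,
      measurePreserving_combine_gam _ _ ?_, fun p => ?_⟩
    · rw [Real.sq_sqrt (by positivity), Real.sq_sqrt (by positivity), ← add_div, div_self h0.ne']
    · have h1 : ∀ c, 0 ≤ c → √(a + b) * √(c / (a + b)) = √c := fun c hc => by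
        rw [← Real.sqrt_mul h0.le, mul_div_cancel₀ _ h0.ne']
      rw [hs]
      simp only [mul_add, ← mul_assoc, h1 a ha, h1 b hb, add_assoc]

/-- Semigroup property of Gaussian smoothing. -/
theorem gsmooth_add_of_integrable {F : ℝ → ℝ} {a b : ℝ} (ha : 0 ≤ a)
    (hb : 0 ≤ b) (x : ℝ) (hi : Integrable (fun w => F (x + √(a + b) * w)) gam) :
    gsmooth (a + b) F x = gsmooth a (gsmooth b F) x := by
  obtain ⟨f, hf, hfs⟩ := measurePreserving_combine_var a b ha hb x (fun w => rfl)
  have h1 := integral_comp_measurePreserving hf (F := fun w => F (x + √(a + b) * w))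
    hi.aestronglyMeasurable
  have h2 := hf.integrable_comp_of_integrable hi
  simp only [Function.comp_def, hfs] at h1 h2
  rw [integral_prod _ h2] at h1
  simp only [gsmooth]
  exact h1.symm

theorem gsmooth_add {F : ℝ → ℝ} (hF : Measurable F) {C : ℝ} (hC : ∀ x, |F x| ≤ C) {a b : ℝ}
    (ha : 0 ≤ a) (hb : 0 ≤ b) (x : ℝ) : gsmooth (a + b) F x = gsmooth a (gsmooth b F) x :=
  gsmooth_add_of_integrable ha hb x (bounded_integrable_gam hF hC x _)

/-- Bounded functions, bounded away from zero, with bounded Lipschitz derivative. -/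
structure TameDensity (δ L : ℝ) (g g' : ℝ → ℝ) : Prop where
  δ_pos : 0 < δ
  deriv : ∀ x, HasDerivAt g (g' x) x
  lower : ∀ x, δ ≤ g x
  upper : ∀ x, g x ≤ L
  deriv_bound : ∀ x, |g' x| ≤ L
  deriv_lip : ∀ x y, |g' x - g' y| ≤ L * |x - y|

namespace TameDensity

variable {δ L : ℝ} {g g' : ℝ → ℝ}

theorem L_pos (h : TameDensity δ L g g') : 0 < L := h.δ_pos.trans_le ((h.lower 0).trans (h.upper 0))

theorem pos (h : TameDensity δ L g g') (x : ℝ) : 0 < g x := h.δ_pos.trans_le (h.lower x)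

theorem abs_le (h : TameDensity δ L g g') (x : ℝ) : |g x| ≤ L := by rw [abs_of_pos (h.pos x)]; exact h.upper x

theorem continuous (h : TameDensity δ L g g') : Continuous g := continuous_iff_continuousAt.2 fun x => (h.deriv x).continuousAt

theorem continuous_deriv (h : TameDensity δ L g g') : Continuous g' :=
  (LipschitzWith.of_dist_le_mul (K := L.toNNReal) fun x y => by
    rw [Real.dist_eq, Real.dist_eq, Real.coe_toNNReal _ h.L_pos.le]; exact h.deriv_lip x y).continuous

theorem lip (h : TameDensity δ L g g') (x y : ℝ) : |g x - g y| ≤ L * |x - y| := by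
  have := Convex.norm_image_sub_le_of_norm_hasDerivWithin_le (f := g) (f' := g') (C := L)
    (s := Set.univ) (fun x _ => (h.deriv x).hasDerivWithinAt) (fun x _ => h.deriv_bound x)
    convex_univ (Set.mem_univ y) (Set.mem_univ x)
  simpa using this

theorem taylor (h : TameDensity δ L g g') (x t : ℝ) : |g (x + t) - g x - t * g' x| ≤ L * t ^ 2 := by
  have := Convex.norm_image_sub_le_of_norm_hasDerivWithin_le
    (f := fun y => g y - y * g' x) (f' := fun y => g' y - g' x) (C := L * |t|)
    (s := Metric.closedBall x |t|)
    (fun y _ => ((h.deriv y).sub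
      (by simpa using (hasDerivAt_id y).mul_const (g' x))).hasDerivWithinAt)
    (fun y hy => (h.deriv_lip y x).trans (mul_le_mul_of_nonneg_left
      (by simpa [Real.dist_eq] using hy) h.L_pos.le))
    (convex_closedBall x _) (Metric.mem_closedBall_self (abs_nonneg t))
    (y := x + t) (by simp)
  have e : g (x + t) - (x + t) * g' x - (g x - x * g' x) = g (x + t) - g x - t * g' x := by ring
  rw [e, Real.norm_eq_abs, Real.norm_eq_abs, add_sub_cancel_left, mul_assoc, abs_mul_abs_self,
    ← sq] at this
  exact this

/-- The constants `δ` and `L` survive smoothing, which makes the errors in the iteration of the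
short-time estimate uniform. -/
theorem smooth (h : TameDensity δ L g g') (s : ℝ) : TameDensity δ L (gsmooth s g) (gsmooth s g') where
  δ_pos := h.δ_pos
  deriv x := by
    refine (hasDerivAt_integral_of_dominated_loc_of_deriv_le (μ := gam)
      (F := fun x w => g (x + √s * w)) (F' := fun x w => g' (x + √s * w)) (x₀ := x)
      (bound := fun _ => L) (Metric.ball_mem_nhds x one_pos)
      (Eventually.of_forall fun y =>
        (bounded_integrable_gam h.continuous.measurable h.abs_le y s).aestronglyMeasurable)
      (bounded_integrable_gam h.continuous.measurable h.abs_le x s)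
      (bounded_integrable_gam h.continuous_deriv.measurable h.deriv_bound x s).aestronglyMeasurable
      (ae_of_all _ fun w y _ => h.deriv_bound _) (integrable_const _)
      (ae_of_all _ fun w y _ => ?_)).2
    exact HasDerivAt.comp_add_const y (√s * w) (h.deriv _)
  lower x := by
    have := integral_mono (μ := gam) (integrable_const δ)
      (bounded_integrable_gam h.continuous.measurable h.abs_le x s) fun w => h.lower _
    simpa [gsmooth] using this
  upper x := (le_abs_self _).trans (abs_gsmooth_le h.abs_le x s)
  deriv_bound x := abs_gsmooth_le h.deriv_bound x s
  deriv_lip x y := by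
    unfold gsmooth
    rw [← integral_sub (bounded_integrable_gam h.continuous_deriv.measurable h.deriv_bound x s)
      (bounded_integrable_gam h.continuous_deriv.measurable h.deriv_bound y s)]
    have := norm_integral_le_of_norm_le_const (μ := gam)
      (f := fun w => g' (x + √s * w) - g' (y + √s * w)) (C := L * |x - y|)
      (ae_of_all _ fun w => by
        have := h.deriv_lip (x + √s * w) (y + √s * w)
        rwa [add_sub_add_right_eq_sub] at this)
    simpa using this

theorem score_bound (h : TameDensity δ L g g') (x : ℝ) : |g' x ^ 2 / g x| ≤ L ^ 2 / δ := by
  rw [abs_of_nonneg (div_nonneg (sq_nonneg _) (h.pos x).le)]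
  refine div_le_div₀ (sq_nonneg _) ?_ h.δ_pos (h.lower x)
  rw [← sq_abs]
  exact pow_le_pow_left₀ (abs_nonneg _) (h.deriv_bound x) 2

theorem score_measurable (h : TameDensity δ L g g') : Measurable fun x => g' x ^ 2 / g x :=
  (h.continuous_deriv.measurable.pow_const 2).div h.continuous.measurable

theorem score_lip (h : TameDensity δ L g g') (x y : ℝ) :
    g' x ^ 2 / g x - g' y ^ 2 / g y ≤ (2 * L ^ 2 / δ + L ^ 3 / δ ^ 2) * |x - y| := by
  have hx := h.pos x
  have hy := h.pos y
  have hδ := h.δ_pos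
  have hL := h.L_pos
  have e : g' x ^ 2 / g x - g' y ^ 2 / g y =
      (g' x - g' y) * (g' x + g' y) / g x + g' y ^ 2 * (g y - g x) / (g x * g y) := by
    field_simp; ring
  have h1 : (g' x - g' y) * (g' x + g' y) / g x ≤ 2 * L ^ 2 / δ * |x - y| := by
    calc _ ≤ |(g' x - g' y) * (g' x + g' y) / g x| := le_abs_self _
      _ = |g' x - g' y| * |g' x + g' y| / g x := by rw [abs_div, abs_mul, abs_of_pos hx]
      _ ≤ (L * |x - y|) * (L + L) / δ := by
          refine div_le_div₀ (by positivity) (mul_le_mul (h.deriv_lip x y)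
            ((abs_add_le _ _).trans (add_le_add (h.deriv_bound x) (h.deriv_bound y)))
            (abs_nonneg _) (by positivity)) hδ (h.lower x)
      _ = _ := by ring
  have h2 : g' y ^ 2 * (g y - g x) / (g x * g y) ≤ L ^ 3 / δ ^ 2 * |x - y| := by
    calc _ ≤ |g' y ^ 2 * (g y - g x) / (g x * g y)| := le_abs_self _
      _ = |g' y| ^ 2 * |g y - g x| / (g x * g y) := by
          rw [abs_div, abs_mul, abs_of_pos (mul_pos hx hy), abs_pow]
      _ ≤ L ^ 2 * (L * |x - y|) / (δ * δ) := by
          refine div_le_div₀ (by positivity) (mul_le_mul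
            (pow_le_pow_left₀ (abs_nonneg _) (h.deriv_bound y) 2)
            (by rw [abs_sub_comm x y]; exact h.lip y x) (abs_nonneg _) (by positivity))
            (by positivity) (mul_le_mul (h.lower x) (h.lower y) hδ.le hx.le)
      _ = _ := by ring
  rw [e]; linarith

/-- Jensen for the convex function `(d, m) ↦ d² / m`: integrate `(g' - (d / m) g)² / g ≥ 0`. -/
theorem smooth_score_le (h : TameDensity δ L g g') (s x : ℝ) :
    gsmooth s g' x ^ 2 / gsmooth s g x ≤ gsmooth s (fun y => g' y ^ 2 / g y) x := by
  have hm := (h.smooth s).pos x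
  set m := gsmooth s g x
  set d := gsmooth s g' x
  have i1 := bounded_integrable_gam h.continuous.measurable h.abs_le x s
  have i2 := bounded_integrable_gam h.continuous_deriv.measurable h.deriv_bound x s
  have i3 := bounded_integrable_gam h.score_measurable h.score_bound x s
  have key : 0 ≤ ∫ w, (g' (x + √s * w) ^ 2 / g (x + √s * w) -
      2 * (d / m) * g' (x + √s * w) + (d / m) ^ 2 * g (x + √s * w)) ∂gam := by
    refine integral_nonneg fun w => ?_
    have hp := h.pos (x + √s * w)
    have : g' (x + √s * w) ^ 2 / g (x + √s * w) -
      2 * (d / m) * g' (x + √s * w) + (d / m) ^ 2 * g (x + √s * w) =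
      (g' (x + √s * w) - d / m * g (x + √s * w)) ^ 2 / g (x + √s * w) := by
      field_simp; ring
    simp only [Pi.zero_apply]
    rw [this]; positivity
  have i4 : Integrable (fun w => g' (x + √s * w) ^ 2 / g (x + √s * w) -
      2 * (d / m) * g' (x + √s * w)) gam := i3.sub (i2.const_mul _)
  rw [integral_add i4 (i1.const_mul _), integral_sub i3 (i2.const_mul _),
    integral_const_mul, integral_const_mul] at key
  change 0 ≤ gsmooth s (fun y => g' y ^ 2 / g y) x - 2 * (d / m) * d + (d / m) ^ 2 * m at key
  have : 2 * (d / m) * d - (d / m) ^ 2 * m = d ^ 2 / m := by field_simp; ring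
  linarith

end TameDensity

/-! ### Short-time expansion of the entropy and its iteration. -/

/-- The difference of the two sides has derivative `r³ / (1 + r)`, so it has its minimum at `r = 0`.
-/
theorem log_one_add_le {r : ℝ} (hr : -1 < r) : Real.log (1 + r) ≤ r - r ^ 2 / 2 + r ^ 3 / 3 := by
  set φ : ℝ → ℝ := fun r => r - r ^ 2 / 2 + r ^ 3 / 3 - Real.log (1 + r) with hφ
  have hd : ∀ r, -1 < r → HasDerivAt φ (r ^ 3 / (1 + r)) r := fun r hr => by
    have h1 : (1 + r) ≠ 0 := by linarith
    have := (((hasDerivAt_id r).sub ((hasDerivAt_pow 2 r).div_const 2)).add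
      ((hasDerivAt_pow 3 r).div_const 3)).sub (((hasDerivAt_id r).const_add 1).log h1)
    refine this.congr_deriv ?_
    simp only [id]; push_cast; field_simp; ring
  have h0 : φ 0 = 0 := by simp [hφ]
  suffices 0 ≤ φ r by simp only [hφ] at this; linarith
  rw [← h0]
  rcases le_total 0 r with h | h
  · refine (monotoneOn_of_deriv_nonneg (convex_Icc 0 r) (f := φ)
      (fun x hx => (hd x (by linarith [hx.1])).continuousAt.continuousWithinAt) (fun x hx => ?_)
      (fun x hx => ?_)) (Set.left_mem_Icc.2 h) (Set.right_mem_Icc.2 h) h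
    · rw [interior_Icc] at hx
      exact (hd x (by linarith [hx.1])).differentiableAt.differentiableWithinAt
    · rw [interior_Icc] at hx
      rw [(hd x (by linarith [hx.1])).deriv]
      exact div_nonneg (pow_nonneg hx.1.le 3) (by linarith [hx.1])
  · refine (antitoneOn_of_deriv_nonpos (convex_Icc r 0) (f := φ)
      (fun x hx => (hd x (by linarith [hx.1])).continuousAt.continuousWithinAt) (fun x hx => ?_)
      (fun x hx => ?_)) (Set.left_mem_Icc.2 h) (Set.right_mem_Icc.2 h) h
    · rw [interior_Icc] at hx
      exact (hd x (by linarith [hx.1])).differentiableAt.differentiableWithinAt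
    · rw [interior_Icc] at hx
      rw [(hd x (by linarith [hx.1])).deriv]
      exact div_nonpos_of_nonpos_of_nonneg (Odd.pow_nonpos (by decide) hx.2.le) (by linarith [hx.1])

/-- Quadratic upper bound for the Bregman divergence of `x log x`. -/
theorem mul_log_le {c y : ℝ} (hc : 0 < c) (hy : 0 < y) :
    y * Real.log y ≤ y * Real.log c + (y - c) + ((y - c) ^ 2 / (2 * c) + |y - c| ^ 3 / c ^ 2 +
      (y - c) ^ 4 / c ^ 3) := by
  set r := (y - c) / c with hr
  have hyr : y = c * (1 + r) := by rw [hr]; field_simp; ring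
  have hr1 : 0 < 1 + r := by
    have : 1 + r = y / c := by rw [hr]; field_simp; ring
    rw [this]; positivity
  have hu : y - c = c * r := by rw [hr]; field_simp
  rw [hu, hyr, Real.log_mul hc.ne' hr1.ne', abs_mul, abs_of_pos hc]
  have h1 := log_one_add_le (r := r) (by linarith)
  have h2 : (1 + r) * Real.log (1 + r) ≤ (1 + r) * (r - r ^ 2 / 2 + r ^ 3 / 3) :=
    mul_le_mul_of_nonneg_left h1 hr1.le
  have h3 : (1 + r) * (r - r ^ 2 / 2 + r ^ 3 / 3) ≤ r + r ^ 2 / 2 + |r| ^ 3 + r ^ 4 := by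
    have : -r ^ 3 ≤ |r| ^ 3 := by rw [← abs_pow]; exact neg_le_abs _
    have h4 : 0 ≤ |r| ^ 3 := by positivity
    have h5 : 0 ≤ r ^ 4 := by positivity
    nlinarith
  have e : c * r + ((c * r) ^ 2 / (2 * c) + (c * |r|) ^ 3 / c ^ 2 + (c * r) ^ 4 / c ^ 3) =
      c * (r + r ^ 2 / 2 + |r| ^ 3 + r ^ 4) := by field_simp; ring
  have := mul_le_mul_of_nonneg_left (h2.trans h3) hc.le
  linarith

theorem bounded_mul_log {g : ℝ → ℝ} {L : ℝ} (h0 : ∀ x, 0 ≤ g x) (hL : ∀ x, g x ≤ L) (x : ℝ) :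
    |g x * Real.log (g x)| ≤ 1 + L ^ 2 := by
  have hx := h0 x
  have hLx := hL x
  rcases hx.eq_or_lt with h | h
  · rw [← h]; simp; positivity
  rw [abs_le]; constructor
  · have := Real.one_sub_inv_le_log_of_pos h
    have h2 := mul_le_mul_of_nonneg_left this hx
    rw [mul_sub, mul_inv_cancel₀ h.ne'] at h2
    nlinarith
  · have := Real.log_le_sub_one_of_pos h
    have h2 := mul_le_mul_of_nonneg_left this hx
    nlinarith

theorem measurable_mul_log {g : ℝ → ℝ} (hg : Measurable g) :
    Measurable fun x => g x * Real.log (g x) := hg.mul (Real.measurable_log.comp hg)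

/-- The entropy decomposes along the semigroup. -/
theorem gent_add {g : ℝ → ℝ} (hg : Measurable g) {L : ℝ} (h0 : ∀ x, 0 ≤ g x)
    (hL : ∀ x, g x ≤ L) {a b : ℝ} (ha : 0 ≤ a) (hb : 0 ≤ b) (x : ℝ) :
    gent (a + b) g x = gsmooth a (gent b g) x + gent a (gsmooth b g) x := by
  have habs : ∀ x, |g x| ≤ L := fun x => by rw [abs_of_nonneg (h0 x)]; exact hL x
  have s0 : ∀ x, 0 ≤ gsmooth b g x := fun x => integral_nonneg fun w => h0 _
  have sL : ∀ x, gsmooth b g x ≤ L := fun x => (le_abs_self _).trans (abs_gsmooth_le habs x b)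
  have e : gsmooth a (gent b g) x = gsmooth a (gsmooth b (fun y => g y * Real.log (g y))) x -
      gsmooth a (fun y => gsmooth b g y * Real.log (gsmooth b g y)) x := by
    unfold gent gsmooth
    exact integral_sub (bounded_integrable_gam (measurable_gsmooth (measurable_mul_log hg) b)
        (fun y => abs_gsmooth_le (bounded_mul_log h0 hL) y b) x a)
      (bounded_integrable_gam (measurable_mul_log (measurable_gsmooth hg b))
        (bounded_mul_log s0 sL) x a)
  rw [e]
  unfold gent
  rw [gsmooth_add (measurable_mul_log hg) (bounded_mul_log h0 hL) ha hb,
    gsmooth_add hg habs ha hb]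
  ring

theorem integrable_abs_pow_gam (n : ℕ) : Integrable (fun x : ℝ => |x| ^ n) gam := by
  have := (memLp_id_gaussianReal (μ := 0) (v := 1) n).integrable_norm_pow'
  simpa using this

/-- The constant in the short-time entropy estimate. -/
noncomputable def entConst (δ L : ℝ) : ℝ :=
  (L ^ 2 / δ + L ^ 3 / δ ^ 2 + L ^ 4 / δ ^ 3) * ∫ w : ℝ, (|w| ^ 3 + |w| ^ 4) ∂gam +
    (2 * L ^ 2 / δ + L ^ 3 / δ ^ 2) * ∫ w : ℝ, |w| ∂gam

namespace TameDensity

variable {δ L : ℝ} {g g' : ℝ → ℝ}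

/-- Second-order expansion of `y log y` around `g x`: the quadratic term produces `s / 2` times the
score, and the cubic and quartic terms are `O(s^(3/2))`. -/
theorem gent_le_center (h : TameDensity δ L g g') {s : ℝ} (hs0 : 0 ≤ s) (hs1 : s ≤ 1) (x : ℝ) :
    gent s g x ≤ s / 2 * (g' x ^ 2 / g x) + s * √s *
      ((L ^ 2 / δ + L ^ 3 / δ ^ 2 + L ^ 4 / δ ^ 3) * ∫ w : ℝ, (|w| ^ 3 + |w| ^ 4) ∂gam) := by
  have hδ := h.δ_pos
  have hL := h.L_pos
  have hc := h.pos x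
  set c := g x with hcdef
  set m := gsmooth s g x with hm
  have hmpos : 0 < m := (h.smooth s).pos x
  set K := L ^ 2 / δ + L ^ 3 / δ ^ 2 + L ^ 4 / δ ^ 3 with hK
  have i1 := bounded_integrable_gam h.continuous.measurable h.abs_le x s
  have i2 := bounded_integrable_gam (measurable_mul_log h.continuous.measurable)
    (bounded_mul_log (fun x => (h.pos x).le) h.upper) x s
  have i3 : Integrable (fun w : ℝ => |w| ^ 3 + |w| ^ 4) gam :=
    (integrable_abs_pow_gam 3).add (integrable_abs_pow_gam 4)
  have hr0 : 0 ≤ √s := Real.sqrt_nonneg s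
  have hr1 : √s ≤ 1 := Real.sqrt_le_one.2 hs1
  have hrs : √s ^ 2 = s := Real.sq_sqrt hs0
  have hpt : ∀ w, g (x + √s * w) * Real.log (g (x + √s * w)) ≤
      Real.log c * g (x + √s * w) + (g (x + √s * w) - c) +
      (s / 2 * (g' x ^ 2 / c) * w ^ 2 + s * √s * K * (|w| ^ 3 + |w| ^ 4)) := fun w => by
    have h1 := mul_log_le hc (h.pos (x + √s * w))
    set u := g (x + √s * w) - c with hu
    have hu1 : |u| ≤ L * √s * |w| := by
      have := h.lip (x + √s * w) x
      rwa [add_sub_cancel_left, abs_mul, abs_of_nonneg hr0, ← mul_assoc] at this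
    have hT := h.taylor x (√s * w)
    rw [mul_pow, hrs, ← hcdef, ← hu] at hT
    have hw0 := abs_nonneg w
    have ha0 := abs_nonneg u
    have hw2 : |w| ^ 2 = w ^ 2 := sq_abs w
    -- Compare the increment `u` with its linear part `v`: `u - v` is `O(s w²)` and `u + v` is `O(√s
    -- |w|)`.
    have hu2 : u ^ 2 ≤ s * w ^ 2 * g' x ^ 2 + 2 * L ^ 2 * (s * √s) * |w| ^ 3 := by
      set v := √s * w * g' x with hv
      have hvb : |v| ≤ L * √s * |w| := by
        rw [hv, abs_mul, abs_mul, abs_of_nonneg hr0]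
        have := mul_le_mul_of_nonneg_left (h.deriv_bound x) (mul_nonneg hr0 hw0)
        linarith
      have h3 : u ^ 2 - v ^ 2 ≤ (L * (s * w ^ 2)) * (2 * (L * √s * |w|)) := by
        calc u ^ 2 - v ^ 2 = (u - v) * (u + v) := by ring
          _ ≤ |(u - v) * (u + v)| := le_abs_self _
          _ = |u - v| * |u + v| := abs_mul _ _
          _ ≤ _ := mul_le_mul hT ((abs_add_le _ _).trans (by linarith)) (abs_nonneg _)
            (by positivity)
      have h4 : v ^ 2 = s * w ^ 2 * g' x ^ 2 := by rw [hv, mul_pow, mul_pow, hrs]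
      rw [← h4, show |w| ^ 3 = w ^ 2 * |w| by rw [← hw2]; ring]
      linarith
    have hA : u ^ 2 / (2 * c) ≤ s / 2 * (g' x ^ 2 / c) * w ^ 2 +
        s * √s * (L ^ 2 / δ) * |w| ^ 3 := by
      calc u ^ 2 / (2 * c) ≤ (s * w ^ 2 * g' x ^ 2 + 2 * L ^ 2 * (s * √s) * |w| ^ 3) / (2 * c) :=
            div_le_div_of_nonneg_right hu2 (by positivity)
        _ = s / 2 * (g' x ^ 2 / c) * w ^ 2 + L ^ 2 * (s * √s) * |w| ^ 3 / c := by
            field_simp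
        _ ≤ s / 2 * (g' x ^ 2 / c) * w ^ 2 + L ^ 2 * (s * √s) * |w| ^ 3 / δ := by
            gcongr; exact h.lower x
        _ = _ := by ring
    have hB : |u| ^ 3 / c ^ 2 ≤ s * √s * (L ^ 3 / δ ^ 2) * |w| ^ 3 := by
      calc |u| ^ 3 / c ^ 2 ≤ (L * √s * |w|) ^ 3 / δ ^ 2 := by
            gcongr; exact h.lower x
        _ = (√s ^ 2 * √s) * (L ^ 3 / δ ^ 2) * |w| ^ 3 := by ring
        _ = _ := by rw [hrs]
    have hC : u ^ 4 / c ^ 3 ≤ s * √s * (L ^ 4 / δ ^ 3) * |w| ^ 4 := by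
      have hu4 : u ^ 4 = |u| ^ 4 := by rw [← abs_pow, abs_of_nonneg (by positivity)]
      calc u ^ 4 / c ^ 3 = |u| ^ 4 / c ^ 3 := by rw [hu4]
        _ ≤ (L * √s * |w|) ^ 4 / δ ^ 3 := by gcongr; exact h.lower x
        _ = (√s ^ 2 * √s) * √s * ((L ^ 4 / δ ^ 3) * |w| ^ 4) := by ring
        _ ≤ (√s ^ 2 * √s) * 1 * ((L ^ 4 / δ ^ 3) * |w| ^ 4) := by gcongr
        _ = _ := by rw [hrs]; ring
    have hD : s * √s * (L ^ 2 / δ) * |w| ^ 3 + s * √s * (L ^ 3 / δ ^ 2) * |w| ^ 3 +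
        s * √s * (L ^ 4 / δ ^ 3) * |w| ^ 4 ≤ s * √s * K * (|w| ^ 3 + |w| ^ 4) := by
      have p1 : 0 ≤ s * √s * (L ^ 2 / δ + L ^ 3 / δ ^ 2) * |w| ^ 4 := by positivity
      have p2 : 0 ≤ s * √s * (L ^ 4 / δ ^ 3) * |w| ^ 3 := by positivity
      rw [hK]; linarith
    linarith [mul_comm (g (x + √s * w)) (Real.log c)]
  have hint := integral_mono i2 (((i1.const_mul (Real.log c)).add (i1.sub (integrable_const c))).add
    ((integrable_sq_gam.const_mul (s / 2 * (g' x ^ 2 / c))).add (i3.const_mul (s * √s * K)))) hpt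
  have e1 : ∫ w, (Real.log c * g (x + √s * w) + (g (x + √s * w) - c) +
      (s / 2 * (g' x ^ 2 / c) * w ^ 2 + s * √s * K * (|w| ^ 3 + |w| ^ 4))) ∂gam =
      Real.log c * m + (m - c) + (s / 2 * (g' x ^ 2 / c) +
        s * √s * K * ∫ w : ℝ, (|w| ^ 3 + |w| ^ 4) ∂gam) := by
    have j1 : Integrable (fun w => g (x + √s * w) - c) gam := i1.sub (integrable_const c)
    have j2 : Integrable (fun w => Real.log c * g (x + √s * w) + (g (x + √s * w) - c)) gam :=
      (i1.const_mul (Real.log c)).add j1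
    have j3 : Integrable (fun w => s / 2 * (g' x ^ 2 / c) * w ^ 2 +
        s * √s * K * (|w| ^ 3 + |w| ^ 4)) gam :=
      (integrable_sq_gam.const_mul (s / 2 * (g' x ^ 2 / c))).add (i3.const_mul (s * √s * K))
    rw [integral_add j2 j3, integral_add (i1.const_mul _) j1, integral_sub i1 (integrable_const _),
      integral_add (integrable_sq_gam.const_mul _) (i3.const_mul _), integral_const_mul,
      integral_const_mul, integral_const_mul, integral_sq_gam]
    simp [hm, gsmooth]
  have hint' : gsmooth s (fun y => g y * Real.log (g y)) x ≤ Real.log c * m + (m - c) +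
      (s / 2 * (g' x ^ 2 / c) + s * √s * K * ∫ w : ℝ, (|w| ^ 3 + |w| ^ 4) ∂gam) := by
    rw [← e1]; exact hint
  -- The expansion is centred at `c = g x` and not at the mean `m`; the discrepancy is a Bregman
  -- divergence of the favourable sign.
  have hlog : Real.log c * m + (m - c) ≤ m * Real.log m := by
    have := Real.log_le_sub_one_of_pos (div_pos hc hmpos)
    rw [Real.log_div hc.ne' hmpos.ne'] at this
    have h2 := mul_le_mul_of_nonneg_left this hmpos.le
    have h3 : m * (c / m - 1) = c - m := by field_simp
    rw [h3] at h2
    linarith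
  unfold gent
  linarith

/-- Replacing the score at the centre by its Gaussian average costs `O(√s)` by `score_lip`, hence
`O(s^(3/2))` after multiplication by `s / 2`. -/
theorem gent_le_smooth (h : TameDensity δ L g g') {s : ℝ} (hs0 : 0 ≤ s) (hs1 : s ≤ 1) (x : ℝ) :
    gent s g x ≤ s / 2 * gsmooth s (fun y => g' y ^ 2 / g y) x + s * √s * entConst δ L := by
  have hδ := h.δ_pos
  have hL := h.L_pos
  have h1 := h.gent_le_center hs0 hs1 x
  set C := 2 * L ^ 2 / δ + L ^ 3 / δ ^ 2 with hC
  have hC0 : 0 ≤ C := by positivity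
  have i3 := bounded_integrable_gam h.score_measurable h.score_bound x s
  have i0 : Integrable (fun w : ℝ => |w|) gam := integrable_id_gam.abs
  have h2 : g' x ^ 2 / g x ≤ gsmooth s (fun y => g' y ^ 2 / g y) x + C * √s * ∫ w : ℝ, |w| ∂gam := by
    have := integral_mono (μ := gam) (integrable_const (g' x ^ 2 / g x))
      (i3.add (i0.const_mul (C * √s))) fun w => by
        have := h.score_lip x (x + √s * w)
        rw [sub_add_cancel_left, abs_neg, abs_mul, abs_of_nonneg (Real.sqrt_nonneg s)] at this
        simp only [Pi.add_apply]
        linarith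
    simp only [Pi.add_apply] at this
    rw [integral_add i3 (i0.const_mul _), integral_const_mul] at this
    simpa [gsmooth] using this
  have h3 := mul_le_mul_of_nonneg_left h2 (by positivity : 0 ≤ s / 2)
  have h4 : s / 2 * (C * √s * ∫ w : ℝ, |w| ∂gam) ≤ s * √s * (C * ∫ w : ℝ, |w| ∂gam) := by
    have : 0 ≤ s * √s * (C * ∫ w : ℝ, |w| ∂gam) := by
      have : 0 ≤ ∫ w : ℝ, |w| ∂gam := integral_nonneg fun w => abs_nonneg w
      positivity
    linarith
  unfold entConst
  rw [← hC]
  linarith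

/-- Induction over `n` steps of variance `s`. The entropy is additive along the steps (`gent_add`),
smoothing does not increase the score (`smooth_score_le`), and each step adds one error term. -/
theorem gent_mul_le (n : ℕ) {s : ℝ} (hs0 : 0 ≤ s) (hs1 : s ≤ 1) :
    ∀ {g g' : ℝ → ℝ}, TameDensity δ L g g' → ∀ x, gent (n * s) g x ≤
      n * s / 2 * gsmooth (n * s) (fun y => g' y ^ 2 / g y) x + n * (s * √s * entConst δ L) := by
  induction n with
  | zero => intro g g' h x; simp [gent, gsmooth]
  | succ n ih =>
    intro g g' h x
    have hn : 0 ≤ (n : ℝ) * s := by positivity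
    have e : ((n + 1 : ℕ) : ℝ) * s = n * s + s := by push_cast; ring
    have hgm := h.continuous.measurable
    rw [e, gent_add hgm (fun x => (h.pos x).le) h.upper hn hs0]
    have hqm := h.score_measurable
    have h1 : gsmooth (n * s) (gent s g) x ≤
        s / 2 * gsmooth (n * s + s) (fun y => g' y ^ 2 / g y) x + s * √s * entConst δ L := by
      rw [gsmooth_add hqm h.score_bound hn hs0]
      have i1 := bounded_integrable_gam (measurable_gsmooth hqm s)
        (fun y => abs_gsmooth_le h.score_bound y s) x (n * s)
      have i2 : Integrable (fun w => gent s g (x + √(n * s) * w)) gam := by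
        unfold gent
        exact (bounded_integrable_gam (measurable_gsmooth (measurable_mul_log hgm) s)
          (fun y => abs_gsmooth_le (bounded_mul_log (fun x => (h.pos x).le) h.upper) y s) x _).sub
          (bounded_integrable_gam (measurable_mul_log (measurable_gsmooth hgm s))
          (bounded_mul_log (fun x => ((h.smooth s).pos x).le) (h.smooth s).upper) x _)
      have := integral_mono i2 ((i1.const_mul (s / 2)).add (integrable_const (s * √s * entConst δ L)))
        fun w => h.gent_le_smooth hs0 hs1 (x + √(n * s) * w)
      simp only [Pi.add_apply] at this
      rw [integral_add (i1.const_mul _) (integrable_const _), integral_const_mul] at this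
      simpa [gsmooth] using this
    have h2 := ih (h.smooth s) x
    have h3 : gsmooth (n * s) (fun y => gsmooth s g' y ^ 2 / gsmooth s g y) x ≤
        gsmooth (n * s + s) (fun y => g' y ^ 2 / g y) x := by
      rw [gsmooth_add hqm h.score_bound hn hs0]
      exact integral_mono (bounded_integrable_gam (h.smooth s).score_measurable
        (h.smooth s).score_bound x _) (bounded_integrable_gam (measurable_gsmooth hqm s)
        (fun y => abs_gsmooth_le h.score_bound y s) x (n * s)) fun w => h.smooth_score_le s _
    have h4 := mul_le_mul_of_nonneg_left h3 (by positivity : 0 ≤ (n : ℝ) * s / 2)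
    push_cast
    linarith

/-- The logarithmic Sobolev inequality for the Gaussian of variance `s`. -/
theorem gent_le (h : TameDensity δ L g g') {s : ℝ} (hs : 0 ≤ s) (x : ℝ) :
    gent s g x ≤ s / 2 * gsmooth s (fun y => g' y ^ 2 / g y) x := by
  -- With `n` steps of variance `s / n` the total error is `n (s / n)^(3/2)` up to a constant, which
  -- vanishes in the limit.
  have hlim : Tendsto (fun n : ℕ => s / 2 * gsmooth s (fun y => g' y ^ 2 / g y) x +
      s * √(s / n) * entConst δ L) atTop
      (𝓝 (s / 2 * gsmooth s (fun y => g' y ^ 2 / g y) x + s * √0 * entConst δ L)) := by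
    have h1 : Tendsto (fun n : ℕ => s / (n : ℝ)) atTop (𝓝 0) := tendsto_const_div_atTop_nhds_zero_nat s
    exact tendsto_const_nhds.add (((h1.sqrt).const_mul s).mul_const _)
  rw [Real.sqrt_zero, mul_zero, zero_mul, add_zero] at hlim
  refine ge_of_tendsto hlim ?_
  obtain ⟨N, hN⟩ := exists_nat_ge s
  filter_upwards [eventually_ge_atTop (max N 1)] with n hn
  have hn1 : (1 : ℝ) ≤ n := by exact_mod_cast (le_max_right N 1).trans hn
  have hnN : (N : ℝ) ≤ n := by exact_mod_cast (le_max_left N 1).trans hn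
  have e : (n : ℝ) * (s / n) = s := by field_simp
  have := gent_mul_le n (s := s / n) (by positivity)
    (by rw [div_le_one (by linarith)]; linarith) h x
  rw [e] at this
  calc _ ≤ _ := this
    _ = s / 2 * gsmooth s (fun y => g' y ^ 2 / g y) x +
      ((n : ℝ) * (s / n)) * √(s / n) * entConst δ L := by ring
    _ = _ := by rw [e]

end TameDensity

/-! ### Derivatives of Gaussian smoothings -/

/-- The derivative of the Gaussian smoothing of `q`, as an integral. -/
noncomputable def dsmooth (s : ℝ) (q : ℝ → ℝ) (x : ℝ) : ℝ :=
  (√s)⁻¹ * ∫ w, w * q (x + √s * w) ∂gam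

/-- On the unit ball around `t` the integrand's derivative is dominated through `|x| ≤ exp |x|`;
this is where `r = |t| + 2` comes from. -/
theorem hasDerivAt_integral_exp_mul {Q : ℝ → ℝ} (hQ : Measurable Q)
    (hexp : ∀ t, Integrable (fun x => Real.exp (t * x) * Q x) gam) (t : ℝ) :
    Integrable (fun x => x * (Real.exp (t * x) * Q x)) gam ∧
    HasDerivAt (fun t => ∫ x, Real.exp (t * x) * Q x ∂gam)
      (∫ x, x * (Real.exp (t * x) * Q x) ∂gam) t := by
  set r := |t| + 2 with hr
  refine hasDerivAt_integral_of_dominated_loc_of_deriv_le (μ := gam)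
    (F := fun t x => Real.exp (t * x) * Q x) (F' := fun t x => x * (Real.exp (t * x) * Q x))
    (bound := fun x => |Real.exp (r * x) * Q x| + |Real.exp (-r * x) * Q x|)
    (Metric.ball_mem_nhds t one_pos)
    (Eventually.of_forall fun s => (hexp s).aestronglyMeasurable) (hexp t)
    (Measurable.aestronglyMeasurable (by fun_prop))
    (ae_of_all _ fun x s hs => ?_) ((hexp r).abs.add (hexp (-r)).abs)
    (ae_of_all _ fun x s _ => ?_)
  · have hs' : |s| ≤ |t| + 1 := by
      rw [Metric.mem_ball, Real.dist_eq] at hs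
      linarith [abs_sub_abs_le_abs_sub s t]
    have h1 : |x| * Real.exp (s * x) ≤ Real.exp (r * |x|) := by
      have h2 : |x| ≤ Real.exp |x| := by linarith [Real.add_one_le_exp |x|]
      have h3 : s * x ≤ (|t| + 1) * |x| := by
        calc s * x ≤ |s * x| := le_abs_self _
          _ = |s| * |x| := abs_mul _ _
          _ ≤ _ := mul_le_mul_of_nonneg_right hs' (abs_nonneg _)
      calc |x| * Real.exp (s * x) ≤ Real.exp |x| * Real.exp ((|t| + 1) * |x|) :=
            mul_le_mul h2 (Real.exp_le_exp.2 h3) (Real.exp_pos _).le (Real.exp_pos _).le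
        _ = _ := by rw [← Real.exp_add, hr]; congr 1; ring
    have h2 : Real.exp (r * |x|) ≤ Real.exp (r * x) + Real.exp (-r * x) := by
      rcases abs_cases x with ⟨h, _⟩ | ⟨h, _⟩ <;> rw [h]
      · linarith [Real.exp_pos (-r * x)]
      · rw [mul_neg, neg_mul]; linarith [Real.exp_pos (r * x)]
    rw [Real.norm_eq_abs, abs_mul, abs_mul, abs_mul, abs_mul, Real.abs_exp, Real.abs_exp,
      Real.abs_exp, ← mul_assoc, ← add_mul]
    exact mul_le_mul_of_nonneg_right (h1.trans h2) (abs_nonneg _)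
  · have h1 : HasDerivAt (fun s => s * x) x s := by simpa using (hasDerivAt_id s).mul_const x
    exact (h1.exp.mul_const (Q x)).congr_deriv (by ring)

/-- `q` is only measurable, so the translation is first moved from `q` to an exponential weight by a
Gaussian change of variables, and the weight is differentiated. -/
theorem hasDerivAt_gsmooth {q : ℝ → ℝ} (hq : Measurable q) {s : ℝ} (hs : 0 < s)
    (hexp : ∀ t, Integrable (fun x => Real.exp (t * x) * q (√s * x)) gam) (p : ℝ) :
    HasDerivAt (gsmooth s q) (dsmooth s q p) p := by
  have hr : √s ≠ 0 := (Real.sqrt_pos.2 hs).ne'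
  set Q : ℝ → ℝ := fun x => q (√s * x) with hQ
  have hQm : Measurable Q := hq.comp (by fun_prop)
  have e0 : ∀ (F : ℝ → ℝ) (t : ℝ), ∫ x, F (x + t) ∂gam =
      Real.exp (-t ^ 2 / 2) * ∫ x, Real.exp (t * x) * F x ∂gam := fun F t => by
    rw [integral_gam_add, ← integral_const_mul]
    congr 1; ext x
    rw [← mul_assoc, ← Real.exp_add]; congr 2; ring
  have e1 : ∀ x w, x + √s * w = √s * (w + x / √s) := fun x w => by field_simp; ring
  have e2 : gsmooth s q = fun x => Real.exp (-(x / √s) ^ 2 / 2) *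
      ∫ w, Real.exp (x / √s * w) * Q w ∂gam := by
    ext x
    unfold gsmooth
    simp only [e1]
    exact e0 Q (x / √s)
  set t := p / √s with ht
  obtain ⟨hi, hd⟩ := hasDerivAt_integral_exp_mul hQm hexp t
  have h1 : HasDerivAt (fun x => x / √s) (√s)⁻¹ p := by
    simpa using (hasDerivAt_id p).div_const √s
  have h2 : HasDerivAt (fun t : ℝ => -t ^ 2 / 2) (-t) t :=
    ((hasDerivAt_pow 2 t).neg.div_const 2).congr_deriv (by push_cast; ring)
  have h3 := ((h2.exp.mul hd).comp p h1)
  rw [e2]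
  refine h3.congr_deriv ?_
  unfold dsmooth
  simp only [e1 p, ← ht]
  have e3 : ∫ w, w * q (√s * (w + t)) ∂gam = ∫ w, (fun y => (y - t) * Q y) (w + t) ∂gam := by
    simp [hQ]
  rw [e3, e0 (fun y => (y - t) * Q y) t]
  have e4 : ∫ x, Real.exp (t * x) * ((x - t) * Q x) ∂gam =
      ∫ x, x * (Real.exp (t * x) * Q x) ∂gam - t * ∫ x, Real.exp (t * x) * Q x ∂gam := by
    rw [← integral_const_mul, ← integral_sub hi ((hexp t).const_mul t)]
    congr 1; ext x; ring
  simp only [e4]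
  ring

theorem integrable_exp_mul_of_bounded {q : ℝ → ℝ} (hq : Measurable q) {C : ℝ}
    (hC : ∀ x, |q x| ≤ C) (s t : ℝ) :
    Integrable (fun x => Real.exp (t * x) * q (√s * x)) gam :=
  (integrable_exp_mul_gaussianReal t).mul_bdd (hq.comp (by fun_prop)).aestronglyMeasurable
    (ae_of_all _ fun _ => hC _)

theorem abs_dsmooth_le {q : ℝ → ℝ} {C : ℝ} (hC : ∀ x, |q x| ≤ C) (s x : ℝ) :
    |dsmooth s q x| ≤ (√s)⁻¹ * (C * ∫ w : ℝ, |w| ∂gam) := by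
  unfold dsmooth
  rw [abs_mul, abs_of_nonneg (inv_nonneg.2 (Real.sqrt_nonneg s))]
  refine mul_le_mul_of_nonneg_left ?_ (inv_nonneg.2 (Real.sqrt_nonneg s))
  rw [← integral_const_mul]
  refine (abs_integral_le_integral_abs).trans (integral_mono_of_nonneg
    (ae_of_all _ fun w => abs_nonneg _) (integrable_id_gam.abs.const_mul C)
    (ae_of_all _ fun w => ?_))
  simp only [abs_mul]
  rw [mul_comm]
  exact mul_le_mul_of_nonneg_right (hC _) (abs_nonneg _)

theorem measurable_dsmooth {q : ℝ → ℝ} (hq : Measurable q) (s : ℝ) : Measurable (dsmooth s q) := by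
  have h : StronglyMeasurable fun p : ℝ × ℝ => p.2 * q (p.1 + √s * p.2) :=
    (measurable_snd.mul (hq.comp (by fun_prop))).stronglyMeasurable
  exact h.integral_prod_right.measurable.const_mul _

/-- Smoothing a bounded function which is bounded away from zero gives a tame density. -/
theorem exists_tameDensity {q : ℝ → ℝ} (hq : Measurable q) {δ C : ℝ} (hδ : 0 < δ)
    (hδq : ∀ x, δ ≤ q x) (hqC : ∀ x, q x ≤ C) {a : ℝ} (ha : 0 < a) :
    ∃ L, TameDensity δ L (gsmooth a q) (dsmooth a q) := by
  have habs : ∀ x, |q x| ≤ C := fun x => by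
    rw [abs_of_pos (hδ.trans_le (hδq x))]; exact hqC x
  -- Two derivatives are needed, the second one to make the first Lipschitz. Each half of the
  -- variance pays for one of them.
  have ha2 : 0 < a / 2 := by linarith
  set g0 := gsmooth (a / 2) q
  set g1 := dsmooth (a / 2) q
  have hg1m : Measurable g1 := measurable_dsmooth hq _
  set A := ∫ w : ℝ, |w| ∂gam
  set C1 := (√(a / 2))⁻¹ * (C * A)
  have hg1 : ∀ x, |g1 x| ≤ C1 := abs_dsmooth_le habs _
  have hg0d : ∀ x, HasDerivAt g0 (g1 x) x :=
    hasDerivAt_gsmooth hq ha2 (integrable_exp_mul_of_bounded hq habs _)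
  have hg0m : Measurable g0 := measurable_gsmooth hq _
  have hg0 : ∀ x, |g0 x| ≤ C := fun x => abs_gsmooth_le habs x _
  have hg : gsmooth a q = gsmooth (a / 2) g0 := by
    ext x
    rw [← gsmooth_add hq habs ha2.le ha2.le, add_halves]
  have hd : ∀ x, HasDerivAt (gsmooth a q) (dsmooth a q x) x :=
    hasDerivAt_gsmooth hq ha (integrable_exp_mul_of_bounded hq habs _)
  have hd2 : ∀ x, HasDerivAt (gsmooth a q) (gsmooth (a / 2) g1 x) x := fun x => by
    rw [hg]
    exact (hasDerivAt_integral_of_dominated_loc_of_deriv_le (μ := gam)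
      (F := fun x w => g0 (x + √(a / 2) * w)) (F' := fun x w => g1 (x + √(a / 2) * w)) (x₀ := x)
      (bound := fun _ => C1) (Metric.ball_mem_nhds x one_pos)
      (Eventually.of_forall fun y => (bounded_integrable_gam hg0m hg0 y _).aestronglyMeasurable)
      (bounded_integrable_gam hg0m hg0 x _)
      (bounded_integrable_gam hg1m hg1 x _).aestronglyMeasurable
      (ae_of_all _ fun w y _ => hg1 _) (integrable_const _)
      (ae_of_all _ fun w y _ => HasDerivAt.comp_add_const y (√(a / 2) * w) (hg0d _))).2
  have hde : dsmooth a q = gsmooth (a / 2) g1 := funext fun x => (hd x).unique (hd2 x)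
  have hd3 : ∀ x, HasDerivAt (dsmooth a q) (dsmooth (a / 2) g1 x) x := fun x => by
    rw [hde]
    exact hasDerivAt_gsmooth hg1m ha2 (integrable_exp_mul_of_bounded hg1m hg1 _) x
  set C2 := (√(a / 2))⁻¹ * (C1 * A)
  have hC2 : ∀ x, |dsmooth (a / 2) g1 x| ≤ C2 := abs_dsmooth_le hg1 _
  refine ⟨max C (max ((√a)⁻¹ * (C * A)) C2), hδ, hd, fun x => ?_, fun x => ?_, fun x => ?_,
    fun x y => ?_⟩
  · have := integral_mono (μ := gam) (integrable_const δ) (bounded_integrable_gam hq habs x a)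
      fun w => hδq _
    simpa [gsmooth] using this
  · exact ((le_abs_self _).trans (abs_gsmooth_le habs x a)).trans (le_max_left _ _)
  · exact (abs_dsmooth_le habs a x).trans ((le_max_left _ _).trans (le_max_right _ _))
  · have := Convex.norm_image_sub_le_of_norm_hasDerivWithin_le (f := dsmooth a q)
      (f' := dsmooth (a / 2) g1) (C := C2) (s := Set.univ)
      (fun x _ => (hd3 x).hasDerivWithinAt) (fun x _ => hC2 x)
      convex_univ (Set.mem_univ y) (Set.mem_univ x)
    refine (by simpa using this : |dsmooth a q x - dsmooth a q y| ≤ C2 * |x - y|).trans ?_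
    exact mul_le_mul_of_nonneg_right ((le_max_right _ _).trans (le_max_right _ _)) (abs_nonneg _)

/-! ### Cauchy–Schwarz bounds and averaging of the smoothing derivative. -/

/-- Cauchy–Schwarz in the form `(∫ D)² / ∫ f ≤ ∫ D² / f`, with the weight `κ = D² / f`. -/
theorem sq_integral_div_le {α : Type*} [MeasurableSpace α] {μ : Measure α} {f D κ : α → ℝ}
    (hf : Integrable f μ) (hD : Integrable D μ) (hκ : Integrable κ μ)
    (h : ∀ᵐ x ∂μ, ∀ l : ℝ, 0 ≤ κ x - 2 * l * D x + l ^ 2 * f x) :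
    (∫ x, D x ∂μ) ^ 2 / ∫ x, f x ∂μ ≤ ∫ x, κ x ∂μ := by
  have key : ∀ l : ℝ, 0 ≤ ∫ x, κ x ∂μ - 2 * l * ∫ x, D x ∂μ + l ^ 2 * ∫ x, f x ∂μ := fun l => by
    have h1 : 0 ≤ ∫ x, (κ x - 2 * l * D x + l ^ 2 * f x) ∂μ :=
      integral_nonneg_of_ae (by filter_upwards [h] with x hx using hx l)
    have i4 : Integrable (fun x => κ x - 2 * l * D x) μ := hκ.sub (hD.const_mul _)
    rwa [integral_add i4 (hf.const_mul _), integral_sub hκ (hD.const_mul _), integral_const_mul,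
      integral_const_mul] at h1
  by_cases h0 : ∫ x, f x ∂μ = 0
  · have := key 0
    rw [h0, div_zero]; simpa using this
  · have := key ((∫ x, D x ∂μ) / ∫ x, f x ∂μ)
    have e : 2 * ((∫ x, D x ∂μ) / ∫ x, f x ∂μ) * ∫ x, D x ∂μ -
        ((∫ x, D x ∂μ) / ∫ x, f x ∂μ) ^ 2 * ∫ x, f x ∂μ = (∫ x, D x ∂μ) ^ 2 / ∫ x, f x ∂μ := by
      field_simp; ring
    linarith

theorem integrable_mul_of_sq {q : ℝ → ℝ} {x s : ℝ}
    (h1 : Integrable (fun w => q (x + √s * w)) gam)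
    (h2 : Integrable (fun w => w ^ 2 * q (x + √s * w)) gam) :
    Integrable (fun w => w * q (x + √s * w)) gam := by
  refine (h1.norm.add h2.norm).mono' (measurable_id.aestronglyMeasurable.mul
    h1.aestronglyMeasurable) (ae_of_all _ fun w => ?_)
  simp only [Pi.add_apply, Real.norm_eq_abs, abs_mul, abs_pow]
  have : |w| ≤ 1 + |w| ^ 2 := by nlinarith [sq_nonneg (|w| - 1)]
  nlinarith [abs_nonneg (q (x + √s * w))]

/-- Cauchy–Schwarz with weight `q`. It is the source of the bound `1 / E` for the Fisher information
and of the dominating functions below. -/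
theorem dsmooth_sq_div_le {q : ℝ → ℝ} (h0 : ∀ x, 0 ≤ q x) {x s : ℝ} (hs : 0 < s)
    (h1 : Integrable (fun w => q (x + √s * w)) gam)
    (h2 : Integrable (fun w => w ^ 2 * q (x + √s * w)) gam) :
    dsmooth s q x ^ 2 / gsmooth s q x ≤ s⁻¹ * ∫ w, w ^ 2 * q (x + √s * w) ∂gam := by
  have := sq_integral_div_le h1 (integrable_mul_of_sq h1 h2) h2 (ae_of_all _ fun w l => by
    have : w ^ 2 * q (x + √s * w) - 2 * l * (w * q (x + √s * w)) + l ^ 2 * q (x + √s * w) =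
      (w - l) ^ 2 * q (x + √s * w) := by ring
    rw [this]; exact mul_nonneg (sq_nonneg _) (h0 _))
  unfold dsmooth gsmooth
  rw [mul_pow, inv_pow, Real.sq_sqrt hs.le, mul_div_assoc]
  exact mul_le_mul_of_nonneg_left this (inv_nonneg.2 hs.le)

/-- A rotation which turns the sum of two independent Gaussians into a single one. -/
theorem exists_rotation {a e : ℝ} (ha : 0 < a) (he : 0 < e) :
    ∃ T : ℝ × ℝ → ℝ × ℝ, MeasurePreserving T (gam.prod gam) (gam.prod gam) ∧
      (∀ v p, v + √e * (T p).1 + √a * (T p).2 = v + √(e + a) * p.1) ∧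
      ∀ p, (T p).2 = √a / √(e + a) * p.1 + √e / √(e + a) * p.2 := by
  have hb0 : 0 < e + a := by linarith
  have hrb := Real.sqrt_pos.2 hb0
  have hsb := Real.sq_sqrt hb0.le
  have hsa := Real.sq_sqrt ha.le
  have hse := Real.sq_sqrt he.le
  have hcs : (√e / √(e + a)) ^ 2 + (-(√a / √(e + a))) ^ 2 = 1 := by
    rw [neg_sq, div_pow, div_pow, hsb, hsa, hse, ← add_div, div_self hb0.ne']
  refine ⟨_, measurePreserving_rotate_gam _ _ hcs, fun v p => ?_, fun p => ?_⟩
  · have h3 : √e * √e + √a * √a = √(e + a) * √(e + a) := by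
      rw [← sq, ← sq, ← sq, hse, hsa, hsb]
    simp only
    field_simp
    linear_combination p.1 * h3
  · simp only; ring

section Add

variable {q : ℝ → ℝ} {a e : ℝ}

theorem integrable_combine (hq : Measurable q) (ha : 0 < a) (he : 0 < e) (v : ℝ)
    (h1 : Integrable (fun w => q (v + √(e + a) * w)) gam) :
    Integrable (fun p : ℝ × ℝ => q (v + √e * p.1 + √a * p.2)) (gam.prod gam) := by
  obtain ⟨T, hT, hT1, -⟩ := exists_rotation ha he
  refine (hT.integrable_comp (hq.comp (by fun_prop)).aestronglyMeasurable).1 ?_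
  simp only [Function.comp_def, hT1]
  exact h1.comp_fst gam

theorem integrable_combine_sq (hq : Measurable q) (ha : 0 < a) (he : 0 < e) (v : ℝ)
    (h1 : Integrable (fun w => q (v + √(e + a) * w)) gam)
    (h2 : Integrable (fun w => w ^ 2 * q (v + √(e + a) * w)) gam) :
    Integrable (fun p : ℝ × ℝ => p.2 ^ 2 * q (v + √e * p.1 + √a * p.2)) (gam.prod gam) := by
  obtain ⟨T, hT, hT1, hT2⟩ := exists_rotation ha he
  have hm : Measurable fun p : ℝ × ℝ => p.2 ^ 2 * q (v + √e * p.1 + √a * p.2) :=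
    (measurable_snd.pow_const 2).mul (hq.comp (by fun_prop))
  refine (hT.integrable_comp hm.aestronglyMeasurable).1 ?_
  simp only [Function.comp_def, hT1]
  simp only [hT2]
  set b := e + a
  have j1 : Integrable (fun p : ℝ × ℝ => (√a / √b) ^ 2 * (p.1 ^ 2 * q (v + √b * p.1)))
      (gam.prod gam) := (h2.const_mul _).comp_fst gam
  have j2 : Integrable (fun p : ℝ × ℝ => (p.1 * q (v + √b * p.1)) *
      (2 * (√a / √b) * (√e / √b) * p.2)) (gam.prod gam) :=
    (integrable_mul_of_sq h1 h2).mul_prod (integrable_id_gam.const_mul _)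
  have j3 : Integrable (fun p : ℝ × ℝ => q (v + √b * p.1) * ((√e / √b) ^ 2 * p.2 ^ 2))
      (gam.prod gam) := h1.mul_prod (integrable_sq_gam.const_mul _)
  exact ((j1.add j2).add j3).congr (ae_of_all _ fun p => by simp only [Pi.add_apply]; ring)

/-- The smoothing derivative at variance `e + a` is the average of the one at variance `a`. -/
theorem dsmooth_add (hq : Measurable q) (ha : 0 < a) (he : 0 < e) (v : ℝ)
    (h1 : Integrable (fun w => q (v + √(e + a) * w)) gam)
    (h2 : Integrable (fun w => w ^ 2 * q (v + √(e + a) * w)) gam) :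
    Integrable (fun w => dsmooth a q (v + √e * w)) gam ∧
      dsmooth (e + a) q v = ∫ w, dsmooth a q (v + √e * w) ∂gam := by
  obtain ⟨T, hrot, hT1, hT2⟩ := exists_rotation ha he
  have hrb := Real.sqrt_pos.2 (by linarith : 0 < e + a)
  have hra := Real.sqrt_pos.2 ha
  set b := e + a
  set Φ : ℝ × ℝ → ℝ := fun p => p.2 * q (v + √e * p.1 + √a * p.2) with hΦ
  have hΦm : Measurable Φ := measurable_snd.mul (hq.comp (by fun_prop))
  have hi := integrable_mul_of_sq h1 h2
  have hΦT : ∀ p, Φ (T p) = √a / √b * (p.1 * q (v + √b * p.1)) +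
      q (v + √b * p.1) * (√e / √b * p.2) := fun p => by
    simp only [hΦ, hT1]; rw [hT2]; ring
  have j1 : Integrable (fun p : ℝ × ℝ => √a / √b * (p.1 * q (v + √b * p.1))) (gam.prod gam) :=
    (hi.const_mul _).comp_fst gam
  have j2 : Integrable (fun p : ℝ × ℝ => q (v + √b * p.1) * (√e / √b * p.2)) (gam.prod gam) :=
    h1.mul_prod (integrable_id_gam.const_mul (√e / √b))
  have hΦi : Integrable Φ (gam.prod gam) := by
    refine (hrot.integrable_comp hΦm.aestronglyMeasurable).1 ?_
    have e3 : Φ ∘ T = fun p => √a / √b * (p.1 * q (v + √b * p.1)) +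
      q (v + √b * p.1) * (√e / √b * p.2) := funext hΦT
    rw [e3]; exact j1.add j2
  refine ⟨hΦi.integral_prod_left.const_mul _, ?_⟩
  have hI : ∫ p, Φ p ∂(gam.prod gam) = √a / √b * ∫ w, w * q (v + √b * w) ∂gam := by
    rw [← integral_comp_measurePreserving hrot hΦm.aestronglyMeasurable]
    simp only [hΦT]
    -- After the rotation the second coordinate is independent of the argument of `q` and centred,
    -- so its term drops out.
    have hz : ∫ y : ℝ, y ∂gam = 0 := by simp
    rw [integral_add j1 j2, integral_prod_mul (fun x => q (v + √b * x)) (fun y => √e / √b * y),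
      integral_const_mul (√e / √b), hz, mul_zero, mul_zero, add_zero, integral_const_mul]
    congr 1
    exact (integral_fun_fst (μ := gam) (ν := gam) (fun x => x * q (v + √b * x))).trans (by simp)
  unfold dsmooth
  rw [integral_const_mul]
  have : ∫ x, ∫ w, w * q (v + √e * x + √a * w) ∂gam ∂gam = ∫ p, Φ p ∂(gam.prod gam) :=
    (integral_prod _ hΦi).symm
  rw [this, hI]
  field_simp

end Add

/-! ### The score of a smoothed density -/

/-- The Fisher information density of the smoothing of `q`. -/
noncomputable def scoreSq (s : ℝ) (q : ℝ → ℝ) (x : ℝ) : ℝ := dsmooth s q x ^ 2 / gsmooth s q x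

theorem gsmooth_nonneg {q : ℝ → ℝ} (h0 : ∀ x, 0 ≤ q x) (s x : ℝ) : 0 ≤ gsmooth s q x :=
  integral_nonneg fun _ => h0 _

theorem scoreSq_nonneg {q : ℝ → ℝ} (h0 : ∀ x, 0 ≤ q x) (s x : ℝ) : 0 ≤ scoreSq s q x :=
  div_nonneg (sq_nonneg _) (gsmooth_nonneg h0 s x)

theorem measurable_scoreSq {q : ℝ → ℝ} (hq : Measurable q) (s : ℝ) : Measurable (scoreSq s q) :=
  ((measurable_dsmooth hq s).pow_const 2).div (measurable_gsmooth hq s)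

theorem ae_eq_zero_of_gsmooth {q : ℝ → ℝ} (h0 : ∀ x, 0 ≤ q x) {s x : ℝ}
    (h1 : Integrable (fun w => q (x + √s * w)) gam) (h : gsmooth s q x = 0) :
    ∀ᵐ w ∂gam, q (x + √s * w) = 0 :=
  (integral_eq_zero_iff_of_nonneg (fun _ => h0 _) h1).1 h

theorem dsmooth_eq_zero {q : ℝ → ℝ} (h0 : ∀ x, 0 ≤ q x) {s x : ℝ}
    (h1 : Integrable (fun w => q (x + √s * w)) gam) (h : gsmooth s q x = 0) :
    dsmooth s q x = 0 := by
  unfold dsmooth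
  rw [integral_eq_zero_of_ae, mul_zero]
  filter_upwards [ae_eq_zero_of_gsmooth h0 h1 h] with w hw
  simp [hw]

theorem integrable_scoreSq {q : ℝ → ℝ} (hq : Measurable q) (h0 : ∀ x, 0 ≤ q x) {a e : ℝ}
    (ha : 0 < a) (he : 0 < e) (v : ℝ)
    (h1 : Integrable (fun w => q (v + √(e + a) * w)) gam)
    (h2 : Integrable (fun w => w ^ 2 * q (v + √(e + a) * w)) gam) :
    Integrable (fun w => scoreSq a q (v + √e * w)) gam := by
  have i1 := integrable_combine hq ha he v h1
  have i2 := integrable_combine_sq hq ha he v h1 h2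
  refine (i2.integral_prod_left.const_mul a⁻¹).mono'
    ((measurable_scoreSq hq a).comp (by fun_prop)).aestronglyMeasurable ?_
  filter_upwards [i1.prod_right_ae, i2.prod_right_ae] with w k1 k2
  rw [Real.norm_eq_abs, abs_of_nonneg (scoreSq_nonneg h0 _ _)]
  exact dsmooth_sq_div_le h0 ha k1 k2

/-- Numerator and denominator at variance `e + a` are averages of those at variance `a`, so this is
Cauchy–Schwarz. It makes the Fisher information nonincreasing in `E`. -/
theorem scoreSq_add_le {q : ℝ → ℝ} (hq : Measurable q) (h0 : ∀ x, 0 ≤ q x) {a e : ℝ}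
    (ha : 0 < a) (he : 0 < e) (v : ℝ)
    (h1 : Integrable (fun w => q (v + √(e + a) * w)) gam)
    (h2 : Integrable (fun w => w ^ 2 * q (v + √(e + a) * w)) gam) :
    scoreSq (e + a) q v ≤ ∫ w, scoreSq a q (v + √e * w) ∂gam := by
  have i1 := integrable_combine hq ha he v h1
  obtain ⟨hDi, hD⟩ := dsmooth_add hq ha he v h1 h2
  unfold scoreSq
  rw [hD, gsmooth_add_of_integrable he.le ha.le v h1]
  refine sq_integral_div_le i1.integral_prod_left hDi (integrable_scoreSq hq h0 ha he v h1 h2) ?_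
  filter_upwards [i1.prod_right_ae] with w k1 l
  have hf := gsmooth_nonneg h0 a (v + √e * w)
  -- Where the density vanishes so does its derivative, so the quadratic form stays nonnegative
  -- despite the convention `x / 0 = 0`.
  rcases hf.eq_or_lt with hz | hp
  · change 0 ≤ scoreSq a q (v + √e * w) - 2 * l * dsmooth a q (v + √e * w) +
      l ^ 2 * gsmooth a q (v + √e * w)
    rw [dsmooth_eq_zero h0 k1 hz.symm, ← hz, mul_zero, mul_zero, sub_zero, add_zero]
    exact scoreSq_nonneg h0 _ _
  · have : scoreSq a q (v + √e * w) - 2 * l * dsmooth a q (v + √e * w) +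
        l ^ 2 * gsmooth a q (v + √e * w) = (dsmooth a q (v + √e * w) -
        l * gsmooth a q (v + √e * w)) ^ 2 / gsmooth a q (v + √e * w) := by
      unfold scoreSq; field_simp; ring
    change 0 ≤ scoreSq a q (v + √e * w) - 2 * l * dsmooth a q (v + √e * w) +
      l ^ 2 * gsmooth a q (v + √e * w)
    rw [this]; positivity

/-! ### Truncation, and the logarithmic Sobolev inequality for arbitrary densities. -/

/-- The truncation of `q` from above and below. -/
noncomputable def clip (q : ℝ → ℝ) (n : ℕ) (x : ℝ) : ℝ := min (q x) n + ((n : ℝ) + 1)⁻¹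

section Clip

variable {q : ℝ → ℝ}

theorem clip_lower (h0 : ∀ x, 0 ≤ q x) (n : ℕ) (x : ℝ) : ((n : ℝ) + 1)⁻¹ ≤ clip q n x := by
  unfold clip; linarith [le_min (h0 x) (Nat.cast_nonneg (α := ℝ) n)]

theorem clip_upper (q : ℝ → ℝ) (n : ℕ) (x : ℝ) : clip q n x ≤ n + 1 := by
  unfold clip
  have : ((n : ℝ) + 1)⁻¹ ≤ 1 := inv_le_one_of_one_le₀ (by linarith [Nat.cast_nonneg (α := ℝ) n])
  linarith [min_le_right (q x) n]

theorem clip_le (q : ℝ → ℝ) (n : ℕ) (x : ℝ) : clip q n x ≤ q x + 1 := by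
  unfold clip
  have : ((n : ℝ) + 1)⁻¹ ≤ 1 := inv_le_one_of_one_le₀ (by linarith [Nat.cast_nonneg (α := ℝ) n])
  linarith [min_le_left (q x) n]

theorem clip_pos (h0 : ∀ x, 0 ≤ q x) (n : ℕ) (x : ℝ) : 0 < clip q n x :=
  lt_of_lt_of_le (by positivity) (clip_lower h0 n x)

theorem measurable_clip (hq : Measurable q) (n : ℕ) : Measurable (clip q n) :=
  (hq.min measurable_const).add_const _

theorem tendsto_clip (q : ℝ → ℝ) (x : ℝ) : Tendsto (fun n => clip q n x) atTop (𝓝 (q x)) := by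
  have h1 : Tendsto (fun n : ℕ => min (q x) (n : ℝ)) atTop (𝓝 (q x)) := by
    refine tendsto_const_nhds.congr' ?_
    obtain ⟨N, hN⟩ := exists_nat_ge (q x)
    filter_upwards [eventually_ge_atTop N] with n hn
    exact (min_eq_left (hN.trans (by exact_mod_cast hn))).symm
  have h2 : Tendsto (fun n : ℕ => ((n : ℝ) + 1)⁻¹) atTop (𝓝 0) := by
    simpa [one_div] using tendsto_one_div_add_atTop_nhds_zero_nat (𝕜 := ℝ)
  simpa [clip] using h1.add h2

theorem tendsto_gsmooth_clip (hq : Measurable q) (h0 : ∀ x, 0 ≤ q x) {s x : ℝ}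
    (h1 : Integrable (fun w => q (x + √s * w)) gam) :
    Tendsto (fun n => gsmooth s (clip q n) x) atTop (𝓝 (gsmooth s q x)) := by
  refine tendsto_integral_of_dominated_convergence (fun w => q (x + √s * w) + 1)
    (fun n => ((measurable_clip hq n).comp (by fun_prop)).aestronglyMeasurable)
    (h1.add (integrable_const 1)) (fun n => ae_of_all _ fun w => ?_)
    (ae_of_all _ fun w => tendsto_clip q _)
  rw [Real.norm_eq_abs, abs_of_pos (clip_pos h0 n _)]
  exact clip_le q n _

theorem tendsto_dsmooth_clip (hq : Measurable q) (h0 : ∀ x, 0 ≤ q x) {s x : ℝ}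
    (h1 : Integrable (fun w => w * q (x + √s * w)) gam) :
    Tendsto (fun n => dsmooth s (clip q n) x) atTop (𝓝 (dsmooth s q x)) := by
  refine Tendsto.const_mul _ (tendsto_integral_of_dominated_convergence
    (fun w => |w * q (x + √s * w)| + |w|)
    (fun n => (measurable_id.mul ((measurable_clip hq n).comp (by fun_prop))).aestronglyMeasurable)
    (h1.abs.add integrable_id_gam.abs) (fun n => ae_of_all _ fun w => ?_)
    (ae_of_all _ fun w => (tendsto_clip q _).const_mul w))
  rw [Real.norm_eq_abs, abs_mul, abs_mul, abs_of_pos (clip_pos h0 n _), abs_of_nonneg (h0 _)]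
  nlinarith [clip_le q n (x + √s * w), abs_nonneg w]

theorem tendsto_scoreSq_clip (hq : Measurable q) (h0 : ∀ x, 0 ≤ q x) {s x : ℝ}
    (h1 : Integrable (fun w => q (x + √s * w)) gam)
    (h2 : Integrable (fun w => w ^ 2 * q (x + √s * w)) gam) :
    Tendsto (fun n => scoreSq s (clip q n) x) atTop (𝓝 (scoreSq s q x)) := by
  by_cases hz : gsmooth s q x = 0
  · have h3 : ∀ n, dsmooth s (clip q n) x = 0 := fun n => by
      unfold dsmooth
      have : ∫ w, w * clip q n (x + √s * w) ∂gam = ∫ w : ℝ, w * ((n : ℝ) + 1)⁻¹ ∂gam := by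
        refine integral_congr_ae ?_
        filter_upwards [ae_eq_zero_of_gsmooth h0 h1 hz] with w hw
        simp [clip, hw]
      rw [this, integral_mul_const]
      simp
    simp [scoreSq, h3, hz]
  · exact ((tendsto_dsmooth_clip hq h0 (integrable_mul_of_sq h1 h2)).pow 2).div
      (tendsto_gsmooth_clip hq h0 h1) hz

theorem scoreSq_clip_le (hq : Measurable q) (h0 : ∀ x, 0 ≤ q x) {s x : ℝ} (hs : 0 < s)
    (h2 : Integrable (fun w => w ^ 2 * q (x + √s * w)) gam) (n : ℕ) :
    scoreSq s (clip q n) x ≤ s⁻¹ * (∫ w, w ^ 2 * q (x + √s * w) ∂gam + 1) := by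
  have hb : ∀ x, |clip q n x| ≤ n + 1 := fun x => by
    rw [abs_of_pos (clip_pos h0 n x)]; exact clip_upper q n x
  have k1 := bounded_integrable_gam (measurable_clip hq n) hb x s
  have k2 : Integrable (fun w => w ^ 2 * clip q n (x + √s * w)) gam :=
    integrable_sq_gam.mul_bdd k1.aestronglyMeasurable (ae_of_all _ fun w => hb _)
  refine (dsmooth_sq_div_le (fun x => (clip_pos h0 n x).le) hs k1 k2).trans
    (mul_le_mul_of_nonneg_left ?_ (inv_nonneg.2 hs.le))
  rw [← integral_sq_gam, ← integral_add h2 integrable_sq_gam]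
  refine integral_mono k2 (h2.add integrable_sq_gam) fun w => ?_
  simp only
  nlinarith [clip_le q n (x + √s * w), sq_nonneg w]

end Clip

/-- The logarithmic Sobolev inequality for the smoothing of an arbitrary density. -/
theorem gent_gsmooth_le {q : ℝ → ℝ} (hq : Measurable q) (h0 : ∀ x, 0 ≤ q x) {a e : ℝ}
    (ha : 0 < a) (he : 0 < e) (v : ℝ)
    (h1 : Integrable (fun w => q (v + √(e + a) * w)) gam)
    (h2 : Integrable (fun w => w ^ 2 * q (v + √(e + a) * w)) gam)
    (h3 : Integrable (fun w => gsmooth a q (v + √e * w) *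
      Real.log (gsmooth a q (v + √e * w))) gam) :
    gent e (gsmooth a q) v ≤ e / 2 * ∫ w, scoreSq a q (v + √e * w) ∂gam := by
  have i1 := integrable_combine hq ha he v h1
  have i2 := integrable_combine_sq hq ha he v h1 h2
  set F := gsmooth a q with hF
  set Fn : ℕ → ℝ → ℝ := fun n => gsmooth a (clip q n) with hFn
  have hcabs : ∀ n x, |clip q n x| ≤ n + 1 := fun n x => by
    rw [abs_of_pos (clip_pos h0 n x)]; exact clip_upper q n x
  have hFm : Measurable F := measurable_gsmooth hq a
  have hFnm : ∀ n, Measurable (Fn n) := fun n => measurable_gsmooth (measurable_clip hq n) a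
  have hFn0 : ∀ n x, 0 ≤ Fn n x := fun n => gsmooth_nonneg (fun x => (clip_pos h0 n x).le) a
  have hFnL : ∀ n x, Fn n x ≤ n + 1 := fun n x =>
    (le_abs_self _).trans (abs_gsmooth_le (hcabs n) x a)
  have hFi : Integrable (fun w => F (v + √e * w)) gam := i1.integral_prod_left
  -- the logarithmic Sobolev inequality for the truncations
  have hlsi : ∀ n, gent e (Fn n) v ≤ e / 2 * ∫ w, scoreSq a (clip q n) (v + √e * w) ∂gam := fun n => by
    obtain ⟨L, hL⟩ := exists_tameDensity (measurable_clip hq n) (δ := ((n : ℝ) + 1)⁻¹)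
      (by positivity) (clip_lower h0 n) (clip_upper q n) ha
    exact hL.gent_le he.le v
  -- convergence of the Fisher information
  have hS : Tendsto (fun n => ∫ w, scoreSq a (clip q n) (v + √e * w) ∂gam) atTop
      (𝓝 (∫ w, scoreSq a q (v + √e * w) ∂gam)) := by
    refine tendsto_integral_of_dominated_convergence
      (fun w => a⁻¹ * (∫ u, u ^ 2 * q (v + √e * w + √a * u) ∂gam + 1))
      (fun n => ((measurable_scoreSq (measurable_clip hq n) a).comp
        (by fun_prop)).aestronglyMeasurable)
      ((i2.integral_prod_left.add (integrable_const 1)).const_mul _) (fun n => ?_) ?_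
    · filter_upwards [i2.prod_right_ae] with w k2
      rw [Real.norm_eq_abs, abs_of_nonneg (scoreSq_nonneg (fun x => (clip_pos h0 n x).le) _ _)]
      exact scoreSq_clip_le hq h0 ha k2 n
    · filter_upwards [i1.prod_right_ae, i2.prod_right_ae] with w k1 k2
      exact tendsto_scoreSq_clip hq h0 k1 k2
  -- convergence of the means
  have hpt : ∀ᵐ w ∂gam, Tendsto (fun n => Fn n (v + √e * w)) atTop (𝓝 (F (v + √e * w))) := by
    filter_upwards [i1.prod_right_ae] with w k1
    exact tendsto_gsmooth_clip hq h0 k1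
  have hm : Tendsto (fun n => gsmooth e (Fn n) v) atTop (𝓝 (gsmooth e F v)) := by
    refine tendsto_integral_of_dominated_convergence (fun w => F (v + √e * w) + 1)
      (fun n => ((hFnm n).comp (by fun_prop)).aestronglyMeasurable)
      (hFi.add (integrable_const 1)) (fun n => ?_) hpt
    filter_upwards [i1.prod_right_ae] with w k1
    rw [Real.norm_eq_abs, abs_of_nonneg (hFn0 n _)]
    have := integral_mono (bounded_integrable_gam (measurable_clip hq n) (hcabs n)
      (v + √e * w) a) (k1.add (integrable_const 1)) fun u => clip_le q n _
    simp only [Pi.add_apply] at this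
    rw [integral_add k1 (integrable_const 1)] at this
    simpa [hFn, hF, gsmooth] using this
  set Bn : ℕ → ℝ := fun n => gsmooth e (Fn n) v * Real.log (gsmooth e (Fn n) v) +
    e / 2 * ∫ w, scoreSq a (clip q n) (v + √e * w) ∂gam + 1 with hBn
  set B : ℝ := gsmooth e F v * Real.log (gsmooth e F v) +
    e / 2 * ∫ w, scoreSq a q (v + √e * w) ∂gam + 1 with hBdef
  have hBt : Tendsto Bn atTop (𝓝 B) :=
    ((Real.continuous_mul_log.continuousAt.tendsto.comp hm).add (hS.const_mul _)).add_const 1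
  -- Adding 1 makes the entropy integrand nonnegative, so Fatou's lemma applies. One inequality is
  -- enough, because the means and the Fisher terms converge.
  have hlow : ∀ y : ℝ, 0 ≤ y → 0 ≤ y * Real.log y + 1 := fun y hy => by
    rcases hy.eq_or_lt with h | h
    · rw [← h]; simp
    · have := mul_le_mul_of_nonneg_left (Real.one_sub_inv_le_log_of_pos h) hy
      rw [mul_sub, mul_inv_cancel₀ h.ne'] at this
      linarith
  have hFnB : ∀ n, ∫⁻ w, ENNReal.ofReal (Fn n (v + √e * w) * Real.log (Fn n (v + √e * w)) + 1) ∂gam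
      ≤ ENNReal.ofReal (Bn n) := fun n => by
    have k := bounded_integrable_gam (measurable_mul_log (hFnm n))
      (bounded_mul_log (hFn0 n) (hFnL n)) v e
    have k' : Integrable (fun w => Fn n (v + √e * w) * Real.log (Fn n (v + √e * w)) + 1) gam :=
      k.add (integrable_const 1)
    rw [← ofReal_integral_eq_lintegral_ofReal k' (ae_of_all _ fun w => hlow _ (hFn0 n _))]
    refine ENNReal.ofReal_le_ofReal ?_
    rw [integral_add k (integrable_const 1)]
    have := hlsi n
    unfold gent at this
    simp only [integral_const, probReal_univ, one_smul, hBn]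
    unfold gsmooth at this ⊢
    linarith
  have hfatou : ∫⁻ w, ENNReal.ofReal (F (v + √e * w) * Real.log (F (v + √e * w)) + 1) ∂gam ≤
      ENNReal.ofReal B := by
    calc _ = ∫⁻ w, liminf (fun n => ENNReal.ofReal (Fn n (v + √e * w) *
          Real.log (Fn n (v + √e * w)) + 1)) atTop ∂gam := by
          refine lintegral_congr_ae ?_
          filter_upwards [hpt] with w hw
          refine (Tendsto.liminf_eq ?_).symm
          exact (ENNReal.continuous_ofReal.tendsto _).comp
            ((Real.continuous_mul_log.continuousAt.tendsto.comp hw).add_const 1)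
      _ ≤ liminf (fun n => ∫⁻ w, ENNReal.ofReal (Fn n (v + √e * w) *
          Real.log (Fn n (v + √e * w)) + 1) ∂gam) atTop := by
          refine lintegral_liminf_le fun n => ENNReal.measurable_ofReal.comp ?_
          exact ((measurable_mul_log (hFnm n)).comp (by fun_prop :
            Measurable fun w : ℝ => v + √e * w)).add_const 1
      _ ≤ liminf (fun n => ENNReal.ofReal (Bn n)) atTop := liminf_le_liminf (Eventually.of_forall hFnB)
      _ = ENNReal.ofReal B := ((ENNReal.continuous_ofReal.tendsto _).comp hBt).liminf_eq
  have hF0 : ∀ x, 0 ≤ F x := gsmooth_nonneg h0 a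
  have h3' : Integrable (fun w => F (v + √e * w) * Real.log (F (v + √e * w)) + 1) gam :=
    h3.add (integrable_const 1)
  rw [← ofReal_integral_eq_lintegral_ofReal h3' (ae_of_all _ fun w => hlow _ (hF0 _))] at hfatou
  have hBn0 : ∀ n, 0 ≤ Bn n := fun n => by
    have h4 := hlow _ (gsmooth_nonneg (hFn0 n) e v)
    have h5 : 0 ≤ ∫ w, scoreSq a (clip q n) (v + √e * w) ∂gam :=
      integral_nonneg fun w => scoreSq_nonneg (fun x => (clip_pos h0 n x).le) _ _
    simp only [hBn]
    have : 0 ≤ e / 2 * ∫ w, scoreSq a (clip q n) (v + √e * w) ∂gam := by positivity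
    linarith
  have hB0 : 0 ≤ B := ge_of_tendsto' hBt hBn0
  have hfin := (ENNReal.ofReal_le_ofReal_iff hB0).1 hfatou
  rw [integral_add h3 (integrable_const 1)] at hfin
  simp only [integral_const, probReal_univ, one_smul, hBdef] at hfin
  unfold gent
  unfold gsmooth at hfin ⊢
  linarith

section

/-! ### Fisher information of a memoryless channel -/

variable {Y : Type*} [MeasurableSpace Y] {ν : Measure Y} (P : MemorylessChannel ν)

/-- The likelihood of the input, for a given output `y`. -/
def MemorylessChannel.lik (y : Y) (u : ℝ) : ℝ := P.density u y

theorem MemorylessChannel.lik_nonneg (y : Y) (u : ℝ) : 0 ≤ P.lik y u := P.density_nonneg u y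

theorem MemorylessChannel.measurable_lik (y : Y) : Measurable (P.lik y) :=
  P.measurable_density.comp (by fun_prop : Measurable fun u : ℝ => (u, y))

theorem MemorylessChannel.measurable_lik_comp {α : Type*} [MeasurableSpace α] {u : α → ℝ}
    {y : α → Y} (hu : Measurable u) (hy : Measurable y) : Measurable fun x => P.lik (y x) (u x) :=
  P.measurable_density.comp (hu.prodMk hy)

theorem smoothed_eq_gsmooth {E : ℝ} (hE : 0 ≤ E) (p : ℝ) (y : Y) :
    smoothed P E p y = gsmooth E (P.lik y) p :=
  integral_gaussianReal_eq_gam p E hE (P.measurable_lik y)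

theorem measurable_gsmooth_lik (s : ℝ) : Measurable fun q : ℝ × Y => gsmooth s (P.lik q.2) q.1 := by
  have h : StronglyMeasurable fun x : (ℝ × Y) × ℝ => P.lik x.1.2 (x.1.1 + √s * x.2) :=
    (P.measurable_lik_comp (by fun_prop) (by fun_prop)).stronglyMeasurable
  exact h.integral_prod_right.measurable

theorem measurable_dsmooth_lik (s : ℝ) : Measurable fun q : ℝ × Y => dsmooth s (P.lik q.2) q.1 := by
  have h : StronglyMeasurable fun x : (ℝ × Y) × ℝ => x.2 * P.lik x.1.2 (x.1.1 + √s * x.2) :=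
    (measurable_snd.mul (P.measurable_lik_comp (by fun_prop) (by fun_prop))).stronglyMeasurable
  exact h.integral_prod_right.measurable.const_mul _

theorem measurable_scoreSq_lik (s : ℝ) : Measurable fun q : ℝ × Y => scoreSq s (P.lik q.2) q.1 :=
  ((measurable_dsmooth_lik P s).pow_const 2).div (measurable_gsmooth_lik P s)

theorem measurable_scoreSq_lik_comp {α : Type*} [MeasurableSpace α] (s : ℝ) {u : α → ℝ}
    {y : α → Y} (hu : Measurable u) (hy : Measurable y) :
    Measurable fun x => scoreSq s (P.lik (y x)) (u x) := by
  have h := measurable_scoreSq_lik P s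
  generalize hF : (fun q : ℝ × Y => scoreSq s (P.lik q.2) q.1) = F at h
  have e : (fun x => scoreSq s (P.lik (y x)) (u x)) = fun x => F (u x, y x) := by rw [← hF]
  rw [e]
  exact h.comp (hu.prodMk hy)

theorem integrable_of_lintegral_lt_top {ρ : ℝ → ℝ} (hρ : Measurable ρ) (hρ0 : ∀ w, 0 ≤ ρ w)
    (x s : ℝ) (y : Y) (h : ∫⁻ w, ENNReal.ofReal (ρ w * P.lik y (x + √s * w)) ∂gam < ∞) :
    Integrable (fun w => ρ w * P.lik y (x + √s * w)) gam := by
  refine ⟨(hρ.mul ((P.measurable_lik y).comp (by fun_prop))).aestronglyMeasurable, ?_⟩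
  rwa [hasFiniteIntegral_iff_ofReal (ae_of_all _ fun w =>
    mul_nonneg (hρ0 w) (P.lik_nonneg _ _))]

theorem phi_eq {E : ℝ} (hE : 0 ≤ E) (z : ℝ) (y : Y) :
    phi P E z y = gsmooth E (P.lik y) (z * √(1 - E)) := smoothed_eq_gsmooth P hE _ y

theorem integrable_phi_log (hP : FiniteEntropy P) {E : ℝ} (h0 : 0 ≤ E) (h1 : E ≤ 1) :
    Integrable (fun q : ℝ × Y => phi P E q.1 q.2 * Real.log (phi P E q.1 q.2)) (gam.prod ν) := by
  have := (hP E ⟨h0, h1⟩).mul_const (Real.log 2)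
  refine this.congr (ae_of_all _ fun q => ?_)
  have h2 : Real.log 2 ≠ 0 := (Real.log_pos (by norm_num)).ne'
  simp only [Real.logb]
  field_simp

section SFinite

variable [SFinite ν]

/-- Tonelli together with the normalization of the channel. Through it, a single Gaussian moment
gives integrability for almost every output. -/
theorem lintegral_mul_lik {ρ : ℝ → ℝ} (hρ : Measurable ρ) (hρ0 : ∀ w, 0 ≤ ρ w) (x s : ℝ) :
    ∫⁻ y, ∫⁻ w, ENNReal.ofReal (ρ w * P.lik y (x + √s * w)) ∂gam ∂ν =
      ∫⁻ w, ENNReal.ofReal (ρ w) ∂gam := by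
  have hm : Measurable fun q : Y × ℝ => ENNReal.ofReal (ρ q.2 * P.lik q.1 (x + √s * q.2)) :=
    ENNReal.measurable_ofReal.comp ((hρ.comp measurable_snd).mul
      (P.measurable_lik_comp (by fun_prop) (by fun_prop)))
  rw [lintegral_lintegral_swap hm.aemeasurable]
  refine lintegral_congr fun w => ?_
  simp only [ENNReal.ofReal_mul (hρ0 w)]
  rw [lintegral_const_mul]
  · simp only [MemorylessChannel.lik, P.lintegral_density, mul_one]
  · exact ENNReal.measurable_ofReal.comp (P.measurable_lik_comp measurable_const measurable_id)

theorem ae_integrable_mul_lik {ρ : ℝ → ℝ} (hρ : Measurable ρ) (hρ0 : ∀ w, 0 ≤ ρ w)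
    (hρi : Integrable ρ gam) (x s : ℝ) :
    ∀ᵐ y ∂ν, Integrable (fun w => ρ w * P.lik y (x + √s * w)) gam := by
  have hm : Measurable fun q : Y × ℝ => ENNReal.ofReal (ρ q.2 * P.lik q.1 (x + √s * q.2)) :=
    ENNReal.measurable_ofReal.comp ((hρ.comp measurable_snd).mul
      (P.measurable_lik_comp (by fun_prop) (by fun_prop)))
  have h1 := lintegral_mul_lik P hρ hρ0 x s
  have h2 : ∫⁻ w, ENNReal.ofReal (ρ w) ∂gam ≠ ∞ := ((hasFiniteIntegral_iff_ofReal (ae_of_all _ hρ0)).1 hρi.2).ne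
  rw [← h1] at h2
  filter_upwards [ae_lt_top hm.lintegral_prod_right' h2] with y hy
  exact integrable_of_lintegral_lt_top P hρ hρ0 x s y hy

theorem ae_prod_integrable_mul_lik {ρ : ℝ → ℝ} (hρ : Measurable ρ) (hρ0 : ∀ w, 0 ≤ ρ w)
    (hρi : Integrable ρ gam) {x : ℝ → ℝ} (hx : Measurable x) (s : ℝ) :
    ∀ᵐ q ∂(gam.prod ν), Integrable (fun w => ρ w * P.lik q.2 (x q.1 + √s * w)) gam := by
  have hm : Measurable fun r : (ℝ × Y) × ℝ =>
      ENNReal.ofReal (ρ r.2 * P.lik r.1.2 (x r.1.1 + √s * r.2)) :=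
    ENNReal.measurable_ofReal.comp ((hρ.comp measurable_snd).mul
      (P.measurable_lik_comp (by fun_prop) (by fun_prop)))
  have h1 : ∫⁻ q, ∫⁻ w, ENNReal.ofReal (ρ w * P.lik q.2 (x q.1 + √s * w)) ∂gam ∂(gam.prod ν) =
      ∫⁻ w, ENNReal.ofReal (ρ w) ∂gam := by
    rw [lintegral_prod _ hm.lintegral_prod_right'.aemeasurable]
    simp only [lintegral_mul_lik P hρ hρ0, lintegral_const, measure_univ, mul_one]
  have h2 : ∫⁻ w, ENNReal.ofReal (ρ w) ∂gam ≠ ∞ := ((hasFiniteIntegral_iff_ofReal (ae_of_all _ hρ0)).1 hρi.2).ne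
  rw [← h1] at h2
  filter_upwards [ae_lt_top hm.lintegral_prod_right' h2] with q hq
  exact integrable_of_lintegral_lt_top P hρ hρ0 (x q.1) s q.2 hq

theorem ae_integrable_lik (x s : ℝ) :
    ∀ᵐ y ∂ν, Integrable (fun w => P.lik y (x + √s * w)) gam := by
  simpa using ae_integrable_mul_lik P (ρ := fun _ => 1) measurable_const (fun _ => zero_le_one)
    (integrable_const 1) x s

theorem ae_integrable_sq_lik (x s : ℝ) :
    ∀ᵐ y ∂ν, Integrable (fun w => w ^ 2 * P.lik y (x + √s * w)) gam :=
  ae_integrable_mul_lik P (by fun_prop) (fun w => sq_nonneg w) integrable_sq_gam x s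

/-- The null set must not depend on `p`. All that is needed is finiteness of the exponential moments
about 0, and integer exponents suffice: `exp (t w)` is at most `exp (⌊t⌋ w) + exp ((⌊t⌋ + 1) w)`. -/
theorem ae_hasDerivAt_smoothed {E : ℝ} (hE : 0 < E) :
    ∀ᵐ y ∂ν, ∀ p, HasDerivAt (fun x => smoothed P E x y) (dsmooth E (P.lik y) p) p := by
  have h1 : ∀ᵐ y ∂ν, ∀ n : ℤ,
      Integrable (fun w => Real.exp (n * w) * P.lik y (0 + √E * w)) gam :=
    ae_all_iff.2 fun n => ae_integrable_mul_lik P (by fun_prop) (fun w => (Real.exp_pos _).le)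
      (integrable_exp_mul_gaussianReal (n : ℝ)) 0 E
  filter_upwards [h1] with y hy p
  have e : (fun x => smoothed P E x y) = gsmooth E (P.lik y) :=
    funext fun x => smoothed_eq_gsmooth P hE.le x y
  rw [e]
  refine hasDerivAt_gsmooth (P.measurable_lik y) hE (fun t => ?_) p
  refine ((hy ⌊t⌋).add (hy (⌊t⌋ + 1))).mono'
    ((Measurable.mul (by fun_prop) ((P.measurable_lik y).comp (by fun_prop))).aestronglyMeasurable)
    (ae_of_all _ fun w => ?_)
  have h0 := P.lik_nonneg y (√E * w)
  simp only [Pi.add_apply, zero_add, Real.norm_eq_abs, abs_mul, Real.abs_exp, abs_of_nonneg h0,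
    ← add_mul]
  refine mul_le_mul_of_nonneg_right ?_ h0
  rcases le_total 0 w with hw | hw
  · have : Real.exp (t * w) ≤ Real.exp (((⌊t⌋ + 1 : ℤ) : ℝ) * w) := by
      refine Real.exp_le_exp.2 (mul_le_mul_of_nonneg_right ?_ hw)
      push_cast; exact (Int.lt_floor_add_one t).le
    linarith [Real.exp_pos ((⌊t⌋ : ℝ) * w)]
  · have : Real.exp (t * w) ≤ Real.exp ((⌊t⌋ : ℝ) * w) :=
      Real.exp_le_exp.2 (mul_le_mul_of_nonpos_right (Int.floor_le t) hw)
    linarith [Real.exp_pos (((⌊t⌋ + 1 : ℤ) : ℝ) * w)]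

theorem fisher_eq {E : ℝ} (hE : 0 < E) (p : ℝ) :
    fisher P E p = ∫⁻ y, ENNReal.ofReal (scoreSq E (P.lik y) p) ∂ν := by
  unfold fisher
  refine lintegral_congr_ae ?_
  filter_upwards [ae_hasDerivAt_smoothed P hE] with y hy
  congr 1
  unfold scoreSq
  rw [← smoothed_eq_gsmooth P hE.le]
  -- Where the density vanishes both sides are zero: one has the density as a factor, the other
  -- divides by zero.
  by_cases h : smoothed P E p y = 0
  · simp [h]
  · rw [((hy p).log h).deriv]
    field_simp

theorem measurable_fisher {E : ℝ} (hE : 0 < E) : Measurable (fisher P E) := by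
  have : fisher P E = fun p => ∫⁻ y, ENNReal.ofReal (scoreSq E (P.lik y) p) ∂ν :=
    funext fun p => fisher_eq P hE p
  rw [this]
  exact (ENNReal.measurable_ofReal.comp (measurable_scoreSq_lik P E)).lintegral_prod_right'

/-- Cauchy–Schwarz for each output, then summation over outputs, leaves `1 / E` times the second
moment of the standard Gaussian. -/
theorem fisher_le {E : ℝ} (hE : 0 < E) (p : ℝ) : fisher P E p ≤ ENNReal.ofReal E⁻¹ := by
  rw [fisher_eq P hE]
  have hm : Measurable fun q : Y × ℝ =>
      ENNReal.ofReal (q.2 ^ 2 * P.lik q.1 (p + √E * q.2)) :=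
    ENNReal.measurable_ofReal.comp ((measurable_snd.pow_const 2).mul
      (P.measurable_lik_comp (by fun_prop) (by fun_prop)))
  calc _ ≤ ∫⁻ y, ENNReal.ofReal E⁻¹ *
        ∫⁻ w, ENNReal.ofReal (w ^ 2 * P.lik y (p + √E * w)) ∂gam ∂ν := by
        refine lintegral_mono_ae ?_
        filter_upwards [ae_integrable_lik P p E, ae_integrable_sq_lik P p E] with y h1 h2
        rw [← ofReal_integral_eq_lintegral_ofReal h2
          (ae_of_all _ fun w => mul_nonneg (sq_nonneg w) (P.lik_nonneg _ _)),
          ← ENNReal.ofReal_mul (inv_nonneg.2 hE.le)]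
        exact ENNReal.ofReal_le_ofReal (dsmooth_sq_div_le (P.lik_nonneg y) hE h1 h2)
    _ = ENNReal.ofReal E⁻¹ := by
        rw [lintegral_const_mul _ hm.lintegral_prod_right',
          lintegral_mul_lik P (by fun_prop) (fun w => sq_nonneg w),
          ← ofReal_integral_eq_lintegral_ofReal integrable_sq_gam
            (ae_of_all _ fun w => sq_nonneg w), integral_sq_gam]
        simp

theorem meanFisher_le {E : ℝ} (hE : 0 < E) : meanFisher P E ≤ ENNReal.ofReal E⁻¹ := by
  rw [meanFisher, if_pos hE]
  calc _ ≤ ∫⁻ _p, ENNReal.ofReal E⁻¹ ∂(gaussianReal 0 (1 - E).toNNReal) :=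
        lintegral_mono fun p => fisher_le P hE p
    _ = _ := by simp

/-- The mean Fisher information, averaged over a decomposition of the input Gaussian. -/
theorem lintegral_scoreSq_eq_meanFisher {a b : ℝ} (ha : 0 < a) (hab : a ≤ b) (hb : b ≤ 1) :
    ∫⁻ q, ∫⁻ w, ENNReal.ofReal (scoreSq a (P.lik q.2) (q.1 * √(1 - b) + √(b - a) * w)) ∂gam
      ∂(gam.prod ν) = meanFisher P a := by
  have hm : Measurable fun r : (ℝ × Y) × ℝ =>
      ENNReal.ofReal (scoreSq a (P.lik r.1.2) (r.1.1 * √(1 - b) + √(b - a) * r.2)) :=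
    (measurable_scoreSq_lik_comp P a (by fun_prop) (by fun_prop)).ennreal_ofReal
  rw [lintegral_prod _ hm.lintegral_prod_right'.aemeasurable, meanFisher, if_pos ha]
  obtain ⟨f, hf, hfs⟩ := measurePreserving_combine_var (1 - b) (b - a) (by linarith)
    (by linarith) 0 (fun w => rfl)
  rw [show 1 - b + (b - a) = 1 - a by ring] at hfs
  have key : ∀ F : ℝ → ℝ≥0∞, Measurable F → ∫⁻ p, F p ∂gaussianReal 0 (1 - a).toNNReal =
      ∫⁻ z, ∫⁻ w, F (0 + √(1 - a) * f (z, w)) ∂gam ∂gam := fun F hF => by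
    have hF' : Measurable fun w : ℝ => F (0 + √(1 - a) * w) := hF.comp (by fun_prop)
    rw [← (measurePreserving_gam 0 (1 - a) (by linarith)).lintegral_comp hF,
      ← hf.lintegral_comp hF']
    exact lintegral_prod _ (hF'.comp hf.measurable).aemeasurable
  rw [key _ (measurable_fisher P ha)]
  refine lintegral_congr fun z => ?_
  have hm' : Measurable fun r : Y × ℝ =>
      ENNReal.ofReal (scoreSq a (P.lik r.1) (z * √(1 - b) + √(b - a) * r.2)) :=
    (measurable_scoreSq_lik_comp P a (by fun_prop) (by fun_prop)).ennreal_ofReal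
  rw [lintegral_lintegral_swap hm'.aemeasurable]
  refine lintegral_congr fun w => ?_
  simp only [hfs, fisher_eq P ha, zero_add]
  simp only [mul_comm z]

theorem ae_prod_integrable_lik (b s : ℝ) :
    ∀ᵐ q ∂(gam.prod ν), Integrable (fun w => P.lik q.2 (q.1 * √b + √s * w)) gam := by
  simpa using ae_prod_integrable_mul_lik P (ρ := fun _ => 1) measurable_const
    (fun _ => zero_le_one) (integrable_const 1) (x := fun z => z * √b) (by fun_prop) s

theorem ae_prod_integrable_sq_lik (b s : ℝ) :
    ∀ᵐ q ∂(gam.prod ν), Integrable (fun w => w ^ 2 * P.lik q.2 (q.1 * √b + √s * w)) gam :=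
  ae_prod_integrable_mul_lik P (by fun_prop) (fun w => sq_nonneg w) integrable_sq_gam
    (x := fun z => z * √b) (by fun_prop) s

theorem meanFisher_eq_prod {b : ℝ} (hb0 : 0 < b) (hb : b ≤ 1) : meanFisher P b =
    ∫⁻ q, ENNReal.ofReal (scoreSq b (P.lik q.2) (q.1 * √(1 - b))) ∂(gam.prod ν) := by
  rw [← lintegral_scoreSq_eq_meanFisher P hb0 le_rfl hb]
  simp

/-- Split `𝒩(0, 1 - a)` into variances `1 - b` and `b - a`. Averaging the density over the second
part raises the smoothing from `a` to `b`, and by convexity lowers the score. -/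
theorem meanFisher_anti {a b : ℝ} (ha : 0 < a) (hab : a ≤ b) (hb : b ≤ 1) :
    meanFisher P b ≤ meanFisher P a := by
  rcases hab.eq_or_lt with rfl | hlt
  · exact le_rfl
  rw [meanFisher_eq_prod P (ha.trans hlt) hb, ← lintegral_scoreSq_eq_meanFisher P ha hab hb]
  refine lintegral_mono_ae ?_
  have e : b - a + a = b := by ring
  filter_upwards [ae_prod_integrable_lik P (1 - b) (b - a + a),
    ae_prod_integrable_sq_lik P (1 - b) (b - a + a)] with q h1 h2
  have he : 0 < b - a := by linarith
  rw [← ofReal_integral_eq_lintegral_ofReal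
    (integrable_scoreSq (P.measurable_lik _) (P.lik_nonneg _) ha he _ h1 h2)
    (ae_of_all _ fun w => scoreSq_nonneg (P.lik_nonneg _) _ _)]
  have := scoreSq_add_le (P.measurable_lik q.2) (P.lik_nonneg _) ha he _ h1 h2
  rw [e] at this
  exact ENNReal.ofReal_le_ofReal this

/-! ### Conditional entropy -/

/-- The conditional entropy of the output, in nats. -/
noncomputable def condEnt (E : ℝ) : ℝ :=
  -∫ q, phi P E q.1 q.2 * Real.log (phi P E q.1 q.2) ∂(gam.prod ν)

theorem measurePreserving_shuffle {f : ℝ × ℝ → ℝ} (hf : MeasurePreserving f (gam.prod gam) gam) :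
    MeasurePreserving (fun r : (ℝ × Y) × ℝ => (f (r.1.1, r.2), r.1.2)) ((gam.prod ν).prod gam)
      (gam.prod ν) := by
  have h1 := measurePreserving_prodAssoc gam ν gam
  have h2 := (MeasurePreserving.id gam).prod (Measure.measurePreserving_swap (μ := ν) (ν := gam))
  have h3 := (measurePreserving_prodAssoc gam gam ν).symm
  have h4 := hf.prod (MeasurePreserving.id ν)
  exact h4.comp (h3.comp (h2.comp h1))

/-- The entropy grows at most at the rate given by half the Fisher information. -/
theorem condEnt_sub_le (hP : FiniteEntropy P) {a b : ℝ} (ha : 0 < a) (hab : a ≤ b) (hb : b ≤ 1) :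
    condEnt P b - condEnt P a ≤ (b - a) / 2 * (meanFisher P a).toReal := by
  rcases hab.eq_or_lt with rfl | hlt
  · simp
  have he : 0 < b - a := by linarith
  have e : b - a + a = b := by ring
  have hb0 : 0 < b := ha.trans hlt
  obtain ⟨f, hf, hfs⟩ := measurePreserving_combine_var (1 - b) (b - a) (by linarith)
    (by linarith) 0 (fun w => rfl)
  rw [show 1 - b + (b - a) = 1 - a by ring] at hfs
  have hS := measurePreserving_shuffle (ν := ν) hf
  have hia := integrable_phi_log P hP ha.le (hab.trans hb)
  have hib := integrable_phi_log P hP hb0.le hb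
  set Xa : ℝ × Y → ℝ := fun q => phi P a q.1 q.2 * Real.log (phi P a q.1 q.2) with hXa
  have hSi : Integrable (fun r : (ℝ × Y) × ℝ => Xa (f (r.1.1, r.2), r.1.2))
    ((gam.prod ν).prod gam) := hS.integrable_comp_of_integrable hia
  -- The input at parameter `a` is written as the input at parameter `b` plus independent noise of
  -- variance `b - a`. For fixed `(z, y)` the entropy difference is then `gent (b - a)` of the
  -- likelihood smoothed at `a`.
  have hXf : ∀ z y w, Xa (f (z, w), y) = gsmooth a (P.lik y) (z * √(1 - b) + √(b - a) * w) *
      Real.log (gsmooth a (P.lik y) (z * √(1 - b) + √(b - a) * w)) := fun z y w => by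
    have : f (z, w) * √(1 - a) = z * √(1 - b) + √(b - a) * w := by
      have := hfs (z, w)
      simp only [zero_add] at this
      rw [mul_comm, this, mul_comm z]
    simp only [hXa, phi_eq P ha.le, this]
  have hA : condEnt P a = -∫ q, ∫ w, Xa (f (q.1, w), q.2) ∂gam ∂(gam.prod ν) := by
    rw [condEnt, ← integral_comp_measurePreserving hS hia.aestronglyMeasurable,
      integral_prod _ hSi]
  set RHS : ℝ × Y → ℝ := fun q => (b - a) / 2 *
    ∫ w, scoreSq a (P.lik q.2) (q.1 * √(1 - b) + √(b - a) * w) ∂gam with hRHS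
  have hR0 : ∀ q, 0 ≤ RHS q := fun q => mul_nonneg (by linarith)
    (integral_nonneg fun w => scoreSq_nonneg (P.lik_nonneg _) _ _)
  have hRm : Measurable RHS := by
    have h : StronglyMeasurable fun r : (ℝ × Y) × ℝ =>
        scoreSq a (P.lik r.1.2) (r.1.1 * √(1 - b) + √(b - a) * r.2) :=
      (measurable_scoreSq_lik_comp P a (by fun_prop) (by fun_prop)).stronglyMeasurable
    exact h.integral_prod_right.measurable.const_mul _
  have hgood := (ae_prod_integrable_lik P (1 - b) (b - a + a)).and
    (ae_prod_integrable_sq_lik P (1 - b) (b - a + a))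
  have hRl : ∫⁻ q, ENNReal.ofReal (RHS q) ∂(gam.prod ν) =
      ENNReal.ofReal ((b - a) / 2) * meanFisher P a := by
    rw [← lintegral_scoreSq_eq_meanFisher P ha hab hb, ← lintegral_const_mul' _ _
      ENNReal.ofReal_ne_top]
    refine lintegral_congr_ae ?_
    filter_upwards [hgood] with q hq
    rw [← ofReal_integral_eq_lintegral_ofReal
      (integrable_scoreSq (P.measurable_lik _) (P.lik_nonneg _) ha he _ hq.1 hq.2)
      (ae_of_all _ fun w => scoreSq_nonneg (P.lik_nonneg _) _ _),
      ← ENNReal.ofReal_mul (by linarith)]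
  have hMF : meanFisher P a ≠ ∞ := ne_top_of_le_ne_top ENNReal.ofReal_ne_top (meanFisher_le P ha)
  have hRi : Integrable RHS (gam.prod ν) := by
    refine ⟨hRm.aestronglyMeasurable, ?_⟩
    rw [hasFiniteIntegral_iff_ofReal (ae_of_all _ hR0), hRl]
    exact ENNReal.mul_lt_top ENNReal.ofReal_lt_top hMF.lt_top
  have hRint : ∫ q, RHS q ∂(gam.prod ν) = (b - a) / 2 * (meanFisher P a).toReal := by
    rw [integral_eq_lintegral_of_nonneg_ae (ae_of_all _ hR0) hRm.aestronglyMeasurable, hRl,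
      ENNReal.toReal_mul, ENNReal.toReal_ofReal (by linarith)]
  rw [hA, condEnt, ← hRint, neg_sub_neg, ← integral_sub hSi.integral_prod_left hib]
  refine integral_mono_ae (hSi.integral_prod_left.sub hib) hRi ?_
  filter_upwards [hgood, hSi.prod_right_ae] with q hq hi
  simp only [hXf] at hi ⊢
  have := gent_gsmooth_le (P.measurable_lik q.2) (P.lik_nonneg _) ha he _ hq.1 hq.2 hi
  unfold gent at this
  rw [← gsmooth_add_of_integrable he.le ha.le _ hq.1, e] at this
  rw [phi_eq P hb0.le]
  exact this

end SFinite

end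

section

/-! ### Lower semicontinuity of the conditional entropy -/

/-- Continuity at `0` of the Ornstein-Uhlenbeck flow in `L¹`. -/
theorem tendsto_lintegral_rotate_sub {q : ℝ → ℝ} (hm : Measurable q) (hq : Integrable q gam)
    {e : ℕ → ℝ} (he0 : ∀ n, 0 ≤ e n) (he1 : ∀ n, e n ≤ 1) (he : Tendsto e atTop (𝓝 0)) :
    Tendsto (fun n => ∫⁻ r, ‖q (√(1 - e n) * r.1 + √(e n) * r.2) - q r.1‖ₑ ∂(gam.prod gam))
      atTop (𝓝 0) := by
  have hmp : ∀ n, MeasurePreserving (fun r : ℝ × ℝ => √(1 - e n) * r.1 + √(e n) * r.2)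
      (gam.prod gam) gam := fun n => measurePreserving_combine_gam _ _ (by
    rw [Real.sq_sqrt (by linarith [he1 n]), Real.sq_sqrt (he0 n)]; ring)
  refine ENNReal.tendsto_nhds_zero.2 fun η hη => ?_
  have h4 : η / 4 ≠ 0 := (ENNReal.div_pos hη.ne' (by norm_num)).ne'
  -- The rotated argument has the same law as `r.1`, so both approximation errors equal `∫ ‖q - g‖`,
  -- at most `η / 4` each; the remaining `η / 2` goes to the continuous `g`.
  obtain ⟨g, hgc, hg, hgcont, hgi⟩ := hq.exists_hasCompactSupport_lintegral_sub_le h4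
  obtain ⟨C, hC⟩ := hgcont.bounded_above_of_compact_support hgc
  have hlim : Tendsto (fun n => ∫⁻ r : ℝ × ℝ,
      ‖g (√(1 - e n) * r.1 + √(e n) * r.2) - g r.1‖ₑ ∂(gam.prod gam)) atTop (𝓝 0) := by
    have h0 : (0 : ℝ≥0∞) = ∫⁻ _r : ℝ × ℝ, 0 ∂(gam.prod gam) := by simp
    rw [h0]
    refine tendsto_lintegral_of_dominated_convergence (fun _ => ENNReal.ofReal (C + C))
      (fun n => ?_) (fun n => ae_of_all _ fun r => ?_) (by simp) (ae_of_all _ fun r => ?_)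
    · have : Continuous fun r : ℝ × ℝ => g (√(1 - e n) * r.1 + √(e n) * r.2) - g r.1 := by
        fun_prop
      exact this.measurable.enorm
    · change ‖g (√(1 - e n) * r.1 + √(e n) * r.2) - g r.1‖ₑ ≤ ENNReal.ofReal (C + C)
      rw [← ofReal_norm]
      exact ENNReal.ofReal_le_ofReal ((norm_sub_le _ _).trans (add_le_add (hC _) (hC _)))
    · have h1 : Tendsto (fun n => √(1 - e n) * r.1 + √(e n) * r.2) atTop (𝓝 r.1) := by
        have h := ((tendsto_const_nhds.sub he).sqrt.mul_const r.1).add (he.sqrt.mul_const r.2)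
          (f := fun n => √((1 : ℝ) - e n) * r.1)
        simpa using h
      have h2 := ((hgcont.tendsto _).comp h1).sub_const (g r.1)
      rw [sub_self] at h2
      simpa using h2.enorm
  filter_upwards [ENNReal.tendsto_nhds_zero.1 hlim (η / 2) (ENNReal.half_pos hη.ne')] with n hn
  have hmd : Measurable fun x => ‖q x - g x‖ₑ := (hm.sub hgcont.measurable).enorm
  have hmg : Measurable fun r : ℝ × ℝ => ‖g (√(1 - e n) * r.1 + √(e n) * r.2) - g r.1‖ₑ := by
    have : Continuous fun r : ℝ × ℝ => g (√(1 - e n) * r.1 + √(e n) * r.2) - g r.1 := by fun_prop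
    exact this.measurable.enorm
  calc _ ≤ ∫⁻ r : ℝ × ℝ, (‖q (√(1 - e n) * r.1 + √(e n) * r.2) -
          g (√(1 - e n) * r.1 + √(e n) * r.2)‖ₑ +
        ‖g (√(1 - e n) * r.1 + √(e n) * r.2) - g r.1‖ₑ) + ‖q r.1 - g r.1‖ₑ ∂(gam.prod gam) := by
        refine lintegral_mono fun r => ?_
        have : q (√(1 - e n) * r.1 + √(e n) * r.2) - q r.1 =
          (q (√(1 - e n) * r.1 + √(e n) * r.2) - g (√(1 - e n) * r.1 + √(e n) * r.2)) +
          (g (√(1 - e n) * r.1 + √(e n) * r.2) - g r.1) + (g r.1 - q r.1) := by ring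
        rw [this, ← enorm_neg (q r.1 - g r.1), neg_sub]
        exact (enorm_add_le _ _).trans (by gcongr; exact enorm_add_le _ _)
    _ = (∫⁻ x, ‖q x - g x‖ₑ ∂gam + ∫⁻ r : ℝ × ℝ,
          ‖g (√(1 - e n) * r.1 + √(e n) * r.2) - g r.1‖ₑ ∂(gam.prod gam)) +
        ∫⁻ x, ‖q x - g x‖ₑ ∂gam := by
        have h1 : Measurable fun r : ℝ × ℝ => ‖q r.1 - g r.1‖ₑ := hmd.comp measurable_fst
        rw [lintegral_add_right _ h1, lintegral_add_right _ hmg,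
          (hmp n).lintegral_comp hmd, measurePreserving_fst.lintegral_comp hmd]
    _ ≤ (η / 4 + η / 2) + η / 4 := by gcongr
    _ = η := by
        rw [add_right_comm, show η / 4 + η / 4 = η / 2 by
          rw [← two_mul, show (4 : ℝ≥0∞) = 2 * 2 by norm_num, ← mul_div_assoc,
            ENNReal.mul_div_mul_left _ _ (by norm_num) (by norm_num)]]
        exact ENNReal.add_halves η

variable {Y : Type*} [MeasurableSpace Y] {ν : Measure Y} (P : MemorylessChannel ν)

theorem phi_eq_integral {E : ℝ} (h0 : 0 ≤ E) (z : ℝ) (y : Y) :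
    phi P E z y = ∫ w, P.lik y (√(1 - E) * z + √E * w) ∂gam := by
  rw [phi_eq P h0, gsmooth, mul_comm]

theorem phi_zero (z : ℝ) (y : Y) : phi P 0 z y = P.lik y z := by
  rw [phi_eq_integral P le_rfl]; simp

theorem phi_one (z : ℝ) (y : Y) : phi P 1 z y = ∫ w, P.lik y w ∂gam := by
  rw [phi_eq_integral P zero_le_one]; simp

theorem phi_nonneg {E : ℝ} (h0 : 0 ≤ E) (z : ℝ) (y : Y) : 0 ≤ phi P E z y := by
  rw [phi_eq_integral P h0]; exact integral_nonneg fun w => P.lik_nonneg _ _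

theorem measurable_phi {E : ℝ} (h0 : 0 ≤ E) : Measurable fun q : ℝ × Y => phi P E q.1 q.2 := by
  have h : StronglyMeasurable fun x : (ℝ × Y) × ℝ =>
      P.lik x.1.2 (√(1 - E) * x.1.1 + √E * x.2) :=
    (P.measurable_lik_comp (by fun_prop) (by fun_prop)).stronglyMeasurable
  have := h.integral_prod_right' (ν := gam)
  simp only [phi_eq_integral P h0]
  exact this.measurable

/-- `√(1 - E) z + √E w` is standard Gaussian for every `E`, so averaging over `z` always gives the
output law `phi P 1`, which does not depend on `z`. -/
theorem integrable_phi_section {E : ℝ} (h0 : 0 ≤ E) (h1 : E ≤ 1) {y : Y}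
    (hy : Integrable (P.lik y) gam) :
    Integrable (fun z => phi P E z y) gam ∧
      ∫ z, phi P E z y ∂gam = ∫ w, P.lik y w ∂gam := by
  have hmp := measurePreserving_combine_gam (√(1 - E)) (√E) (by
    rw [Real.sq_sqrt (by linarith), Real.sq_sqrt h0]; ring)
  have hi := hmp.integrable_comp_of_integrable hy
  simp only [phi_eq_integral P h0]
  refine ⟨hi.integral_prod_left, ?_⟩
  rw [← integral_comp_measurePreserving hmp hy.aestronglyMeasurable]
  exact (integral_prod _ hi).symm

section SFinite

variable [SFinite ν]

theorem ae_integrable_lik_gam : ∀ᵐ y ∂ν, Integrable (P.lik y) gam := by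
  simpa using ae_integrable_lik P 0 1

theorem lintegral_lik_gam : ∫⁻ y, ∫⁻ w, ENNReal.ofReal (P.lik y w) ∂gam ∂ν = 1 := by
  simpa using lintegral_mul_lik P (ρ := fun _ => 1) measurable_const (fun _ => zero_le_one) 0 1

/-- For almost every output the likelihood is continuous in `L¹` along the Ornstein–Uhlenbeck flow.
Twice its Gaussian mean dominates, and taking the integral over the noise inside the norm only
decreases the distance. -/
theorem tendsto_phi_zero {e : ℕ → ℝ} (he0 : ∀ n, 0 ≤ e n) (he1 : ∀ n, e n ≤ 1)
    (he : Tendsto e atTop (𝓝 0)) :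
    Tendsto (fun n => ∫⁻ q, ‖phi P (e n) q.1 q.2 - phi P 0 q.1 q.2‖ₑ ∂(gam.prod ν))
      atTop (𝓝 0) := by
  have hmq : ∀ n, Measurable fun x : Y × (ℝ × ℝ) =>
      ‖P.lik x.1 (√(1 - e n) * x.2.1 + √(e n) * x.2.2) - P.lik x.1 x.2.1‖ₑ := fun n =>
    ((P.measurable_lik_comp (by fun_prop) (by fun_prop)).sub
      (P.measurable_lik_comp (by fun_prop) (by fun_prop))).enorm
  have hlim : Tendsto (fun n => ∫⁻ y, ∫⁻ r : ℝ × ℝ,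
      ‖P.lik y (√(1 - e n) * r.1 + √(e n) * r.2) - P.lik y r.1‖ₑ ∂(gam.prod gam) ∂ν)
      atTop (𝓝 0) := by
    have h0 : (0 : ℝ≥0∞) = ∫⁻ _y : Y, 0 ∂ν := by simp
    rw [h0]
    refine tendsto_lintegral_of_dominated_convergence
      (fun y => ∫⁻ w, ENNReal.ofReal (P.lik y w) ∂gam + ∫⁻ w, ENNReal.ofReal (P.lik y w) ∂gam)
      (fun n => (hmq n).lintegral_prod_right') (fun n => ae_of_all _ fun y => ?_) ?_ ?_
    · have hmp := measurePreserving_combine_gam (√(1 - e n)) (√(e n)) (by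
        rw [Real.sq_sqrt (by linarith [he1 n]), Real.sq_sqrt (he0 n)]; ring)
      have hmo : Measurable fun w => ENNReal.ofReal (P.lik y w) := (P.measurable_lik y).ennreal_ofReal
      calc _ ≤ ∫⁻ r : ℝ × ℝ, ENNReal.ofReal (P.lik y (√(1 - e n) * r.1 + √(e n) * r.2)) +
            ENNReal.ofReal (P.lik y r.1) ∂(gam.prod gam) := by
            refine lintegral_mono fun r => ?_
            have h := enorm_sub_le (a := P.lik y (√(1 - e n) * r.1 + √(e n) * r.2))
              (b := P.lik y r.1)
            rwa [Real.enorm_of_nonneg (P.lik_nonneg _ _),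
              Real.enorm_of_nonneg (P.lik_nonneg _ _)] at h
        _ = _ := by
            have h1 : Measurable fun r : ℝ × ℝ => ENNReal.ofReal (P.lik y r.1) :=
              hmo.comp measurable_fst
            rw [lintegral_add_right _ h1, hmp.lintegral_comp hmo,
              measurePreserving_fst.lintegral_comp hmo]
    · have hmo : Measurable fun y => ∫⁻ w, ENNReal.ofReal (P.lik y w) ∂gam :=
        Measurable.lintegral_prod_right' (f := fun x : Y × ℝ => ENNReal.ofReal (P.lik x.1 x.2))
          (P.measurable_lik_comp measurable_snd measurable_fst).ennreal_ofReal
      rw [lintegral_add_right _ hmo, lintegral_lik_gam P]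
      simp
    · filter_upwards [ae_integrable_lik_gam P] with y hy
      exact tendsto_lintegral_rotate_sub (P.measurable_lik y) hy he0 he1 he
  refine tendsto_of_tendsto_of_tendsto_of_le_of_le tendsto_const_nhds hlim
    (fun n => zero_le) (fun n => ?_)
  have hmn : Measurable fun q : ℝ × Y => ‖phi P (e n) q.1 q.2 - phi P 0 q.1 q.2‖ₑ :=
    ((measurable_phi P (he0 n)).sub (measurable_phi P le_rfl)).enorm
  simp only
  rw [lintegral_prod_symm' _ hmn]
  refine lintegral_mono_ae ?_
  filter_upwards [ae_integrable_lik_gam P] with y hy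
  have hmp := measurePreserving_combine_gam (√(1 - e n)) (√(e n)) (by
    rw [Real.sq_sqrt (by linarith [he1 n]), Real.sq_sqrt (he0 n)]; ring)
  have hi := hmp.integrable_comp_of_integrable hy
  rw [lintegral_prod (μ := gam) (ν := gam) (fun r : ℝ × ℝ =>
    ‖P.lik y (√(1 - e n) * r.1 + √(e n) * r.2) - P.lik y r.1‖ₑ)
    ((hmq n).comp measurable_prodMk_left).aemeasurable]
  refine lintegral_mono_ae ?_
  filter_upwards [hi.prod_right_ae] with z hz
  rw [phi_zero, phi_eq_integral P (he0 n)]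
  have e1 : ∫ w, P.lik y (√(1 - e n) * z + √(e n) * w) ∂gam - P.lik y z =
      ∫ w, (P.lik y (√(1 - e n) * z + √(e n) * w) - P.lik y z) ∂gam := by
    have hz' : Integrable (fun w => P.lik y (√(1 - e n) * z + √(e n) * w)) gam := hz
    rw [integral_sub hz' (integrable_const _)]
    simp
  rw [e1]
  exact enorm_integral_le_lintegral_enorm _

/-! ### The entropy defect as an integral of a nonnegative relative entropy. -/

/-- The pointwise relative entropy of `phi` with respect to its mean over `z`. -/
noncomputable def relEnt (E : ℝ) (q : ℝ × Y) : ℝ :=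
  phi P E q.1 q.2 * Real.log (phi P E q.1 q.2) - phi P E q.1 q.2 * Real.log (phi P 1 q.1 q.2) -
    phi P E q.1 q.2 + phi P 1 q.1 q.2

theorem ae_swap_prod {p : ℝ × Y → Prop} (hp : MeasurableSet {q | p q})
    (h : ∀ᵐ y ∂ν, ∀ᵐ z ∂gam, p (z, y)) : ∀ᵐ q ∂(gam.prod ν), p q := by
  have h1 : ∀ᵐ r ∂(ν.prod gam), p r.swap :=
    (Measure.ae_prod_iff_ae_ae (measurable_swap hp)).2 h
  have := Measure.measurePreserving_swap (μ := gam) (ν := ν)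
  exact this.quasiMeasurePreserving.ae h1

theorem relEnt_nonneg {E : ℝ} (h0 : 0 ≤ E) (h1 : E ≤ 1) :
    ∀ᵐ q ∂(gam.prod ν), 0 ≤ relEnt P E q := by
  have hmE := measurable_phi P h0
  have hm1 := measurable_phi P zero_le_one
  refine ae_swap_prod (measurableSet_le measurable_const ?_) ?_
  · exact ((hmE.mul hmE.log).sub (hmE.mul hm1.log)).sub hmE |>.add hm1
  filter_upwards [ae_integrable_lik_gam P] with y hy
  obtain ⟨hi, he⟩ := integrable_phi_section P h0 h1 hy
  -- If the mean over `z` vanishes, then `phi` vanishes for almost every `z`; otherwise the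
  -- convention `log 0 = 0` could break the sign. If the mean is positive, this is `log x ≤ x - 1`.
  rcases (integral_nonneg fun w => P.lik_nonneg y w : 0 ≤ ∫ w, P.lik y w ∂gam).eq_or_lt with h | h
  · rw [← h, integral_eq_zero_iff_of_nonneg (fun z => phi_nonneg P h0 z y) hi] at he
    filter_upwards [he] with z hz
    have hz' : phi P E z y = 0 := hz
    simp [relEnt, hz', phi_one, ← h]
  · refine ae_of_all _ fun z => ?_
    simp only [relEnt, phi_one]
    set b := ∫ w, P.lik y w ∂gam
    rcases (phi_nonneg P h0 z y).eq_or_lt with ha | ha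
    · simp [← ha, h.le]
    · set a := phi P E z y
      have hl := Real.log_le_sub_one_of_pos (div_pos h ha)
      rw [Real.log_div h.ne' ha.ne'] at hl
      have := mul_le_mul_of_nonneg_left hl ha.le
      have e1 : a * (b / a - 1) = b - a := by field_simp
      nlinarith

theorem integrable_phi {E : ℝ} (h0 : 0 ≤ E) (h1 : E ≤ 1) :
    Integrable (fun q : ℝ × Y => phi P E q.1 q.2) (gam.prod ν) ∧
      ∫ q, phi P E q.1 q.2 ∂(gam.prod ν) = 1 := by
  have hmE := measurable_phi P h0
  have hq : ∫⁻ q, ENNReal.ofReal (phi P E q.1 q.2) ∂(gam.prod ν) = 1 := by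
    rw [lintegral_prod_symm' _ hmE.ennreal_ofReal, ← lintegral_lik_gam P]
    refine lintegral_congr_ae ?_
    filter_upwards [ae_integrable_lik_gam P] with y hy
    obtain ⟨hi, he⟩ := integrable_phi_section P h0 h1 hy
    rw [← ofReal_integral_eq_lintegral_ofReal hi (ae_of_all _ fun z => phi_nonneg P h0 z y), he,
      ofReal_integral_eq_lintegral_ofReal hy (ae_of_all _ fun z => P.lik_nonneg y z)]
  have hn : 0 ≤ᵐ[gam.prod ν] fun q : ℝ × Y => phi P E q.1 q.2 :=
    ae_of_all _ fun q => phi_nonneg P h0 _ _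
  refine ⟨⟨hmE.aestronglyMeasurable, ?_⟩, ?_⟩
  · rw [hasFiniteIntegral_iff_ofReal hn, hq]; exact ENNReal.one_lt_top
  · rw [integral_eq_lintegral_of_nonneg_ae hn hmE.aestronglyMeasurable, hq]; rfl

theorem integrable_phi_mul_log_phi_one (hP : FiniteEntropy P) {E : ℝ} (h0 : 0 ≤ E) (h1 : E ≤ 1) :
    Integrable (fun q : ℝ × Y => phi P E q.1 q.2 * Real.log (phi P 1 q.1 q.2)) (gam.prod ν) ∧
      ∫ q, phi P E q.1 q.2 * Real.log (phi P 1 q.1 q.2) ∂(gam.prod ν) = -condEnt P 1 := by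
  have hmE := measurable_phi P h0
  have hm1 := measurable_phi P zero_le_one
  have hi1 := integrable_phi_log P hP zero_le_one le_rfl
  simp only [condEnt, phi_one, neg_neg] at hi1 hm1 ⊢
  set b : Y → ℝ := fun y => ∫ w, P.lik y w ∂gam with hb
  change Integrable (fun q : ℝ × Y => b q.2 * Real.log (b q.2)) (gam.prod ν) at hi1
  have hm1' : Measurable b := hm1.comp (measurable_prodMk_left (x := (0 : ℝ)))
  have hbi : Integrable (fun y => b y * Real.log (b y)) ν := by
    have := hi1.integral_prod_right
    simpa using this
  have hb0 : ∀ y, 0 ≤ b y := fun y => integral_nonneg fun w => P.lik_nonneg _ _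
  have hI : Integrable (fun q : ℝ × Y => phi P E q.1 q.2 * Real.log (b q.2)) (gam.prod ν) := by
    have hmm : Measurable fun q : ℝ × Y => phi P E q.1 q.2 * Real.log (b q.2) := hmE.mul hm1.log
    refine (integrable_prod_iff' hmm.aestronglyMeasurable).2 ⟨?_, ?_⟩
    · filter_upwards [ae_integrable_lik_gam P] with y hy
      exact (integrable_phi_section P h0 h1 hy).1.mul_const _
    · refine hbi.norm.congr ?_
      filter_upwards [ae_integrable_lik_gam P] with y hy
      simp only [norm_mul, Real.norm_of_nonneg (phi_nonneg P h0 _ y), Real.norm_of_nonneg (hb0 y)]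
      rw [integral_mul_const, (integrable_phi_section P h0 h1 hy).2]
  refine ⟨hI, ?_⟩
  rw [integral_prod_symm _ hI, integral_prod_symm _ hi1]
  refine integral_congr_ae ?_
  filter_upwards [ae_integrable_lik_gam P] with y hy
  rw [integral_mul_const, (integrable_phi_section P h0 h1 hy).2]
  simp [hb]

/-- `condEnt P 1 - condEnt P E` is a mutual information. As the integral of a nonnegative function
it is accessible to Fatou's lemma, unlike the entropy itself. -/
theorem lintegral_relEnt (hP : FiniteEntropy P) {E : ℝ} (h0 : 0 ≤ E) (h1 : E ≤ 1) :
    condEnt P E ≤ condEnt P 1 ∧ ∫⁻ q, ENNReal.ofReal (relEnt P E q) ∂(gam.prod ν) =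
      ENNReal.ofReal (condEnt P 1 - condEnt P E) := by
  obtain ⟨ha, ha'⟩ := integrable_phi_mul_log_phi_one P hP h0 h1
  obtain ⟨hb, hb'⟩ := integrable_phi P h0 h1
  obtain ⟨hc, hc'⟩ := integrable_phi P zero_le_one le_rfl
  have hd := integrable_phi_log P hP h0 h1
  have hd' : ∫ q, phi P E q.1 q.2 * Real.log (phi P E q.1 q.2) ∂(gam.prod ν) = -condEnt P E := by
    rw [condEnt, neg_neg]
  have h2 : Integrable (fun q : ℝ × Y => phi P E q.1 q.2 * Real.log (phi P E q.1 q.2) -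
    phi P E q.1 q.2 * Real.log (phi P 1 q.1 q.2)) (gam.prod ν) := hd.sub ha
  have h3 : Integrable (fun q : ℝ × Y => phi P E q.1 q.2 * Real.log (phi P E q.1 q.2) -
    phi P E q.1 q.2 * Real.log (phi P 1 q.1 q.2) - phi P E q.1 q.2) (gam.prod ν) := h2.sub hb
  have hi : Integrable (relEnt P E) (gam.prod ν) := h3.add hc
  have e : ∫ q, relEnt P E q ∂(gam.prod ν) = condEnt P 1 - condEnt P E := by
    simp only [relEnt]
    rw [integral_add h3 hc, integral_sub h2 hb, integral_sub hd ha,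
      ha', hb', hc', hd']
    ring
  have hn := relEnt_nonneg P h0 h1
  constructor
  · have := integral_nonneg_of_ae hn
    linarith
  · rw [← e, ofReal_integral_eq_lintegral_ofReal hi hn]

/-- The conditional entropy is lower semicontinuous at `0` along some sequence. -/
theorem exists_condEnt_le (hP : FiniteEntropy P) {δ ρ : ℝ} (hδ : 0 < δ) (hρ : 0 < ρ) :
    ∃ E, 0 < E ∧ E < ρ ∧ E ≤ 1 ∧ condEnt P E ≤ condEnt P 0 + δ := by
  by_contra! hcon
  set e : ℕ → ℝ := fun n => min (ρ / 2) (1 / ((n : ℝ) + 1)) with he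
  have hpos : ∀ n, 0 < e n := fun n => lt_min (by linarith) (by positivity)
  have h1 : ∀ n, e n ≤ 1 := fun n => (min_le_right _ _).trans (by
    rw [div_le_one (by positivity)]; linarith [n.cast_nonneg (α := ℝ)])
  have hlt : ∀ n, condEnt P 0 + δ < condEnt P (e n) := fun n =>
    hcon _ (hpos n) ((min_le_left _ _).trans_lt (by linarith)) (h1 n)
  have hlim : Tendsto e atTop (𝓝 0) := by
    have := (tendsto_const_nhds (x := ρ / 2)).min tendsto_one_div_add_atTop_nhds_zero_nat
    rwa [min_eq_right (by linarith : (0 : ℝ) ≤ ρ / 2)] at this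
  have hT := tendsto_phi_zero P (fun n => (hpos n).le) h1 hlim
  have hTM : TendstoInMeasure (gam.prod ν) (fun n (q : ℝ × Y) => phi P (e n) q.1 q.2) atTop
      (fun q => phi P 0 q.1 q.2) := by
    refine tendstoInMeasure_of_tendsto_eLpNorm (p := 1) one_ne_zero
      (fun n => (measurable_phi P (hpos n).le).aestronglyMeasurable)
      (measurable_phi P le_rfl).aestronglyMeasurable ?_
    simpa only [eLpNorm_one_eq_lintegral_enorm, Pi.sub_apply] using hT
  obtain ⟨ns, -, hns⟩ := hTM.exists_seq_tendsto_ae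
  have hm : ∀ E, 0 ≤ E → Measurable (relEnt P E) := fun E hE => by
    have hmE := measurable_phi P hE
    have hm1 := measurable_phi P zero_le_one
    exact ((hmE.mul hmE.log).sub (hmE.mul hm1.log)).sub hmE |>.add hm1
  -- Convergence in `L¹` gives almost sure convergence along a subsequence, and Fatou bounds the
  -- defect at 0 by the liminf of the defects. The assumed excess `δ` contradicts this.
  have hF : ∫⁻ q, ENNReal.ofReal (relEnt P 0 q) ∂(gam.prod ν) ≤
      liminf (fun k => ∫⁻ q, ENNReal.ofReal (relEnt P (e (ns k)) q) ∂(gam.prod ν)) atTop := by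
    refine le_trans (lintegral_mono_ae ?_)
      (lintegral_liminf_le fun k => (hm _ (hpos (ns k)).le).ennreal_ofReal)
    filter_upwards [hns] with q hq
    have hc : Continuous fun x : ℝ => ENNReal.ofReal
        (x * Real.log x - x * Real.log (phi P 1 q.1 q.2) - x + phi P 1 q.1 q.2) :=
      ENNReal.continuous_ofReal.comp
        (((Real.continuous_mul_log.sub (by fun_prop)).sub continuous_id).add continuous_const)
    exact ((hc.tendsto _).comp hq).liminf_eq.ge
  have hle : liminf (fun k => ∫⁻ q, ENNReal.ofReal (relEnt P (e (ns k)) q) ∂(gam.prod ν)) atTop ≤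
      ENNReal.ofReal (condEnt P 1 - (condEnt P 0 + δ)) := by
    refine liminf_le_of_le (by isBoundedDefault) fun b hb => ?_
    obtain ⟨k, hk⟩ := hb.exists
    refine hk.trans ?_
    rw [(lintegral_relEnt P hP (hpos _).le (h1 _)).2]
    exact ENNReal.ofReal_le_ofReal (by linarith [hlt (ns k)])
  rw [(lintegral_relEnt P hP le_rfl zero_le_one).2] at hF
  have h3 := (lintegral_relEnt P hP (hpos 0).le (h1 0)).1
  have h4 := hlt 0
  have := (ENNReal.ofReal_le_ofReal_iff (by linarith)).1 (hF.trans hle)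
  linarith

end SFinite

end

section

variable {Y : Type*} [MeasurableSpace Y] {ν : Measure Y} (P : MemorylessChannel ν)

theorem Tu_nonneg (B : ℕ) (R E : ℝ) : 0 ≤ Tu P B R E := mse_nonneg B _

theorem Tu_le_one {B : ℕ} (hB : 2 ≤ B) (R E : ℝ) : Tu P B R E ≤ 1 := mse_le_one B (by omega) _

/-! ### The seeded recursion on the integers: definitions and elementary properties. -/

/-- The coupled recursion for the translation invariant kernel `a` on the integers. -/
noncomputable def lineOp (B : ℕ) (R : ℝ) (w : ℕ) (a : ℤ → ℝ) (X : ℤ → ℝ) (r : ℤ) : ℝ :=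
  smoothR w a (fun c => mse B (∑ l ∈ Finset.Icc (-(w : ℤ)) w,
    ENNReal.ofReal (a l) * invNoise P R (X (c + l)))) r

/-- A probability vector on `{-w,…,w}`. -/
structure IsKernel (w : ℕ) (a : ℤ → ℝ) : Prop where
  nonneg : ∀ k, 0 ≤ a k
  supp : ∀ k, k ∉ Finset.Icc (-(w : ℤ)) w → a k = 0
  sum : ∑ k ∈ Finset.Icc (-(w : ℤ)) w, a k = 1

variable {w : ℕ} {a : ℤ → ℝ}

theorem lineOp_const (B : ℕ) (R : ℝ) (ha : IsKernel w a) (x : ℝ) (r : ℤ) :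
    lineOp P B R w a (fun _ => x) r = Tu P B R x := by
  simp only [lineOp, smoothR, Tu]
  rw [← Finset.sum_mul, ← Finset.sum_mul, ha.sum, one_mul,
    ← ENNReal.ofReal_sum_of_nonneg fun k _ => ha.nonneg k, ha.sum, ENNReal.ofReal_one, one_mul]

theorem lineOp_le_one {B : ℕ} (hB : 2 ≤ B) (R : ℝ) (ha : IsKernel w a) (X : ℤ → ℝ) (r : ℤ) :
    lineOp P B R w a X r ≤ 1 := by
  rw [← ha.sum]
  unfold lineOp smoothR
  exact Finset.sum_le_sum fun k _ =>
    mul_le_of_le_one_right (ha.nonneg k) (mse_le_one B (by omega) _)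

theorem lineOp_add (B : ℕ) (R : ℝ) (X : ℤ → ℝ) (r s : ℤ) :
    lineOp P B R w a X (r + s) = lineOp P B R w a (fun q => X (q + s)) r := by
  unfold lineOp smoothR
  refine Finset.sum_congr rfl fun k _ => ?_
  simp only
  congr 2
  refine Finset.sum_congr rfl fun l _ => ?_
  rw [show r + s - k + l = r - k + l + s by ring]

/-- The recursion on the line with seed value `ε` on the left, started from `1`. -/
noncomputable def seeded (B : ℕ) (R : ℝ) (w : ℕ) (a : ℤ → ℝ) (ε : ℝ) (N : ℤ) : ℕ → ℤ → ℝ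
  | 0, r => if r < 0 then ε else 1
  -- The maximum keeps the profile above the seed, hence nondecreasing in `r`; `min r N` continues
  -- it as a constant to the right of `N`.
  | t + 1, r => if r < 0 then ε else
      max ε (lineOp P B R w a (seeded B R w a ε N t) (min r N))

theorem seeded_const (B : ℕ) (R : ℝ) (ε : ℝ) {N : ℤ} (hN : 0 ≤ N) (t : ℕ) {r : ℤ} (hr : N ≤ r) :
    seeded P B R w a ε N t r = seeded P B R w a ε N t N := by
  cases t <;> simp [seeded, hr, not_lt.2 hN, not_lt.2 (hN.trans hr)]

theorem iterate_Tu_mem {B : ℕ} (hB : 2 ≤ B) (R : ℝ) {E : ℝ} (hE : E ∈ Set.Icc (0 : ℝ) 1) (n : ℕ) :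
    (Tu P B R)^[n] E ∈ Set.Icc (0 : ℝ) 1 := by
  cases n with
  | zero => exact hE
  | succ n => rw [Function.iterate_succ_apply']; exact ⟨Tu_nonneg P B R _, Tu_le_one P hB R _⟩

section SFinite

variable [SFinite ν]

/-! ### The effective noise and the scalar recursion -/

theorem meanFisher_antitoneOn {a b : ℝ} (ha : 0 ≤ a) (hab : a ≤ b) (hb : b ≤ 1) :
    meanFisher P b ≤ meanFisher P a := by
  rcases ha.eq_or_lt with rfl | ha
  · rcases hab.eq_or_lt with rfl | h0
    · exact le_rfl
    rw [meanFisher.eq_1 P 0, if_neg (lt_irrefl _)]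
    refine le_limsup_of_frequently_le (Eventually.frequently ?_) (by isBoundedDefault)
    filter_upwards [Ioo_mem_nhdsGT h0] with e he
    have := meanFisher_anti P he.1 he.2.le hb
    rwa [meanFisher.eq_1 P e, if_pos he.1] at this
  · exact meanFisher_anti P ha hab hb

theorem invNoise_antitoneOn (R : ℝ) {a b : ℝ} (ha : 0 ≤ a) (hab : a ≤ b) (hb : b ≤ 1) :
    invNoise P R b ≤ invNoise P R a :=
  ENNReal.div_le_div_right (meanFisher_antitoneOn P ha hab hb) _

theorem invNoise_ne_top {R E : ℝ} (hR : 0 < R) (hE : 0 < E) : invNoise P R E ≠ ∞ :=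
  ENNReal.div_ne_top (ne_top_of_le_ne_top ENNReal.ofReal_ne_top (meanFisher_le P hE))
    (ENNReal.ofReal_pos.2 hR).ne'

theorem toReal_invNoise_anti {R : ℝ} (hR : 0 < R) {a b : ℝ} (ha : 0 < a) (hab : a ≤ b)
    (hb : b ≤ 1) : (invNoise P R b).toReal ≤ (invNoise P R a).toReal :=
  ENNReal.toReal_mono (invNoise_ne_top P hR ha) (invNoise_antitoneOn P R ha.le hab hb)

theorem condEnt_sub_le_invNoise (hP : FiniteEntropy P) {R : ℝ} (hR : 0 < R) {a b : ℝ} (ha : 0 < a)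
    (hab : a ≤ b) (hb : b ≤ 1) :
    2 / R * condEnt P b - 2 / R * condEnt P a ≤ (invNoise P R a).toReal * (b - a) := by
  have h := condEnt_sub_le P hP ha hab hb
  rw [invNoise, ENNReal.toReal_div, ENNReal.toReal_ofReal hR.le, ← mul_sub]
  calc _ ≤ 2 / R * ((b - a) / 2 * (meanFisher P a).toReal) := by gcongr
    _ = _ := by field_simp

theorem sectPot_mono (B : ℕ) (hB : 2 ≤ B) : Monotone (sectPot B) := fun s t h => by
  by_cases ht : t = ∞
  · rw [ht]; exact sectPot_mono_top B hB s
  have hs := ne_top_of_le_ne_top ht h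
  have h' := ENNReal.toReal_mono ht h
  have := mse_mul_le_sectPot_sub B hB ENNReal.toReal_nonneg h'
  rw [ENNReal.ofReal_toReal hs, ENNReal.ofReal_toReal ht] at this
  have h2 : 0 ≤ mse B t * (t.toReal - s.toReal) := mul_nonneg (mse_nonneg B t) (by linarith)
  linarith

/-- The potential of the underlying ensemble in terms of entropy and section potential. -/
theorem Fu_eq (hP : FiniteEntropy P) (B : ℕ) {R E : ℝ} (h0 : 0 ≤ E) (h1 : E ≤ 1) :
    2 * Real.log 2 * Fu P B R E = 2 / R * condEnt P E -
      (ENNReal.ofReal E * invNoise P R E).toReal + sectPot B (invNoise P R E) := by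
  have hl : Real.log 2 ≠ 0 := (Real.log_pos (by norm_num)).ne'
  have h : ∫ z, (∫ y, phi P E z y * Real.logb 2 (phi P E z y) ∂ν) ∂(gaussianReal 0 1) =
      -condEnt P E / Real.log 2 := by
    rw [← integral_prod _ (hP E ⟨h0, h1⟩), condEnt, neg_neg, ← integral_div]
    refine integral_congr_ae (ae_of_all _ fun q => ?_)
    simp only [Real.logb]
    ring
  rw [Fu, Uu, h, sectPot]
  field_simp
  ring

theorem Tu_mono (B : ℕ) (R : ℝ) {a b : ℝ} (ha : 0 ≤ a) (hab : a ≤ b) (hb : b ≤ 1) :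
    Tu P B R a ≤ Tu P B R b := mse_antitone B (invNoise_antitoneOn P R ha hab hb)

theorem iterate_Tu_monotone {B : ℕ} (hB : 2 ≤ B) (R : ℝ) {E : ℝ} (hE : E ∈ Set.Icc (0 : ℝ) 1)
    (h : E ≤ Tu P B R E) : Monotone fun n => (Tu P B R)^[n] E := by
  refine monotone_nat_of_le_succ fun n => ?_
  induction n with
  | zero => exact h
  | succ n ih =>
    rw [Function.iterate_succ_apply', Function.iterate_succ_apply' _ (n + 1)]
    exact Tu_mono P B R (iterate_Tu_mem P hB R hE n).1 ih (iterate_Tu_mem P hB R hE _).2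

theorem iterate_Tu_antitone {B : ℕ} (hB : 2 ≤ B) (R : ℝ) {E : ℝ} (hE : E ∈ Set.Icc (0 : ℝ) 1)
    (h : Tu P B R E ≤ E) : Antitone fun n => (Tu P B R)^[n] E := by
  refine antitone_nat_of_succ_le fun n => ?_
  induction n with
  | zero => exact h
  | succ n ih =>
    rw [Function.iterate_succ_apply' _ (n + 1)]
    exact (Tu_mono P B R (iterate_Tu_mem P hB R hE (n + 1)).1 ih
      (iterate_Tu_mem P hB R hE n).2).trans (Function.iterate_succ_apply' _ n E).ge

theorem tendsto_TuLim {B : ℕ} (hB : 2 ≤ B) (R : ℝ) {E : ℝ} (hE : E ∈ Set.Icc (0 : ℝ) 1) :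
    Tendsto (fun n => (Tu P B R)^[n] E) atTop (𝓝 (TuLim P B R E)) := by
  refine tendsto_nhds_limUnder ?_
  rcases le_total E (Tu P B R E) with h | h
  · exact ⟨_, tendsto_atTop_ciSup (iterate_Tu_monotone P hB R hE h)
      ⟨1, by rintro _ ⟨n, rfl⟩; exact (iterate_Tu_mem P hB R hE n).2⟩⟩
  · exact ⟨_, tendsto_atTop_ciInf (iterate_Tu_antitone P hB R hE h)
      ⟨0, by rintro _ ⟨n, rfl⟩; exact (iterate_Tu_mem P hB R hE n).1⟩⟩

theorem floorMSE_mem {B : ℕ} (hB : 2 ≤ B) (R : ℝ) : floorMSE P B R ∈ Set.Icc (0 : ℝ) 1 :=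
  isClosed_Icc.mem_of_tendsto (tendsto_TuLim P hB R (by simp))
    (Eventually.of_forall (iterate_Tu_mem P hB R (by simp)))

/-- The iterates of 0 increase to the floor, so each of them is below the image of the floor.
Equality would need a continuity that monotonicity does not supply; the inequality is enough for a
subsolution. -/
theorem floorMSE_le_Tu {B : ℕ} (hB : 2 ≤ B) (R : ℝ) :
    floorMSE P B R ≤ Tu P B R (floorMSE P B R) := by
  have h0 : (0 : ℝ) ∈ Set.Icc (0 : ℝ) 1 := by simp
  have hm := iterate_Tu_monotone P hB R h0 (Tu_nonneg P B R 0)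
  have ht := tendsto_TuLim P hB R h0
  refine le_of_tendsto' ((tendsto_add_atTop_iff_nat 1).2 ht) fun n => ?_
  rw [Function.iterate_succ_apply']
  exact Tu_mono P B R (iterate_Tu_mem P hB R h0 n).1 (hm.ge_of_tendsto ht n)
    (floorMSE_mem P hB R).2

/-! ### The coupled recursion on the integer line -/

theorem lineOp_mono (B : ℕ) (R : ℝ) (ha : IsKernel w a) {X X' : ℤ → ℝ} (h0 : ∀ r, 0 ≤ X r)
    (h : ∀ r, X r ≤ X' r) (h1 : ∀ r, X' r ≤ 1) (r : ℤ) :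
    lineOp P B R w a X r ≤ lineOp P B R w a X' r := by
  unfold lineOp smoothR
  refine Finset.sum_le_sum fun k _ => mul_le_mul_of_nonneg_left (mse_antitone B ?_) (ha.nonneg k)
  exact Finset.sum_le_sum fun l _ => by
    gcongr
    exact invNoise_antitoneOn P R (h0 _) (h _) (h1 _)

theorem lineOp_monotone (B : ℕ) (R : ℝ) (ha : IsKernel w a) {X : ℤ → ℝ} (hX : Monotone X)
    (h0 : ∀ r, 0 ≤ X r) (h1 : ∀ r, X r ≤ 1) : Monotone (lineOp P B R w a X) := fun r s h => by
  rw [show s = r + (s - r) by ring, lineOp_add]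
  exact lineOp_mono P B R ha h0 (fun q => hX (by omega)) (fun q => h1 _) r

/-- At positive values the inverse noise is finite, so the recursion takes the real-valued form
required by `potential_le_of_subsolution`. This is why the seed is positive. -/
theorem lineOp_eq (B : ℕ) {R : ℝ} (hR : 0 < R) (ha : IsKernel w a) {X : ℤ → ℝ}
    (h0 : ∀ r, 0 < X r) (r : ℤ) : lineOp P B R w a X r = smoothR w a (fun c =>
      mse B (ENNReal.ofReal (smoothL w a (fun r => (invNoise P R (X r)).toReal) c))) r := by
  unfold lineOp smoothR
  refine Finset.sum_congr rfl fun k _ => ?_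
  simp only [smoothL]
  rw [ENNReal.ofReal_sum_of_nonneg fun l _ => mul_nonneg (ha.nonneg l) ENNReal.toReal_nonneg]
  congr 2
  refine Finset.sum_congr rfl fun l _ => ?_
  rw [ENNReal.ofReal_mul (ha.nonneg l), ENNReal.ofReal_toReal (invNoise_ne_top P hR (h0 _))]

theorem seeded_props {B : ℕ} (hB : 2 ≤ B) (R : ℝ) (ha : IsKernel w a) {ε : ℝ} (h0 : 0 ≤ ε)
    (h1 : ε ≤ 1) {N : ℤ} (t : ℕ) :
    Monotone (seeded P B R w a ε N t) ∧ (∀ r, ε ≤ seeded P B R w a ε N t r) ∧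
      ∀ r, seeded P B R w a ε N t r ≤ 1 := by
  induction t with
  | zero =>
    refine ⟨fun r s h => ?_, fun r => ?_, fun r => ?_⟩ <;> simp only [seeded]
    · split_ifs <;> first | exact le_rfl | exact h1 | omega
    · split_ifs <;> first | exact le_rfl | exact h1
    · split_ifs <;> first | exact le_rfl | exact h1
  | succ t ih =>
    refine ⟨fun r s h => ?_, fun r => ?_, fun r => ?_⟩ <;> simp only [seeded]
    · split_ifs
      · exact le_rfl
      · exact le_max_left _ _
      · omega
      · exact max_le_max le_rfl (lineOp_monotone P B R ha ih.1 (fun r => h0.trans (ih.2.1 r)) ih.2.2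
          (min_le_min_right _ h))
    · split_ifs
      · exact le_rfl
      · exact le_max_left _ _
    · split_ifs
      · exact h1
      · exact max_le h1 (lineOp_le_one P hB R ha _ _)

theorem seeded_antitone {B : ℕ} (hB : 2 ≤ B) (R : ℝ) (ha : IsKernel w a) {ε : ℝ} (h0 : 0 ≤ ε)
    (h1 : ε ≤ 1) {N : ℤ} (r : ℤ) : Antitone fun t => seeded P B R w a ε N t r := by
  refine antitone_nat_of_succ_le fun t => ?_
  induction t generalizing r with
  | zero =>
    simp only [seeded]
    split_ifs
    · exact le_rfl
    · exact max_le h1 (lineOp_le_one P hB R ha _ _)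
  | succ t ih =>
    rw [seeded, seeded]
    split_ifs
    · exact le_rfl
    · exact max_le_max le_rfl (lineOp_mono P B R ha
        (fun r => h0.trans ((seeded_props P hB R ha h0 h1 (t + 1)).2.1 r)) ih
        (seeded_props P hB R ha h0 h1 t).2.2 _)

/-- The sum of the profile over `0, …, N` decreases in time and is bounded below, so some step
changes it by less than `η`. A nearly stationary time replaces the limiting profile, which need not
be a fixed point without continuity. -/
theorem exists_seeded_le_succ {B : ℕ} (hB : 2 ≤ B) (R : ℝ) (ha : IsKernel w a) {ε : ℝ} (h0 : 0 ≤ ε)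
    (h1 : ε ≤ 1) (N : ℤ) {η : ℝ} (hη : 0 < η) : ∃ t, ∀ r, 0 ≤ r → r ≤ N →
      seeded P B R w a ε N t r ≤ seeded P B R w a ε N (t + 1) r + η := by
  set S : ℕ → ℝ := fun t => ∑ r ∈ Finset.Icc 0 N, seeded P B R w a ε N t r with hS
  have hanti := fun r => seeded_antitone P hB R ha h0 h1 (N := N) r
  have hSa : Antitone S := fun s t h => Finset.sum_le_sum fun r _ => hanti r h
  have hSb : BddBelow (Set.range S) := ⟨0, by
    rintro _ ⟨t, rfl⟩
    exact Finset.sum_nonneg fun r _ => h0.trans ((seeded_props P hB R ha h0 h1 t).2.1 r)⟩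
  have hl := tendsto_atTop_ciInf hSa hSb
  have hd := hl.sub ((tendsto_add_atTop_iff_nat 1).2 hl)
  rw [sub_self] at hd
  obtain ⟨t, ht⟩ := (hd.eventually (gt_mem_nhds hη)).exists
  refine ⟨t, fun r hr0 hrN => ?_⟩
  have h2 : seeded P B R w a ε N t r - seeded P B R w a ε N (t + 1) r ≤ S t - S (t + 1) := by
    rw [hS]
    simp only
    rw [← Finset.sum_sub_distrib]
    exact Finset.single_le_sum
      (f := fun r => seeded P B R w a ε N t r - seeded P B R w a ε N (t + 1) r)
      (fun q _ => sub_nonneg.2 (hanti q (Nat.le_succ t))) (Finset.mem_Icc.2 ⟨hr0, hrN⟩)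
  linarith

/-- The potential at the right end of a nearly stationary seeded profile. -/
theorem exists_seeded_potential_le (hP : FiniteEntropy P) {B : ℕ} (hB : 2 ≤ B) {R : ℝ} (hR : 0 < R)
    (ha : IsKernel w a) {κ : ℝ} (hκ : ∑ k ∈ Finset.Icc (-(w : ℤ)) (w + 1), |a k - a (k - 1)| ≤ κ)
    {ε σ η : ℝ} (h0 : 0 < ε) (h1 : ε ≤ 1) (hσ0 : 0 ≤ σ) (hσ : ε ≤ Tu P B R ε + σ) (hη : 0 < η)
    {N : ℤ} (hN : 0 ≤ N) : ∃ t,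
      2 * Real.log 2 * Fu P B R (seeded P B R w a ε N t N) ≤
        2 / R * condEnt P ε - ε * (invNoise P R ε).toReal + sectPot B (invNoise P R ε) +
          (invNoise P R ε).toReal * (κ + (η + σ)) := by
  obtain ⟨t, ht⟩ := exists_seeded_le_succ P hB R ha h0.le h1 N hη
  obtain ⟨hX, hXl, hXu⟩ := seeded_props P hB R ha h0.le h1 (N := N) t
  refine ⟨t, ?_⟩
  set X := seeded P B R w a ε N t with hXdef
  have hX0 : ∀ r, 0 < X r := fun r => h0.trans_le (hXl r)
  have hneg : ∀ r, r < 0 → X r = ε := fun r hr => by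
    rw [hXdef]; cases t <;> simp [seeded, hr]
  -- The profile lies above the constant `ε`, so its image lies above `Tu P B R ε`. Hence taking the
  -- maximum with `ε` costs at most `σ`.
  have hlow : ∀ r, ε ≤ lineOp P B R w a X r + σ := fun r => by
    have := lineOp_mono P B R ha (X := fun _ => ε) (fun _ => h0.le) hXl hXu r
    rw [lineOp_const P B R ha] at this
    linarith
  have key := potential_le_of_subsolution w a κ (η + σ) ε (X N) N hN ha.nonneg ha.supp ha.sum hκ
    (by linarith) (fun s => (invNoise P R s).toReal) (fun s => mse B (ENNReal.ofReal s))
    (fun s => 2 / R * condEnt P s) (fun s => sectPot B (ENNReal.ofReal s))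
    (fun s u hs hsu hu => toReal_invNoise_anti P hR (h0.trans_le hs) hsu (hu.trans (hXu N)))
    (fun _ _ _ => ENNReal.toReal_nonneg) (fun _ _ => mse_nonneg B _)
    (fun _ _ => mse_le_one B (by omega) _)
    (fun s u hs hsu hu => condEnt_sub_le_invNoise P hP hR (h0.trans_le hs) hsu (hu.trans (hXu N)))
    (fun s u hs hsu => mse_mul_le_sectPot_sub B hB hs hsu) X hX hneg
    (fun r hr => seeded_const P B R ε hN t hr) (fun r hr0 hrN => by
      rw [← lineOp_eq P B hR ha hX0]
      have h2 := ht r hr0 hrN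
      rw [seeded, if_neg (not_lt.2 hr0), min_eq_left hrN] at h2
      have h3 : max ε (lineOp P B R w a X r) ≤ lineOp P B R w a X r + σ :=
        max_le (hlow r) (by linarith)
      linarith)
  rw [Fu_eq P hP B (hX0 N).le (hXu N), ENNReal.toReal_mul, ENNReal.toReal_ofReal (hX0 N).le]
  simp only [ENNReal.ofReal_toReal (invNoise_ne_top P hR (hX0 N)),
    ENNReal.ofReal_toReal (invNoise_ne_top P hR h0)] at key
  exact key

end SFinite

end

section

/-! ### The bulk coupling kernel -/

variable {g : ℕ → ℝ → ℝ} {g₀ gL : ℝ} {w : ℕ}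

/-- The total design weight of a full window. -/
noncomputable def windowSum (g : ℕ → ℝ → ℝ) (w : ℕ) : ℝ :=
  ∑ k ∈ Finset.Icc (-(w : ℤ)) w, g w ((k : ℝ) / w)

/-- The normalized coupling in the bulk. -/
noncomputable def bulkKernel (g : ℕ → ℝ → ℝ) (w : ℕ) (k : ℤ) : ℝ :=
  g w ((k : ℝ) / w) / windowSum g w

theorem abs_div_le_one_iff (hw : 1 ≤ w) (k : ℤ) :
    |(k : ℝ) / w| ≤ 1 ↔ k ∈ Finset.Icc (-(w : ℤ)) w := by
  have hw0 : (0 : ℝ) < w := by exact_mod_cast hw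
  rw [abs_div, abs_of_pos hw0, div_le_one hw0, abs_le, Finset.mem_Icc]
  constructor
  · rintro ⟨h1, h2⟩; exact ⟨by exact_mod_cast h1, by exact_mod_cast h2⟩
  · rintro ⟨h1, h2⟩; exact ⟨by exact_mod_cast h1, by exact_mod_cast h2⟩

theorem IsDesign.nonneg (hg : IsDesign g g₀ gL) (hw : 1 ≤ w) (x : ℝ) : 0 ≤ g w x := by
  rcases le_or_gt |x| 1 with h | h
  · exact hg.pos.le.trans (hg.le w hw x h)
  · exact (hg.eq_zero w hw x h).ge

theorem IsDesign.lipschitz_nonneg (hg : IsDesign g g₀ gL) : 0 ≤ gL := by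
  have := (abs_nonneg _).trans (hg.lipschitz 1 le_rfl 1 0 (by simp) (by simp))
  simpa using this

theorem card_window (w : ℕ) : ((Finset.Icc (-(w : ℤ)) w).card : ℝ) = 2 * w + 1 := by
  rw [Int.card_Icc, show ((w : ℤ) + 1 - -(w : ℤ)).toNat = 2 * w + 1 by omega]
  push_cast; ring

theorem le_windowSum {m : ℝ}
    (hm : ∀ k ∈ Finset.Icc (-(w : ℤ)) w, m ≤ g w ((k : ℝ) / w)) :
    (2 * w + 1) * m ≤ windowSum g w := by
  rw [← card_window, ← nsmul_eq_mul]
  exact Finset.card_nsmul_le_sum _ _ _ hm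

theorem IsDesign.le_windowSum_floor (hg : IsDesign g g₀ gL) (hw : 1 ≤ w) :
    (2 * w + 1) * g₀ ≤ windowSum g w :=
  le_windowSum fun k hk => hg.le w hw _ ((abs_div_le_one_iff hw k).2 hk)

theorem IsDesign.windowSum_pos (hg : IsDesign g g₀ gL) (hw : 1 ≤ w) : 0 < windowSum g w :=
  (mul_pos (by positivity) hg.pos).trans_le (hg.le_windowSum_floor hw)

theorem IsDesign.isKernel (hg : IsDesign g g₀ gL) (hw : 1 ≤ w) : IsKernel w (bulkKernel g w) where
  nonneg k := div_nonneg (hg.nonneg hw _) (hg.windowSum_pos hw).le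
  supp k hk := by
    rw [bulkKernel, hg.eq_zero w hw _ (not_le.1 fun h => hk ((abs_div_le_one_iff hw k).1 h)),
      zero_div]
  sum := by
    unfold bulkKernel
    rw [← Finset.sum_div]
    exact div_self (hg.windowSum_pos hw).ne'

/-- Arguments in a window differ by at most 2, so each value exceeds the window average by at most
`2 * gL`, while the average is at least `g₀`. -/
theorem IsDesign.bulkKernel_le (hg : IsDesign g g₀ gL) (hw : 1 ≤ w) (k : ℤ) :
    bulkKernel g w k ≤ (1 + 2 * gL / g₀) / (2 * w + 1) := by
  have hS := hg.windowSum_pos hw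
  have hL := hg.lipschitz_nonneg
  have h0 := hg.pos
  by_cases hk : k ∈ Finset.Icc (-(w : ℤ)) w
  · have h1 : (2 * w + 1) * (g w ((k : ℝ) / w) - 2 * gL) ≤ windowSum g w := by
      refine le_windowSum fun j hj => ?_
      have hk' := (abs_div_le_one_iff hw k).2 hk
      have hj' := (abs_div_le_one_iff hw j).2 hj
      have h2 := (le_abs_self _).trans (hg.lipschitz w hw _ _ hk' hj')
      have h3 : |(k : ℝ) / w - (j : ℝ) / w| ≤ 2 :=
        (abs_sub _ _).trans (by linarith)
      nlinarith
    have h2 := hg.le_windowSum_floor hw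
    have hw' : (0 : ℝ) < 2 * w + 1 := by positivity
    rw [bulkKernel, div_le_div_iff₀ hS hw']
    have h3 : 2 * gL * (2 * w + 1) ≤ 2 * gL / g₀ * windowSum g w := by
      rw [div_mul_eq_mul_div, le_div_iff₀ h0]
      nlinarith
    nlinarith
  · rw [(hg.isKernel hw).supp k hk]
    positivity

/-- The two jumps at the ends of the window are bounded by `bulkKernel_le`; each of the `2 * w`
interior increments is at most `gL / w` before normalization. -/
theorem IsDesign.variation_le (hg : IsDesign g g₀ gL) (hw : 1 ≤ w) :
    ∑ k ∈ Finset.Icc (-(w : ℤ)) (w + 1), |bulkKernel g w k - bulkKernel g w (k - 1)| ≤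
      (2 * (1 + 2 * gL / g₀) + 2 * gL / g₀) / (2 * w + 1) := by
  have hS := hg.windowSum_pos hw
  have hL := hg.lipschitz_nonneg
  have h0 := hg.pos
  have hK := hg.isKernel hw
  have hw0 : (0 : ℝ) < w := by exact_mod_cast hw
  have e1 : Finset.Icc (-(w : ℤ)) (w + 1) =
      insert (-(w : ℤ)) (insert ((w : ℤ) + 1) (Finset.Icc (-(w : ℤ) + 1) w)) := by
    ext x; simp only [Finset.mem_Icc, Finset.mem_insert]; omega
  rw [e1, Finset.sum_insert (by simp; omega), Finset.sum_insert (by simp),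
    hK.supp (-(w : ℤ) - 1) (by simp), hK.supp ((w : ℤ) + 1) (by simp), sub_zero, zero_sub,
    abs_neg, abs_of_nonneg (hK.nonneg _), abs_of_nonneg (hK.nonneg _)]
  have hmid : ∑ k ∈ Finset.Icc (-(w : ℤ) + 1) w, |bulkKernel g w k - bulkKernel g w (k - 1)| ≤
      2 * gL / g₀ / (2 * w + 1) := by
    have h1 : ∀ k ∈ Finset.Icc (-(w : ℤ) + 1) w,
        |bulkKernel g w k - bulkKernel g w (k - 1)| ≤ gL / w / windowSum g w := fun k hk => by
      rw [Finset.mem_Icc] at hk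
      rw [bulkKernel, bulkKernel, ← sub_div, abs_div, abs_of_pos hS]
      refine div_le_div_of_nonneg_right ?_ hS.le
      refine (hg.lipschitz w hw _ _ ((abs_div_le_one_iff hw k).2 (by simp; omega))
        ((abs_div_le_one_iff hw (k - 1)).2 (by simp; omega))).trans_eq ?_
      rw [← sub_div]
      push_cast
      rw [show (k : ℝ) - (k - 1) = 1 by ring, abs_of_pos (by positivity)]
      ring
    refine (Finset.sum_le_card_nsmul _ _ _ h1).trans ?_
    rw [Int.card_Icc, show ((w : ℤ) + 1 - (-(w : ℤ) + 1)).toNat = 2 * w by omega, nsmul_eq_mul]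
    have h2 := hg.le_windowSum_floor hw
    calc _ = 2 * gL / windowSum g w := by push_cast; field_simp
      _ ≤ 2 * gL / ((2 * w + 1) * g₀) := by gcongr
      _ = _ := by field_simp
  have h1 := hg.bulkKernel_le hw (-(w : ℤ))
  have h2 := hg.bulkKernel_le hw ((w : ℤ) + 1 - 1)
  calc _ ≤ (1 + 2 * gL / g₀) / (2 * w + 1) + ((1 + 2 * gL / g₀) / (2 * w + 1) +
        2 * gL / g₀ / (2 * w + 1)) := by gcongr
    _ = _ := by ring

/-! ### Coupled state evolution is dominated by the recursion on the line -/

theorem sum_fin_eq_window {M : Type*} [AddCommMonoid M] {Γ : ℕ} (F : ℤ → M) (r : ℤ)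
    (h0 : (w : ℤ) ≤ r) (h1 : r + w < Γ) (hF : ∀ c, c - r ∉ Finset.Icc (-(w : ℤ)) w → F c = 0) :
    ∑ c : Fin Γ, F ((c : ℕ) : ℤ) = ∑ k ∈ Finset.Icc (-(w : ℤ)) w, F (r + k) := by
  rw [Fin.sum_univ_eq_sum_range (fun c : ℕ => F (c : ℤ)) Γ]
  refine (Finset.sum_of_injOn (fun k : ℤ => (r + k).toNat) ?_ ?_ ?_ ?_).symm
  · intro x hx y hy hxy
    simp only [Finset.coe_Icc, Set.mem_Icc] at hx hy
    simp only at hxy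
    omega
  · intro x hx
    simp only [Finset.coe_Icc, Set.mem_Icc] at hx
    simp only [Finset.coe_range, Set.mem_Iio]
    omega
  · intro c _ hc
    refine hF _ fun h => hc ⟨(c : ℤ) - r, by exact_mod_cast h, ?_⟩
    simp
  · intro x hx
    rw [Finset.mem_Icc] at hx
    rw [Int.toNat_of_nonneg (by omega)]

theorem sum_fin_eq_window_neg {M : Type*} [AddCommMonoid M] {Γ : ℕ} (F : ℤ → M) (r : ℤ)
    (h0 : (w : ℤ) ≤ r) (h1 : r + w < Γ) (hF : ∀ c, r - c ∉ Finset.Icc (-(w : ℤ)) w → F c = 0) :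
    ∑ c : Fin Γ, F ((c : ℕ) : ℤ) = ∑ k ∈ Finset.Icc (-(w : ℤ)) w, F (r - k) := by
  rw [sum_fin_eq_window F r h0 h1 fun c hc => hF c fun h => hc (by
    rw [Finset.mem_Icc] at *; omega)]
  refine Finset.sum_nbij' (fun k => -k) (fun k => -k) ?_ ?_ ?_ ?_ ?_
  · intro k hk; rw [Finset.mem_Icc] at *; omega
  · intro k hk; rw [Finset.mem_Icc] at *; omega
  · simp
  · simp
  · intro k _; rw [sub_neg_eq_add]

theorem J_div_eq (g : ℕ → ℝ → ℝ) {Γ : ℕ} (r c : Fin Γ) : J g Γ w r c / Γ =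
    g w (((r : ℝ) - (c : ℝ)) / w) / ∑ c : Fin Γ, g w (((r : ℝ) - (c : ℝ)) / w) := by
  have hΓ : (Γ : ℝ) ≠ 0 := by exact_mod_cast r.pos.ne'
  have h2 : (2 * w + 1 : ℝ) ≠ 0 := by positivity
  unfold J rowFactor
  field_simp

theorem IsDesign.J_nonneg (hg : IsDesign g g₀ gL) (hw : 1 ≤ w) {Γ : ℕ} (r c : Fin Γ) :
    0 ≤ J g Γ w r c / Γ := by
  rw [J_div_eq]
  exact div_nonneg (hg.nonneg hw _) (Finset.sum_nonneg fun _ _ => hg.nonneg hw _)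

theorem IsDesign.J_eq_bulkKernel (hg : IsDesign g g₀ gL) (hw : 1 ≤ w) {Γ : ℕ} {r : Fin Γ}
    (h0 : w ≤ (r : ℕ)) (h1 : (r : ℕ) + w < Γ) (c : Fin Γ) :
    J g Γ w r c / Γ = bulkKernel g w (((r : ℕ) : ℤ) - ((c : ℕ) : ℤ)) := by
  have hsum : ∑ c : Fin Γ, g w (((r : ℝ) - (c : ℝ)) / w) = windowSum g w := by
    have := sum_fin_eq_window_neg (w := w) (Γ := Γ)
      (fun c : ℤ => g w ((((r : ℕ) : ℤ) - c : ℤ) / w : ℝ)) ((r : ℕ) : ℤ) (by omega) (by omega)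
      (fun c hc => hg.eq_zero w hw _ (not_le.1 fun h => hc ((abs_div_le_one_iff hw _).1 h)))
    simp only [sub_sub_cancel] at this
    rw [windowSum, ← this]
    exact Finset.sum_congr rfl fun c _ => by push_cast; rfl
  rw [J_div_eq, hsum, bulkKernel]
  push_cast
  rfl

variable {Y : Type*} [MeasurableSpace Y] {ν : Measure Y} (P : MemorylessChannel ν)

theorem exists_gap_le {B : ℕ} {R : ℝ} (h : 0 < gap P B R) : ∃ δ : ℝ, 0 < δ ∧
    ∀ E ∈ Set.Icc (0 : ℝ) 1 \ basin P B R, δ ≤ Fu P B R E - Fu P B R (floorMSE P B R) := by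
  obtain ⟨δ, h1, h2⟩ := EReal.lt_iff_exists_real_btwn.1 h
  refine ⟨δ, by exact_mod_cast h1, fun E hE => ?_⟩
  exact_mod_cast h2.le.trans (iInf₂_le E hE)

section SFinite

variable [SFinite ν]

theorem IsDesign.Tc_mono (hg : IsDesign g g₀ gL) (hw : 1 ≤ w) (B : ℕ) (R : ℝ) {Γ : ℕ}
    {E E' : Fin Γ → ℝ} (h0 : ∀ r, 0 ≤ E r) (h : ∀ r, E r ≤ E' r) (h1 : ∀ r, E' r ≤ 1)
    (r : Fin Γ) : Tc P B g R Γ w E r ≤ Tc P B g R Γ w E' r := by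
  unfold Tc blockInvNoise
  refine Finset.sum_le_sum fun c _ =>
    mul_le_mul_of_nonneg_left (mse_antitone B ?_) (hg.J_nonneg hw r c)
  exact Finset.sum_le_sum fun r' _ => by
    gcongr
    exact invNoise_antitoneOn P R (h0 _) (h _) (h1 _)

/-- An unpinned `r` is at distance at least `3 * w` from the boundary. It couples to columns `c`
within `w` of it, and these to rows `q` within `w` of `c`. All rows involved therefore have full
windows, and their normalized couplings are the bulk kernel. -/
theorem IsDesign.Tc_le_lineOp (hg : IsDesign g g₀ gL) (hw : 1 ≤ w) (B : ℕ) (R : ℝ) {Γ : ℕ}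
    {E : Fin Γ → ℝ} {X : ℤ → ℝ} (h0 : ∀ r, 0 ≤ E r) (h : ∀ r : Fin Γ, E r ≤ X ((r : ℕ) : ℤ))
    (h1 : ∀ r, X r ≤ 1) {r : Fin Γ} (hr : ¬Pinned Γ w r) :
    Tc P B g R Γ w E r ≤ lineOp P B R w (bulkKernel g w) X ((r : ℕ) : ℤ) := by
  have hK := hg.isKernel hw
  simp only [Pinned, not_or, not_le] at hr
  obtain ⟨hr0, hr1⟩ := hr
  set K : ℤ → ℝ := fun c => mse B (∑ l ∈ Finset.Icc (-(w : ℤ)) w,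
    ENNReal.ofReal (bulkKernel g w l) * invNoise P R (X (c + l))) with hKdef
  have e : lineOp P B R w (bulkKernel g w) X ((r : ℕ) : ℤ) =
      ∑ c : Fin Γ, bulkKernel g w (((r : ℕ) : ℤ) - ((c : ℕ) : ℤ)) * K ((c : ℕ) : ℤ) := by
    have := sum_fin_eq_window_neg (w := w) (Γ := Γ)
      (fun c : ℤ => bulkKernel g w (((r : ℕ) : ℤ) - c) * K c) ((r : ℕ) : ℤ) (by omega) (by omega)
      (fun c hc => by rw [hK.supp _ hc, zero_mul])
    rw [this]
    simp only [sub_sub_cancel]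
    rfl
  rw [e, Tc]
  refine Finset.sum_le_sum fun c _ => ?_
  rw [hg.J_eq_bulkKernel hw (by omega) (by omega)]
  by_cases hc : ((r : ℕ) : ℤ) - ((c : ℕ) : ℤ) ∈ Finset.Icc (-(w : ℤ)) w
  swap
  · rw [hK.supp _ hc, zero_mul, zero_mul]
  rw [Finset.mem_Icc] at hc
  refine mul_le_mul_of_nonneg_left (mse_antitone B ?_) (hK.nonneg _)
  have e2 := sum_fin_eq_window (w := w) (Γ := Γ) (fun q : ℤ =>
    ENNReal.ofReal (bulkKernel g w (q - ((c : ℕ) : ℤ))) * invNoise P R (X q)) ((c : ℕ) : ℤ)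
    (by omega) (by omega) (fun q hq => by rw [hK.supp _ hq, ENNReal.ofReal_zero, zero_mul])
  simp only [add_sub_cancel_left] at e2
  rw [← e2, blockInvNoise]
  refine Finset.sum_le_sum fun q _ => ?_
  by_cases hq : ((q : ℕ) : ℤ) - ((c : ℕ) : ℤ) ∈ Finset.Icc (-(w : ℤ)) w
  · rw [Finset.mem_Icc] at hq
    rw [hg.J_eq_bulkKernel hw (by omega) (by omega)]
    gcongr
    exact invNoise_antitoneOn P R (h0 _) (h _) (h1 _)
  · rw [hK.supp _ hq, ENNReal.ofReal_zero, zero_mul]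
    exact zero_le

end SFinite

theorem IsDesign.Tc_mem (hg : IsDesign g g₀ gL) (hw : 1 ≤ w) {B : ℕ} (hB : 2 ≤ B) (R : ℝ) {Γ : ℕ}
    (E : Fin Γ → ℝ) (r : Fin Γ) : Tc P B g R Γ w E r ∈ Set.Icc (0 : ℝ) 1 := by
  refine ⟨Finset.sum_nonneg fun c _ => mul_nonneg (hg.J_nonneg hw r c) (mse_nonneg B _), ?_⟩
  rw [← sum_J g g₀ gL hg Γ w hw r]
  exact Finset.sum_le_sum fun c _ =>
    mul_le_of_le_one_right (hg.J_nonneg hw r c) (mse_le_one B (by omega) _)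

theorem IsDesign.seProfile_mem (hg : IsDesign g g₀ gL) (hw : 1 ≤ w) {B : ℕ} (hB : 2 ≤ B) (R : ℝ)
    {Γ : ℕ} (t : ℕ) (r : Fin Γ) : seProfile P B g R Γ w t r ∈ Set.Icc (0 : ℝ) 1 := by
  cases t <;> simp only [seProfile, pin] <;> split_ifs <;>
    first | exact hg.Tc_mem P hw hB R _ _ | simp

theorem seProfile_pinned (B : ℕ) (R : ℝ) {Γ : ℕ} (t : ℕ) {r : Fin Γ} (hr : Pinned Γ w r) :
    seProfile P B g R Γ w t r = 0 := by
  cases t <;> simp [seProfile, pin, hr]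

variable [SFinite ν]

theorem IsDesign.seProfile_antitone (hg : IsDesign g g₀ gL) (hw : 1 ≤ w) {B : ℕ} (hB : 2 ≤ B)
    (R : ℝ) {Γ : ℕ} (r : Fin Γ) : Antitone fun t => seProfile P B g R Γ w t r := by
  refine antitone_nat_of_succ_le fun t => ?_
  induction t generalizing r with
  | zero =>
    simp only [seProfile, pin]
    split_ifs
    · exact le_rfl
    · exact (hg.Tc_mem P hw hB R _ _).2
  | succ t ih =>
    rw [seProfile, seProfile, pin, pin]
    split_ifs
    · exact le_rfl
    · exact hg.Tc_mono P hw B R (fun q => (hg.seProfile_mem P hw hB R (t + 1) q).1) ih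
        (fun q => (hg.seProfile_mem P hw hB R t q).2) r

theorem IsDesign.tendsto_TcLim (hg : IsDesign g g₀ gL) (hw : 1 ≤ w) {B : ℕ} (hB : 2 ≤ B) (R : ℝ)
    {Γ : ℕ} (r : Fin Γ) :
    Tendsto (fun t => seProfile P B g R Γ w t r) atTop (𝓝 (TcLim P B g R Γ w r)) := by
  have h : Tendsto (seProfile P B g R Γ w) atTop (𝓝 (TcLim P B g R Γ w)) := by
    refine tendsto_nhds_limUnder ⟨fun r => ⨅ t, seProfile P B g R Γ w t r, ?_⟩
    refine tendsto_pi_nhds.2 fun r => tendsto_atTop_ciInf (hg.seProfile_antitone P hw hB R r)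
      ⟨0, ?_⟩
    rintro _ ⟨t, rfl⟩
    exact (hg.seProfile_mem P hw hB R t r).1
  exact tendsto_pi_nhds.1 h r

/-- Pinned positions carry 0, below any value of the seeded profile, and at unpinned ones the two
recursions compare by monotonicity. Forgetting the right-hand pinning only raises the bound. -/
theorem IsDesign.seProfile_le_seeded (hg : IsDesign g g₀ gL) (hw : 1 ≤ w) {B : ℕ} (hB : 2 ≤ B)
    (R : ℝ) {Γ : ℕ} {ε : ℝ} (h0 : 0 ≤ ε) (h1 : ε ≤ 1) (t : ℕ) (r : Fin Γ) :
    seProfile P B g R Γ w t r ≤ seeded P B R w (bulkKernel g w) ε Γ t ((r : ℕ) : ℤ) := by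
  have hp := fun t => seeded_props P hB R (hg.isKernel hw) h0 h1 (N := (Γ : ℤ)) t
  by_cases hr : Pinned Γ w r
  · rw [seProfile_pinned P B R t hr]
    exact h0.trans ((hp t).2.1 _)
  have hrn : ¬ ((r : ℕ) : ℤ) < 0 := by omega
  induction t generalizing r with
  | zero => rw [seProfile, seeded, pin, if_neg hr, if_neg hrn]
  | succ t ih =>
    rw [seProfile, seeded, pin, if_neg hr, if_neg hrn, min_eq_left (by have := r.2; omega)]
    refine le_max_of_le_right ?_
    refine hg.Tc_le_lineOp P hw B R (fun q => (hg.seProfile_mem P hw hB R t q).1) (fun q => ?_)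
      (hp t).2.2 hr
    by_cases hq : Pinned Γ w q
    · rw [seProfile_pinned P B R t hq]
      exact h0.trans ((hp t).2.1 _)
    · exact ih q hq (by omega)

/-- On a constant profile the coupled operator in the bulk is the scalar one, and pinning only
lowers values. -/
theorem IsDesign.seProfile_add_le (hg : IsDesign g g₀ gL) (hw : 1 ≤ w) {B : ℕ} (hB : 2 ≤ B)
    (R : ℝ) {Γ : ℕ} {t : ℕ} {x : ℝ} (hx : x ∈ Set.Icc (0 : ℝ) 1)
    (h : ∀ r : Fin Γ, seProfile P B g R Γ w t r ≤ x) (s : ℕ) (r : Fin Γ) :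
    seProfile P B g R Γ w (t + s) r ≤ (Tu P B R)^[s] x := by
  induction s generalizing r with
  | zero => exact h r
  | succ s ih =>
    have hm := iterate_Tu_mem P hB R hx
    rw [← add_assoc, seProfile, pin]
    split_ifs with hr
    · exact (hm (s + 1)).1
    · rw [Function.iterate_succ_apply', ← lineOp_const P B R (hg.isKernel hw) _ ((r : ℕ) : ℤ)]
      exact hg.Tc_le_lineOp P hw B R (fun q => (hg.seProfile_mem P hw hB R _ q).1) ih
        (fun _ => (hm s).2) hr

/-- Once the profile is below a point of the basin of attraction, decoding succeeds. -/
theorem IsDesign.coupledSucceeds_of_basin (hg : IsDesign g g₀ gL) (hw : 1 ≤ w) {B : ℕ} (hB : 2 ≤ B)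
    (R : ℝ) {Γ : ℕ} (hΓ : 0 < Γ) {t : ℕ} {x : ℝ} (hx : x ∈ basin P B R)
    (h : ∀ r : Fin Γ, seProfile P B g R Γ w t r ≤ x) : CoupledSucceeds P B g Γ w R := by
  have hle : ∀ r, TcLim P B g R Γ w r ≤ floorMSE P B R := fun r => by
    have h1 := hg.tendsto_TcLim P hw hB R r
    have h2 := tendsto_TuLim P hB R hx.1
    rw [hx.2] at h2
    refine le_of_tendsto_of_tendsto' ((tendsto_add_atTop_iff_nat t).2 h1) h2 fun s => ?_
    rw [add_comm]
    exact hg.seProfile_add_le P hw hB R hx.1 h s r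
  have hge : ∀ r, 0 ≤ TcLim P B g R Γ w r := fun r =>
    ge_of_tendsto' (hg.tendsto_TcLim P hw hB R r) fun t => (hg.seProfile_mem P hw hB R t r).1
  rcases (floorMSE_mem P hB R).1.eq_or_lt with h0 | h0
  · exact Or.inr ⟨h0.symm, funext fun r => le_antisymm (hle r) (h0.symm.le.trans (hge r))⟩
  -- Strictness comes from the first position: it is pinned at 0, while the floor is positive.
  · refine Or.inl ⟨hle, ⟨0, hΓ⟩, ?_⟩
    have hp : Pinned Γ w ⟨0, hΓ⟩ := Or.inl (by simp only; omega)
    have : TcLim P B g R Γ w ⟨0, hΓ⟩ = 0 :=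
      tendsto_nhds_unique (hg.tendsto_TcLim P hw hB R _)
        (by simp only [seProfile_pinned P B R _ hp]; exact tendsto_const_nhds)
    rwa [this]

/-! ### Threshold saturation -/

/-- A positive seed value whose potential is close to that of the floor. -/
theorem exists_seed (hP : FiniteEntropy P) {B : ℕ} (hB : 2 ≤ B) {R δ : ℝ} (hR : 0 < R)
    (hδ : 0 < δ) : ∃ ε σ : ℝ, 0 < ε ∧ ε ≤ 1 ∧ 0 ≤ σ ∧ ε ≤ Tu P B R ε + σ ∧
      2 / R * condEnt P ε - ε * (invNoise P R ε).toReal + sectPot B (invNoise P R ε) +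
        (invNoise P R ε).toReal * σ ≤ 2 * Real.log 2 * Fu P B R (floorMSE P B R) + δ := by
  have hm := floorMSE_mem P hB R
  rcases hm.1.eq_or_lt with h0 | h0
  · obtain ⟨ε, hε0, -, hε1, hε⟩ := exists_condEnt_le P hP (δ := δ * R / 2) (ρ := 1)
      (by positivity) one_pos
    -- Taking `σ = ε` makes the subsolution condition trivial, and the two terms `ε` times the
    -- inverse noise cancel, however large that noise term is.
    refine ⟨ε, ε, hε0, hε1, hε0.le, by linarith [Tu_nonneg P B R ε], ?_⟩
    rw [← h0, Fu_eq P hP B le_rfl zero_le_one]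
    have h1 := sectPot_mono B hB (invNoise_antitoneOn P R le_rfl hε0.le hε1)
    have h2 : 2 / R * condEnt P ε ≤ 2 / R * (condEnt P 0 + δ * R / 2) := by gcongr
    have h3 : 2 / R * (condEnt P 0 + δ * R / 2) = 2 / R * condEnt P 0 + δ := by field_simp
    simp only [ENNReal.ofReal_zero, zero_mul, ENNReal.toReal_zero]
    linarith
  · refine ⟨floorMSE P B R, 0, h0, hm.2, le_rfl, by linarith [floorMSE_le_Tu P hB R], ?_⟩
    rw [Fu_eq P hP B hm.1 hm.2, ENNReal.toReal_mul, ENNReal.toReal_ofReal hm.1]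
    linarith

theorem IsDesign.eventually_coupledSucceeds (hP : FiniteEntropy P) {B : ℕ} (hB : 2 ≤ B)
    (hg : IsDesign g g₀ gL) {R : ℝ} (hR : 0 < R) (hgap : 0 < gap P B R) :
    ∀ᶠ w : ℕ in atTop, ∀ Γ : ℕ, 0 < Γ → CoupledSucceeds P B g Γ w R := by
  obtain ⟨δ, hδ, hgap⟩ := exists_gap_le P hgap
  have hl2 : 0 < Real.log 2 := Real.log_pos (by norm_num)
  -- The gap leaves room `2 * Real.log 2 * δ`: half is spent on the seed, a quarter on the variation
  -- of the kernel, a quarter on the stationarity error `η`.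
  have hδ' : 0 < Real.log 2 * δ := by positivity
  obtain ⟨ε, σ, hε0, hε1, hσ0, hσ, hseed⟩ := exists_seed P hP hB hR hδ'
  set H := (invNoise P R ε).toReal with hH
  have hH0 : 0 ≤ H := ENNReal.toReal_nonneg
  set C := 2 * (1 + 2 * gL / g₀) + 2 * gL / g₀
  have hlim : Tendsto (fun w : ℕ => H * (C / (2 * (w : ℝ) + 1))) atTop (𝓝 0) := by
    have : Tendsto (fun w : ℕ => 2 * (w : ℝ) + 1) atTop atTop :=
      tendsto_atTop_add_const_right _ _
        (tendsto_natCast_atTop_atTop.const_mul_atTop (by norm_num))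
    simpa using (this.const_div_atTop C).const_mul H
  filter_upwards [hlim.eventually (gt_mem_nhds (half_pos hδ')), eventually_ge_atTop 1]
    with w hw hw1 Γ hΓ
  -- Dividing by `H + 1` covers the case `H = 0`. The condition on `w` was fixed before `Γ`, so the
  -- conclusion is uniform in `Γ`.
  have hη : 0 < Real.log 2 * δ / 2 / (H + 1) := by positivity
  obtain ⟨t, ht⟩ := exists_seeded_potential_le P hP hB hR (hg.isKernel hw1) (hg.variation_le hw1)
    hε0 hε1 hσ0 hσ hη (N := (Γ : ℤ)) (by omega)
  obtain ⟨hX, hXl, hXu⟩ := seeded_props P hB R (hg.isKernel hw1) hε0.le hε1 (N := (Γ : ℤ)) t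
  set x := seeded P B R w (bulkKernel g w) ε Γ t Γ with hx
  have hxm : x ∈ Set.Icc (0 : ℝ) 1 := ⟨hε0.le.trans (hXl _), hXu _⟩
  refine hg.coupledSucceeds_of_basin P hw1 hB R hΓ (t := t) (x := x) ?_ fun r =>
    (hg.seProfile_le_seeded P hw1 hB R hε0.le hε1 t r).trans (hX (by have := r.2; omega))
  by_contra hxb
  have h1 := hgap x ⟨hxm, hxb⟩
  have h2 : H * (Real.log 2 * δ / 2 / (H + 1)) < Real.log 2 * δ / 2 := by
    rw [← mul_div_assoc, div_lt_iff₀ (by linarith)]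
    nlinarith
  have h3 := mul_le_mul_of_nonneg_left h1 hl2.le
  nlinarith

end

end SparseSuperposition

theorem mainTheorem2 {Y : Type*} [MeasurableSpace Y] (ν : Measure Y) [SigmaFinite ν]
    (P : SparseSuperposition.MemorylessChannel ν) (hP : SparseSuperposition.FiniteEntropy P)
    (B : ℕ) (hB : 2 ≤ B)
    (g : ℕ → ℝ → ℝ) (g₀ gL : ℝ) (hg : SparseSuperposition.IsDesign g g₀ gL) :
    SparseSuperposition.Rc P B g ≥ SparseSuperposition.Rpot P B := by
  refine iSup₂_le fun R hR => ?_
  refine le_liminf_of_le (by isBoundedDefault) ?_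
  filter_upwards [hg.eventually_coupledSucceeds P hP hB hR.1 hR.2] with w hw
  refine le_liminf_of_le (by isBoundedDefault) ?_
  filter_upwards [eventually_gt_atTop 0] with Γ hΓ
  exact le_iSup₂_of_le R ⟨hR.1, hw Γ hΓ⟩ le_rfl
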